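/- **Setting.** A *context* is a finite set of variables, from a fixed countably infinite set with a distinguished variable $*$. For sets $X, M$, $\mathrm{Val}(X,M)$ is the set of relations $v\subseteq X\times M$ such that each $x\in X$ is related to some $a\in M$ to which no other element of $X$ is related, and each $a\in M$ is related to some $x\in X$. Put $[x]_v=\{a: x\,v\,a\}$, and let $[x]_{\pi_v}$ be the set of $a\in[x]_v$ lying in no other $[x']_v$. If $w\in \mathrm{Val}(Y,M)$ and $\ge\,\in \mathrm{Val}(X,Y)$, then $C_\ge(w)={\ge}\circ w\in \mathrm{Val}(X,M)$ is a *consolidation* of $w$, and $w$ a *fragmentation* of it. Formulas $\phi(X)$ over a relational signature $L$ are given by $\bot\mid R(\bar x)\mid\neg\phi(X)\mid\phi(X)\wedge\psi(X)\mid\exists^{\rm fr}_{\ge}\phi(Y)$, with $\bar x$ a tuple in $X$ and $\ge\,\in \mathrm{Val}(X,Y)$. An $n$-*type* is a set of formulas in one context of size $n$; sentences are formulas in the context $\{*\}$; a theory is a set of sentences. A *structure* is a non-empty first-order $L$-structure $M$ with a non-empty family $V$ of ("admissible") co-valuations on $M$ in contexts, closed under consolidations by contexts. Write $V^X$ for the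 members of $V$ in context $X$. For $v\in V^X$, $M\models_v R(\bar x)$ iff $R^M$ meets $\prod_k[x_k]_v$; $M\models_v\exists^{\rm fr}_\ge\phi$ iff $v=C_\ge(w)$ and $M\models_w\phi$ for some $w\in V$; $\bot,\neg,\wedge$ are as usual. It is required that (I) any $u,v\in V$ have a common fragmentation in $V$; (II) if $M\models_vR(\bar x)$, there is a *witness*: some $w\in V^Y$ and tuples $\bar y$ in $Y$, $\bar a$ in $M$ with $a_k\in[y_k]_{\pi_w}$, $[y_k]_w\subseteq[x_k]_v$ for all $k$, and $R^M(\bar a)$. A type $p(X)$ is realized in $M$ if some $v\in V^X$ satisfies all of $p$, and omitted otherwise. A *core* of $M$ is a sequence $v_i\in V$ such that $v_i$ is a consolidation of $v_{i+1}$ and each member of $V$ is a consolidation of some $v_i$. A *compact $\omega$-structure* is a structure that has a core and carries a compact $T_1$ topology in which every $[x]_v$ ($v \in V$) is open, every open cover is refined by $\{[x]_v: x\in X\}$ for some $X$ and $v\in V^X$, and all $R^M$ are closed. For a theory $T$ and a context $X$ of size $n$, $S_n(T)$ is the set of complete types $p(X)$ realized in models of $T$, with the topology generated by the sets $[\phi]=\{p:\phi\in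 p\}$. A type $p(X)$ is *isolated* (over $T$) if there is a formula $\phi(X)$, satisfied somewhere in some model of $T$, such that $M\models_v\phi$ implies $M\models_v\psi$ for all $\psi\in p$, all models $M$ of $T$ and all $v\in V^X$. **The space $\mathrm{Mod}(T)$.** Let $L$ be countable. Fix contexts $X_i$ with $|X_0|=1$, $|X_{i+1}|=2^{|X_i|}$. A code $\mu$ consists of relations in $\mathrm{Val}(X_i,X_{i+1})$, $i\in\mathbb N$, generating (as reflexive-transitive closure) an order $\ge_\mu$ on $\mathbb P=\bigsqcup_iX_i$, and, for each $R\in L$ and $i$, a set of tuples $b_R\subseteq X_i^{a(R)}$, where $a(R)$ is the arity of $R$. A *band* is a finite $B\subseteq\mathbb P$ such that every $p\in\mathbb P$ is comparable with some $b\in B$; a *cap* is a set $C$ such that, for some band $B$, each $b\in B$ is below some $c\in C$; a *selector* is a set meeting all caps. Let $M_\mu$ be the set of minimal selectors, with co-valuations $v_i=\{(x,S)\in X_i\times M_\mu:x\in S\}$, with all consolidations of the $v_i$ as admissible co-valuations, and with $R^{M_\mu}(\bar S)$ iff $b_R(\bar x)$ for all $i$ and all $\bar x$ in $X_i$ with $x_k\in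 S_k$ for all $k$. Given a function $\beta$ assigning a natural number to each triple $(i,R,\bar x)$ with $\bar x\in X_i^{a(R)}$, $\mathrm{Mod}(L)=\mathrm{Mod}_\beta(L)$ is the set of codes such that * if $b_R(\bar y)$ and $\bar x\ge_\mu\bar y$ coordinatewise (each tuple being in a single level), then $b_R(\bar x)$; * if $b_R(\bar x)$, $\bar x$ in $X_i$, then there are $j\le\beta(i,R,\bar x)$, a minimal cover $\mathcal A$ of the set $X_j$ and $A_k\in\mathcal A$ with $x_k\ge_\mu z$ for all $z\in A_k$, such that for each $j'\ge j$ there is $\bar y$ in $X_{j'}$ with $b_R(\bar y)$ and such that $z\in X_j$, $z\ge_\mu y_k$ imply $z\in A_k$. $\beta$ is *adequate* if every infinite compact $\omega$-structure has a core $(v_i)$ with $v_i$ in context $X_i$ such that whenever $M\models_{v_i}R(\bar x)$, a witness as in (II) for $R,v_i,\bar x$ can be found among the consolidations of $v_j$ for some $j\le\beta(i,R,\bar x)$. The *logic topology* on $\mathrm{Mod}(L)$ has as sub-basic open sets the sets of all $\mu$ for which $\ge_\mu$ restricted to $\bigsqcup_{i'\le i}X_{i'}$ is a given relation, and the sets $\{\mu:M_\mu\models_{v_i}\phi\}$,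 $\phi$ a formula in context $X_i$. $\mathrm{Mod}(T)$ is the subspace of those $\mu$ for which $M_\mu$ is a model of $T$. **Theorem (omitting types).** Let $L$ be a countable relational signature. 1. There is an adequate function $\beta$ (depending only on $L$) such that for every theory $T$ in $L$ the space $\mathrm{Mod}(T)$ is Polish in the logic topology; and if all compact $\omega$-models of $T$ are infinite, $n\in\mathbb N$, and $F\subseteq S_n(T)$ is meager, then for comeagerly many $\mu\in\mathrm{Mod}(T)$, $M_\mu$ is a compact $\omega$-model of $T$ that omits every type in $F$. 2. For every theory $T$ in $L$ (which may have finite models) and every non-isolated $n$-type $p(X)$, the set $\{r\in S_n(T):p\subseteq r\}$ is meager in $S_n(T)$. If $T$ has a model, then for every countable family of non-isolated types (in arbitrary contexts) there is a compact $\omega$-model of $T$ that omits all of them. -/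

import Mathlib

open Topology

/-- A relation `v ⊆ X × M` that is co-bijective: every `x` is related to some `a` to which no other
element is related (co-injective), and every `a` has some `x` related to it (co-surjective).
Equivalently, the sets `[x]_v = {a | v x a}` form a minimal cover of `M`. For `X` a context this is a
co-valuation on `M` in `X`; the set of all of them is `Val(X, M)`. -/
@[ext]
structure CoVal (X : Type*) (M : Type*) where
  rel : X → M → Prop
  coinj : ∀ x, ∃ a, rel x a ∧ ∀ x', rel x' a → x' = x
  cosurj : ∀ a, ∃ x, rel x a

namespace CoVal

/-- The set `[x]_v`. -/
def cell {X M : Type*} (v : CoVal X M) (x : X) : Set M := {a | v.rel x a}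

/-- The set `[x]_{π_v}` of those `a` that are related to `x` and to nothing else. -/
def core {X M : Type*} (v : CoVal X M) (x : X) : Set M := {a | v.rel x a ∧ ∀ x', v.rel x' a → x' = x}

/-- The consolidation `C_g(w) = g ∘ w` of `w` with pattern `g`; `w` is a fragmentation of it. -/
def cons {X Y M : Type*} (g : CoVal X Y) (w : CoVal Y M) : CoVal X M where
  rel x a := ∃ y, g.rel x y ∧ w.rel y a
  coinj x := by
    obtain ⟨y, hxy, hy⟩ := g.coinj x
    obtain ⟨a, hya, ha⟩ := w.coinj y
    refine ⟨a, ⟨y, hxy, hya⟩, ?_⟩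
    rintro x' ⟨y', h1, h2⟩
    have := ha y' h2
    subst this
    exact hy x' h1
  cosurj a := by
    obtain ⟨y, hy⟩ := w.cosurj a
    obtain ⟨x, hx⟩ := g.cosurj y
    exact ⟨x, y, hx, hy⟩

theorem cons_assoc {X Y Z M : Type*} (g : CoVal X Y) (h : CoVal Y Z) (w : CoVal Z M) :
    g.cons (h.cons w) = (g.cons h).cons w := by
  ext x a
  constructor
  · rintro ⟨y, h1, z, h2, h3⟩
    exact ⟨z, ⟨y, h1, h2⟩, h3⟩
  · rintro ⟨z, ⟨y, h1, h2⟩, h3⟩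
    exact ⟨y, h1, z, h2, h3⟩

end CoVal

/-! ### Formulas -/

/-- Variables are natural numbers, the special variable being `0`; contexts are finite sets of
variables. -/
abbrev Ctx : Type := Finset ℕ

/-- The context of sentences. -/
def starCtx : Ctx := {0}

/-- Formulas of the logic of co-valuations in a given context. -/
inductive CoFormula (L : FirstOrder.Language) : Ctx → Type _
  | bot {X : Ctx} : CoFormula L X
  | rel {X : Ctx} {n : ℕ} (R : L.Relations n) (x : Fin n → X) : CoFormula L X
  | neg {X : Ctx} (φ : CoFormula L X) : CoFormula L X
  | and {X : Ctx} (φ ψ : CoFormula L X) : CoFormula L X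
  | exFr {X Y : Ctx} (g : CoVal X Y) (φ : CoFormula L Y) : CoFormula L X

/-- A type in context `X`. -/
abbrev CoType (L : FirstOrder.Language) (X : Ctx) : Type _ := Set (CoFormula L X)

/-- A theory is a set of sentences. -/
abbrev CoTheory (L : FirstOrder.Language) : Type _ := CoType L starCtx

/-- A complete type. -/
def CoType.IsComplete {L : FirstOrder.Language} {X : Ctx} (p : CoType L X) : Prop :=
  ∀ φ : CoFormula L X, φ ∈ p ∨ CoFormula.neg φ ∈ p

/-! ### Structures -/

/-- A first-order structure with a family of admissible co-valuations in contexts (`adm X` being the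
set of admissible co-valuations in context `X`) that is closed under consolidations by contexts. -/
structure ProtoStructure (L : FirstOrder.Language) where
  carrier : Type
  str : L.Structure carrier
  adm : ∀ X : Ctx, Set (CoVal X carrier)
  adm_cons : ∀ {X Y : Ctx} (g : CoVal X Y) (w : CoVal Y carrier), w ∈ adm Y → g.cons w ∈ adm X

namespace ProtoStructure

/-- The interpretation `R^M` of a relation symbol. -/
def interp {L : FirstOrder.Language} (M : ProtoStructure L) {n : ℕ} (R : L.Relations n) :
    Set (Fin n → M.carrier) :=
  {a | M.str.RelMap R a}

/-- Satisfaction `M ⊨_v φ`. -/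
def Sat {L : FirstOrder.Language} (M : ProtoStructure L) :
    {X : Ctx} → CoFormula L X → CoVal X M.carrier → Prop
  | _, .bot, _ => False
  | _, .rel R x, v => ∃ a ∈ M.interp R, ∀ k, a k ∈ v.cell (x k)
  | _, .neg φ, v => ¬ M.Sat φ v
  | _, .and φ ψ, v => M.Sat φ v ∧ M.Sat ψ v
  | _, .exFr (Y := Y) g φ, v => ∃ w ∈ M.adm Y, v = g.cons w ∧ M.Sat φ w

/-- `M ⊨ T`: every sentence of `T` holds at the (unique) admissible co-valuation in context `{0}`. -/
def Models {L : FirstOrder.Language} (M : ProtoStructure L) (T : CoTheory L) : Prop :=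
  ∃ v ∈ M.adm starCtx, ∀ φ ∈ T, M.Sat φ v

/-- `M` realizes the type `p`. -/
def Realizes {L : FirstOrder.Language} (M : ProtoStructure L) {X : Ctx} (p : CoType L X) : Prop :=
  ∃ v ∈ M.adm X, ∀ φ ∈ p, M.Sat φ v

/-- `M` omits the type `p`. -/
def Omits {L : FirstOrder.Language} (M : ProtoStructure L) {X : Ctx} (p : CoType L X) : Prop :=
  ¬ M.Realizes p

/-- `w` witnesses the second axiom of structures for `R`, `v` and the tuple `x`. -/
def IsWitness {L : FirstOrder.Language} (M : ProtoStructure L) {n : ℕ} (R : L.Relations n)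
    {X Y : Ctx} (v : CoVal X M.carrier) (x : Fin n → X) (w : CoVal Y M.carrier) : Prop :=
  ∃ (y : Fin n → Y) (a : Fin n → M.carrier),
    (∀ k, a k ∈ w.core (y k)) ∧ (∀ k, w.cell (y k) ⊆ v.cell (x k)) ∧ a ∈ M.interp R

/-- Structures: non-empty proto-structures whose family of admissible co-valuations is (non-empty and)
directed under fragmentation, and in which the relations that hold at an admissible co-valuation have
witnesses. -/
structure IsStructure {L : FirstOrder.Language} (M : ProtoStructure L) : Prop where
  nonempty : Nonempty M.carrier
  adm_nonempty : ∃ X : Ctx, (M.adm X).Nonempty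
  directed : ∀ {X Y : Ctx}, ∀ u ∈ M.adm X, ∀ v ∈ M.adm Y, ∃ (Z : Ctx), ∃ w ∈ M.adm Z,
    ∃ (g : CoVal X Z) (h : CoVal Y Z), u = g.cons w ∧ v = h.cons w
  witness : ∀ {n : ℕ} (R : L.Relations n) {X : Ctx}, ∀ v ∈ M.adm X, ∀ x : Fin n → X,
    M.Sat (.rel R x) v → ∃ (Y : Ctx), ∃ w ∈ M.adm Y, M.IsWitness R v x w

/-- `(v_i)` is a core of the family of admissible co-valuations: an `ω`-chain of admissible
co-valuations such that every admissible co-valuation is a consolidation of some `v_i`. -/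
structure IsCore {L : FirstOrder.Language} (M : ProtoStructure L) (Y : ℕ → Ctx)
    (v : ∀ i, CoVal (Y i) M.carrier) : Prop where
  mem : ∀ i, v i ∈ M.adm (Y i)
  chain : ∀ i, ∃ g : CoVal (Y i) (Y (i + 1)), v i = g.cons (v (i + 1))
  generates : ∀ {X : Ctx}, ∀ w ∈ M.adm X, ∃ i, ∃ g : CoVal X (Y i), w = g.cons (v i)

/-- There is a compact `T₁` topology in which the admissible covers are open and refine every open
cover, and in which the relations are closed. -/
def IsCompact {L : FirstOrder.Language} (M : ProtoStructure L) : Prop :=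
  ∃ _ : TopologicalSpace M.carrier, CompactSpace M.carrier ∧ T1Space M.carrier ∧
    (∀ X : Ctx, ∀ v ∈ M.adm X, ∀ x : X, IsOpen (v.cell x)) ∧
    (∀ U : Set (Set M.carrier), (∀ u ∈ U, IsOpen u) → ⋃₀ U = Set.univ →
      ∃ X : Ctx, ∃ v ∈ M.adm X, ∀ x : X, ∃ u ∈ U, v.cell x ⊆ u) ∧
    (∀ (n : ℕ) (R : L.Relations n), IsClosed (M.interp R))

/-- Compact `ω`-structures. -/
structure IsCompactOmega {L : FirstOrder.Language} (M : ProtoStructure L) : Prop where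
  isStructure : M.IsStructure
  isCompact : M.IsCompact
  hasCore : ∃ (Y : ℕ → Ctx) (v : ∀ i, CoVal (Y i) M.carrier), M.IsCore Y v

end ProtoStructure

/-! ### Type spaces -/

/-- The space of complete types in context `X` realized by models of `T`. -/
def TypeSpace {L : FirstOrder.Language} (T : CoTheory L) (X : Ctx) : Type _ :=
  {p : CoType L X // p.IsComplete ∧
    ∃ M : ProtoStructure L, M.IsStructure ∧ M.Models T ∧ M.Realizes p}

/-- The logic topology on the type space, generated by the sets `[φ]`. -/
instance TypeSpace.topology {L : FirstOrder.Language} (T : CoTheory L) (X : Ctx) :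
    TopologicalSpace (TypeSpace T X) :=
  TopologicalSpace.generateFrom {U | ∃ φ : CoFormula L X, U = {p : TypeSpace T X | φ ∈ p.1}}

/-- The type `p` of the theory `T` is isolated: some formula consistent with `T` implies all of `p`
in all models of `T`. -/
def IsIsolatedType {L : FirstOrder.Language} (T : CoTheory L) {X : Ctx} (p : CoType L X) : Prop :=
  ∃ φ : CoFormula L X,
    (∃ M : ProtoStructure L, M.IsStructure ∧ M.Models T ∧ M.Realizes {φ}) ∧
    ∀ M : ProtoStructure L, M.IsStructure → M.Models T →
      ∀ v ∈ M.adm X, M.Sat φ v → ∀ ψ ∈ p, M.Sat ψ v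

/-! ### Level-injective chains and their spectra -/

namespace OmegaChain

/-- The relation between consecutive levels of the disjoint union of the levels `P i`. -/
inductive Step {P : ℕ → Type} (s : ∀ i, CoVal (P i) (P (i + 1))) : (Σ i, P i) → (Σ i, P i) → Prop
  | mk {i : ℕ} {x : P i} {y : P (i + 1)} (h : (s i).rel x y) : Step s ⟨i, x⟩ ⟨i + 1, y⟩

/-- `Ge s p q` means `p ≥ q` in the `ω`-chain: the reflexive and transitive closure of the relations
between consecutive levels. -/
def Ge {P : ℕ → Type} (s : ∀ i, CoVal (P i) (P (i + 1))) : (Σ i, P i) → (Σ i, P i) → Prop :=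
  Relation.ReflTransGen (Step s)

/-- A band is a finite set such that every element is comparable with some element of it. -/
def IsBand {P : ℕ → Type} (s : ∀ i, CoVal (P i) (P (i + 1))) (B : Set (Σ i, P i)) : Prop :=
  B.Finite ∧ ∀ p, ∃ b ∈ B, Ge s p b ∨ Ge s b p

/-- A cap is a set refined by a band. -/
def IsCap {P : ℕ → Type} (s : ∀ i, CoVal (P i) (P (i + 1))) (C : Set (Σ i, P i)) : Prop :=
  ∃ B, IsBand s B ∧ ∀ b ∈ B, ∃ c ∈ C, Ge s c b

/-- A selector is a set that meets every cap. -/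
def IsSelector {P : ℕ → Type} (s : ∀ i, CoVal (P i) (P (i + 1))) (S : Set (Σ i, P i)) : Prop :=
  ∀ C, IsCap s C → (S ∩ C).Nonempty

/-- The spectrum: the set of all minimal selectors. -/
def Spectrum {P : ℕ → Type} (s : ∀ i, CoVal (P i) (P (i + 1))) : Type :=
  {S : Set (Σ i, P i) // Minimal (IsSelector s) S}

theorem Ge.level_le {P : ℕ → Type} {s : ∀ i, CoVal (P i) (P (i + 1))} {p q : Σ i, P i}
    (h : Ge s p q) : p.1 ≤ q.1 := by
  induction h with
  | refl => exact le_rfl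
  | tail _ h2 ih => cases h2; exact ih.trans (Nat.le_succ _)

theorem exists_ge_level {P : ℕ → Type} (s : ∀ i, CoVal (P i) (P (i + 1))) (i k : ℕ) :
    ∀ y : P (i + k), ∃ x : P i, Ge s ⟨i, x⟩ ⟨i + k, y⟩ := by
  induction k with
  | zero => exact fun y => ⟨y, Relation.ReflTransGen.refl⟩
  | succ k ih =>
    intro y
    obtain ⟨z, hz⟩ := (s (i + k)).cosurj y
    obtain ⟨x, hx⟩ := ih z
    exact ⟨x, hx.tail (Step.mk hz)⟩

theorem exists_le_level {P : ℕ → Type} (s : ∀ i, CoVal (P i) (P (i + 1))) (i k : ℕ) (x : P i) :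
    ∃ y : P (i + k), Ge s ⟨i, x⟩ ⟨i + k, y⟩ := by
  induction k with
  | zero => exact ⟨x, Relation.ReflTransGen.refl⟩
  | succ k ih =>
    obtain ⟨y, hy⟩ := ih
    obtain ⟨z, hz, _⟩ := (s (i + k)).coinj y
    exact ⟨z, hy.tail (Step.mk hz)⟩

theorem isCap_level {P : ℕ → Type} [∀ i, Finite (P i)] (s : ∀ i, CoVal (P i) (P (i + 1))) (i : ℕ) :
    IsCap s (Set.range fun x : P i => (⟨i, x⟩ : Σ i, P i)) := by
  refine ⟨_, ⟨Set.finite_range _, ?_⟩, fun b hb => ⟨b, hb, Relation.ReflTransGen.refl⟩⟩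
  rintro ⟨j, p⟩
  rcases le_total i j with h | h
  · obtain ⟨k, rfl⟩ := Nat.exists_eq_add_of_le h
    obtain ⟨x, hx⟩ := exists_ge_level s i k p
    exact ⟨_, ⟨x, rfl⟩, Or.inr hx⟩
  · obtain ⟨k, rfl⟩ := Nat.exists_eq_add_of_le h
    obtain ⟨x, hx⟩ := exists_le_level s j k p
    exact ⟨_, ⟨x, rfl⟩, Or.inl hx⟩

/-- Every selector contains a minimal selector. -/
theorem IsSelector.exists_minimal {P : ℕ → Type} {s : ∀ i, CoVal (P i) (P (i + 1))}
    {D : Set (Σ i, P i)} (hD : IsSelector s D) : ∃ S, S ⊆ D ∧ Minimal (IsSelector s) S := by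
  refine zorn_superset_nonempty {S | IsSelector s S} ?_ D hD
  intro c hc hchain hne
  refine ⟨⋂₀ c, ?_, fun S hS => Set.sInter_subset_of_mem hS⟩
  rintro C ⟨B, hB, hBC⟩
  by_contra hemp
  choose! f hf using hBC
  have hfin : (f '' B).Finite := hB.1.image f
  have hcap : IsCap s (f '' B) := ⟨B, hB, fun b hb => ⟨f b, ⟨b, hb, rfl⟩, (hf b hb).2⟩⟩
  have hout : ∀ x ∈ f '' B, ∃ S ∈ c, x ∉ S := by
    rintro _ ⟨b, hb, rfl⟩
    by_contra hcon
    push Not at hcon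
    exact hemp ⟨f b, fun S hS => hcon S hS, (hf b hb).1⟩
  have key : ∀ t : Set (Σ i, P i), t.Finite → (∀ x ∈ t, ∃ S ∈ c, x ∉ S) →
      ∃ S ∈ c, ∀ x ∈ t, x ∉ S := by
    intro t ht
    induction t, ht using Set.Finite.induction_on with
    | empty => exact fun _ => ⟨hne.some, hne.some_mem, by simp⟩
    | @insert a t _ _ ih =>
      intro h
      obtain ⟨S, hS, hSt⟩ := ih fun x hx => h x (Set.mem_insert_of_mem _ hx)
      obtain ⟨S', hS', haS'⟩ := h a (Set.mem_insert _ _)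
      rcases hchain.total hS hS' with hle | hle
      · refine ⟨S, hS, ?_⟩
        rintro x (rfl | hx)
        · exact fun hxS => haS' (hle hxS)
        · exact hSt x hx
      · refine ⟨S', hS', ?_⟩
        rintro x (rfl | hx)
        · exact haS'
        · exact fun hxS => hSt x hx (hle hxS)
  obtain ⟨S, hS, hSf⟩ := key _ hfin hout
  obtain ⟨x, hxS, hxf⟩ := hc hS _ hcap
  exact hSf x hxf hxS

/-- Some point of the spectrum lies in `x` and in no other element of the level of `x`. -/
theorem exists_private {P : ℕ → Type} [∀ i, Finite (P i)] (s : ∀ i, CoVal (P i) (P (i + 1)))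
    (i : ℕ) (x : P i) :
    ∃ S : Spectrum s, (⟨i, x⟩ : Σ i, P i) ∈ S.1 ∧
      ∀ x' : P i, (⟨i, x'⟩ : Σ i, P i) ∈ S.1 → x' = x := by
  choose next hnext huniq using fun j => (s j).coinj
  let b : ∀ k, P (i + k) := fun k => Nat.rec x (fun k y => next (i + k) y) k
  have hb : ∀ k, b (k + 1) = next (i + k) (b k) := fun _ => rfl
  let D : Set (Σ i, P i) := {q | ∃ k, Ge s q ⟨i + k, b k⟩}
  have hD : IsSelector s D := by
    rintro C ⟨B, ⟨hfin, hcomp⟩, hBC⟩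
    obtain ⟨N, hN⟩ := (hfin.image Sigma.fst).bddAbove
    obtain ⟨q, hq, hor⟩ := hcomp ⟨i + (N + 1), b (N + 1)⟩
    have hqN : q.1 ≤ N := hN ⟨q, hq, rfl⟩
    rcases hor with h | h
    · have h1 : i + (N + 1) ≤ q.1 := h.level_le
      omega
    · obtain ⟨c, hc, hcq⟩ := hBC q hq
      exact ⟨c, ⟨N + 1, hcq.trans h⟩, hc⟩
  have hroot : ∀ (k : ℕ) (x' : P i), Ge s ⟨i, x'⟩ ⟨i + k, b k⟩ → x' = x := by
    intro k
    induction k with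
    | zero =>
      intro x' h
      rcases Relation.ReflTransGen.cases_tail h with h | ⟨r, h1, h2⟩
      · have h0 : (⟨i, x⟩ : Σ i, P i) = ⟨i, x'⟩ := h
        exact (eq_of_heq (Sigma.mk.inj h0).2).symm
      · have h3 : i ≤ r.1 := Ge.level_le h1
        have h4 : r.1 + 1 = i := by
          generalize hq : (⟨i + 0, b 0⟩ : Σ i, P i) = q at h2
          cases h2
          exact (congrArg Sigma.fst hq).symm
        omega
    | succ k ih =>
      intro x' h
      rcases Relation.ReflTransGen.cases_tail h with h | ⟨r, h1, h2⟩
      · have := congrArg Sigma.fst h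
        simp only at this
        omega
      · have hr : r = ⟨i + k, b k⟩ := by
          obtain ⟨j, z⟩ := r
          generalize hq : (⟨i + (k + 1), b (k + 1)⟩ : Σ i, P i) = q at h2
          cases h2 with
          | @mk _ _ y h =>
            have hj : i + k = j := by
              have := congrArg Sigma.fst hq
              simp only at this
              omega
            subst hj
            have hy : b (k + 1) = y := eq_of_heq (Sigma.mk.inj hq).2
            rw [← hy, hb] at h
            rw [huniq (i + k) (b k) z h]
        subst hr
        exact ih x' h1
  obtain ⟨S, hSD, hS⟩ := hD.exists_minimal
  have hpriv : ∀ x' : P i, (⟨i, x'⟩ : Σ i, P i) ∈ S → x' = x := by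
    intro x' hx'
    obtain ⟨k, hk⟩ := hSD hx'
    exact hroot k x' hk
  obtain ⟨q, hqS, x', rfl⟩ := hS.1 _ (isCap_level s i)
  have hx' := hpriv x' hqS
  subst hx'
  exact ⟨⟨S, hS⟩, hqS, hpriv⟩

/-- The co-valuation `v_i` of the spectrum in the `i`-th level: `x` is related to `S` iff `x ∈ S`. -/
def levelVal {P : ℕ → Type} [∀ i, Finite (P i)] (s : ∀ i, CoVal (P i) (P (i + 1))) (i : ℕ) :
    CoVal (P i) (Spectrum s) where
  rel x S := (⟨i, x⟩ : Σ i, P i) ∈ S.1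
  coinj x := exists_private s i x
  cosurj S := by
    obtain ⟨_, hqS, x, rfl⟩ := S.2.1 _ (isCap_level s i)
    exact ⟨x, hqS⟩

end OmegaChain

/-! ### The space of codes of infinite compact structures -/

/-- The sizes `1, 2, 4, 16, …` of the fixed contexts `X_i`. -/
def levelSize : ℕ → ℕ
  | 0 => 1
  | i + 1 => 2 ^ levelSize i

/-- The fixed contexts `X_i`, with `|X_0| = 1` and `|X_{i+1}| = 2 ^ |X_i|`. -/
def levelCtx (i : ℕ) : Ctx := Finset.range (levelSize i)

/-- The type of elements of the context `X_i`. -/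
abbrev Lev (i : ℕ) : Type := levelCtx i

/-- A code: a level-injective `ω`-chain ordering on the disjoint union of the `X_i` (given by its
restrictions `step i` to consecutive levels, which determine it), and for each relation symbol a set of
tuples in the contexts `X_i`. -/
structure Code (L : FirstOrder.Language) where
  step : ∀ i, CoVal (Lev i) (Lev (i + 1))
  holds : ∀ (i : ℕ) {n : ℕ}, L.Relations n → (Fin n → Lev i) → Prop

/-- A function assigning a natural number to every triple of a level `i`, a relation symbol `R` and a
tuple in `X_i` of the length of the arity of `R`. -/
def LevelBound (L : FirstOrder.Language) : Type _ :=
  ∀ (i : ℕ) {n : ℕ}, L.Relations n → (Fin n → Lev i) → ℕ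

/-- A minimal cover of a set. -/
def IsMinCover {α : Type*} (A : Set (Set α)) : Prop :=
  ⋃₀ A = Set.univ ∧ ∀ B ⊆ A, ⋃₀ B = Set.univ → B = A

namespace Code

/-- `μ.Ge p q` is `p ≥_μ q`. -/
def Ge {L : FirstOrder.Language} (μ : Code L) : (Σ i, Lev i) → (Σ i, Lev i) → Prop :=
  OmegaChain.Ge μ.step

/-- Tuples above a tuple that is in the relation are in the relation. -/
def IsUpward {L : FirstOrder.Language} (μ : Code L) : Prop :=
  ∀ {n : ℕ} (R : L.Relations n) (i : ℕ) (y : Fin n → Lev i), μ.holds i R y →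
    ∀ (j : ℕ) (x : Fin n → Lev j), (∀ k, μ.Ge ⟨j, x k⟩ ⟨i, y k⟩) → μ.holds j R x

/-- Tuples that are in the relation have witnesses, on a level bounded by `β`. -/
def IsWitnessed {L : FirstOrder.Language} (β : LevelBound L) (μ : Code L) : Prop :=
  ∀ {n : ℕ} (R : L.Relations n) (i : ℕ) (x : Fin n → Lev i), μ.holds i R x →
    ∃ j ≤ β i R x, ∃ (C : Set (Set (Lev j))) (A : Fin n → Set (Lev j)),
      IsMinCover C ∧ (∀ k, A k ∈ C) ∧
      (∀ k, ∀ z ∈ A k, μ.Ge ⟨i, x k⟩ ⟨j, z⟩) ∧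
      ∀ j' ≥ j, ∃ y : Fin n → Lev j', μ.holds j' R y ∧
        ∀ k, ∀ z : Lev j, μ.Ge ⟨j, z⟩ ⟨j', y k⟩ → z ∈ A k

/-- The underlying set of `M_μ`. -/
def Point {L : FirstOrder.Language} (μ : Code L) : Type := OmegaChain.Spectrum μ.step

/-- The co-valuation `v_i` of `M_μ`. -/
def val {L : FirstOrder.Language} (μ : Code L) (i : ℕ) : CoVal (levelCtx i) μ.Point :=
  OmegaChain.levelVal (P := Lev) μ.step i

/-- The proto-structure `M_μ` coded by `μ`: its points are the minimal selectors, and its admissible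
co-valuations are the consolidations of the `v_i`. -/
def toStr {L : FirstOrder.Language} [L.IsRelational] (μ : Code L) : ProtoStructure L where
  carrier := μ.Point
  str :=
    { funMap := fun f _ => isEmptyElim f
      RelMap := fun R S => ∀ i (x : Fin _ → Lev i),
        (∀ k, (⟨i, x k⟩ : Σ i, Lev i) ∈ (S k).1) → μ.holds i R x }
  adm X := {w | ∃ i, ∃ g : CoVal X (levelCtx i), w = g.cons (μ.val i)}
  adm_cons := by
    rintro X Y g w ⟨i, h, rfl⟩
    exact ⟨i, g.cons h, CoVal.cons_assoc g h _⟩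

end Code

/-- The bound `β` is adequate: every infinite compact `ω`-structure has a core in the contexts `X_i`
such that, whenever a relation holds at some tuple in `X_i`, it has a witness among the consolidations
of the co-valuations of the core with index at most the bound. -/
def LevelBound.IsAdequate {L : FirstOrder.Language} (β : LevelBound L) : Prop :=
  ∀ M : ProtoStructure L, M.IsCompactOmega → Infinite M.carrier →
    ∃ v : ∀ i, CoVal (levelCtx i) M.carrier, M.IsCore levelCtx v ∧
      ∀ (i : ℕ) {n : ℕ} (R : L.Relations n) (x : Fin n → levelCtx i), M.Sat (.rel R x) (v i) →
        ∃ j ≤ β i R x, ∃ (Y : Ctx) (g : CoVal Y (levelCtx j)), M.IsWitness R (v i) x (g.cons (v j))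

/-- The space `Mod(L)`. -/
def ModL {L : FirstOrder.Language} (β : LevelBound L) : Type _ :=
  {μ : Code L // μ.IsUpward ∧ μ.IsWitnessed β}

/-- The logic topology on `Mod(L)`: its sub-basic open sets are the sets of those `μ` whose order is a
given one on the levels up to `i`, and the sets of those `μ` with `M_μ ⊨_{v_i} φ`. -/
instance ModL.topology {L : FirstOrder.Language} [L.IsRelational] (β : LevelBound L) :
    TopologicalSpace (ModL β) :=
  TopologicalSpace.generateFrom
    ({U | ∃ (i : ℕ) (r : (Σ i, Lev i) → (Σ i, Lev i) → Prop),
        U = {μ : ModL β | ∀ p q : Σ i, Lev i, p.1 ≤ i → q.1 ≤ i → (μ.1.Ge p q ↔ r p q)}} ∪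
     {U | ∃ (i : ℕ) (φ : CoFormula L (levelCtx i)),
        U = {μ : ModL β | μ.1.toStr.Sat φ (μ.1.val i)}})

/-- The subspace `Mod(T)` of those `μ` for which `M_μ` is a model of `T`. -/
def ModT {L : FirstOrder.Language} [L.IsRelational] (β : LevelBound L) (T : CoTheory L) :
    Set (ModL β) :=
  {μ | μ.1.toStr.Models T}

/-!
The proof is a Baire category argument on the space `Mod(T)` of codes, together with a Baire category
argument on a compact space of finite structures for theories with models of bounded size.

*Compactness.* A chain of contexts with sets of tuples on its levels gives a compact `ω`-structure on its
spectrum (`chainStr_isCompactOmega`). If the chain is a core of a structure `M`, then this structure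
satisfies the same formulas as `M` (`sat_chainStr_iff`): by `sat_iff_of_isCore` only atomic formulas
matter, and a tuple of points in the relation is found as an ultralimit of tuples on the levels, which
the witnesses required in `M` keep inside the right cells. With a countable elementary family of
co-valuations this yields a downward Löwenheim–Skolem theorem
(`ProtoStructure.IsStructure.exists_isCompactOmega`).

*The bound.* A core of an infinite structure in the fixed contexts is built in stages. Stage `e` provides
a witness for the tuple with number `e` and makes the core finer than one more cover of a given core. As
witnesses and common fragmentations can be taken of bounded size (`IsWitness.exists_small`,
`CoVal.exists_common_between`), the level `checkpoint L e` at which stage `e` begins depends on `L` only.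
This gives an adequate bound `witnessBound L`. Since a finite part of a core can be extended in the same
way (`IsStructure.exists_core_extension`), it also gives many elements of `Mod(T)`.

*Polishness.* Recording the steps of a code and the truth values of all formulas at all consolidations of
the canonical co-valuations embeds `Mod(T)` in a product of countable discrete spaces. The range is
described by recursive clauses for satisfaction. The clause for the quantifier is `Gδ`; the others are
closed, and the existence of witnesses is closed because their level is bounded (`ModT.polishSpace`).

*Omitting types.* For a fixed pattern `h`, the type of the `h`-consolidation of the `j`-th canonical
co-valuation depends continuously on the code. The preimage of a closed nowhere dense set is nowhere dense
(`dense_setOf_typeAt_notMem`): a basic neighbourhood is given by finitely many steps and one formula, to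
which formulas are added that guarantee witnesses in time for the finitely many tuples of the stages
passed (`ModL.exists_formula_witnessedAt`); a type outside the nowhere dense set that contains the
resulting formula is realized in a compact model, and the corresponding finite part of a core extends to
an element of `Mod(T)`. The types extending a non-isolated type form a closed set without interior
(`TypeSpace.isMeagre_setOf_subset`).

*Finite models.* If some model of `T` has an admissible cover of the largest possible size, this cover is
a core by itself, and the model satisfies the same formulas as a finite structure on the context of the
cover. The finite models of `T` on this context form a compact space, and as it is expressible that a
cover is largest, non-isolated types are omitted by a dense open set of them (`exists_finite_omits`).
-/

/-! ### Co-valuations -/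

namespace CoVal

/-- The identity co-valuation. -/
def refl (X : Type*) : CoVal X X where
  rel x y := x = y
  coinj x := ⟨x, rfl, fun _ h => h⟩
  cosurj x := ⟨x, rfl⟩

@[simp] theorem refl_cons {X M : Type*} (v : CoVal X M) : (refl X).cons v = v := by
  ext x a
  constructor
  · rintro ⟨y, rfl, h⟩
    exact h
  · exact fun h => ⟨x, rfl, h⟩

@[simp] theorem cons_refl {X M : Type*} (v : CoVal X M) : v.cons (refl M) = v := by
  ext x a
  constructor
  · rintro ⟨y, h, rfl⟩
    exact h
  · exact fun h => ⟨a, h, rfl⟩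

theorem cons_right_cancel {X Y M : Type*} {g g' : CoVal X Y} (w : CoVal Y M)
    (h : g.cons w = g'.cons w) : g = g' := by
  have key : ∀ g g' : CoVal X Y, g.cons w = g'.cons w → ∀ x y, g.rel x y → g'.rel x y := by
    intro g g' h x y hxy
    obtain ⟨a, hya, ha⟩ := w.coinj y
    have h1 : (g.cons w).rel x a := ⟨y, hxy, hya⟩
    rw [h] at h1
    obtain ⟨y', h2, h3⟩ := h1
    rwa [← ha y' h3]
  ext x y
  exact ⟨key g g' h x y, key g' g h.symm x y⟩

instance {X M : Type*} [Finite X] [Finite M] : Finite (CoVal X M) :=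
  Finite.of_injective (fun v : CoVal X M => v.rel) fun _ _ h => CoVal.ext h

theorem card_le {X M : Type*} [Finite M] (v : CoVal X M) : Nat.card X ≤ Nat.card M := by
  choose f hf hu using v.coinj
  exact Nat.card_le_card_of_injective f fun x x' h => (hu x x' (h ▸ hf x')).symm

/-- The graph of a surjection, with the roles of source and target exchanged: the co-valuation whose
cells are the fibres. -/
def ofSurj {Z U : Type*} (f : Z → U) (hf : Function.Surjective f) : CoVal U Z where
  rel u z := f z = u
  coinj u := by
    obtain ⟨z, rfl⟩ := hf u
    exact ⟨z, rfl, fun _ h => h.symm⟩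
  cosurj z := ⟨f z, rfl⟩

/-- A co-valuation all of whose cells are unions of fibres of `f` factors through the partition into
fibres. -/
theorem exists_factor {X Z U : Type*} (p : CoVal X Z) (f : Z → U) (hf : Function.Surjective f)
    (h : ∀ z z', f z = f z' → ∀ x, p.rel x z → p.rel x z') :
    ∃ p' : CoVal X U, p = p'.cons (ofSurj f hf) := by
  refine ⟨⟨fun x u => ∃ z, f z = u ∧ p.rel x z, fun x => ?_, fun u => ?_⟩, ?_⟩
  · obtain ⟨z, hz, hz'⟩ := p.coinj x
    refine ⟨f z, ⟨z, rfl, hz⟩, ?_⟩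
    rintro x' ⟨z', h1, h2⟩
    exact hz' x' (h z' z h1 x' h2)
  · obtain ⟨z, rfl⟩ := hf u
    obtain ⟨x, hx⟩ := p.cosurj z
    exact ⟨x, z, rfl, hx⟩
  · ext x z
    constructor
    · exact fun hxz => ⟨f z, ⟨z, rfl, hxz⟩, rfl⟩
    · rintro ⟨u, ⟨z', h1, h2⟩, h3⟩
      exact h z' z (h1.trans h3.symm) x h2

/-- The relation "`v` is a consolidation of `w`". -/
def Coarser {X Y M : Type*} (v : CoVal X M) (w : CoVal Y M) : Prop := ∃ g : CoVal X Y, v = g.cons w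

theorem Coarser.rfl' {X M : Type*} (v : CoVal X M) : Coarser v v := ⟨refl X, (refl_cons v).symm⟩

theorem Coarser.trans {X Y Z M : Type*} {u : CoVal X M} {v : CoVal Y M} {w : CoVal Z M}
    (h : Coarser u v) (h' : Coarser v w) : Coarser u w := by
  obtain ⟨g, rfl⟩ := h
  obtain ⟨g', rfl⟩ := h'
  exact ⟨g.cons g', cons_assoc _ _ _⟩

theorem coarser_cons {X Y M : Type*} (g : CoVal X Y) (w : CoVal Y M) : Coarser (g.cons w) w := ⟨g, rfl⟩

theorem Coarser.card_le {X Y M : Type*} [Finite Y] {u : CoVal X M} {v : CoVal Y M}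
    (h : Coarser u v) : Nat.card X ≤ Nat.card Y := h.elim fun g _ => g.card_le

theorem cell_cons_subset {X Y M : Type*} {g : CoVal X Y} {w : CoVal Y M} {x : X} {y : Y}
    (h : g.rel x y) : w.cell y ⊆ (g.cons w).cell x := fun _ ha => ⟨y, h, ha⟩

/-- Inclusion of cells of a fragmentation in cells of a co-valuation is decided by the pattern. -/
theorem rel_of_cell_subset {X Y M : Type*} {g : CoVal X Y} {w : CoVal Y M} {x : X} {y : Y}
    (h : w.cell y ⊆ (g.cons w).cell x) : g.rel x y := by
  obtain ⟨a, ha, hu⟩ := w.coinj y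
  obtain ⟨y', h1, h2⟩ := h ha
  rwa [← hu y' h2]

/-- The unique co-valuation in a one-element context. -/
def single (X M : Type*) [Unique X] [Nonempty M] : CoVal X M where
  rel _ _ := True
  coinj _ := ⟨Classical.arbitrary M, trivial, fun _ _ => Subsingleton.elim _ _⟩
  cosurj _ := ⟨default, trivial⟩

theorem eq_single {X M : Type*} [Unique X] [Nonempty M] (v : CoVal X M) : v = single X M := by
  ext x a
  refine ⟨fun _ => trivial, fun _ => ?_⟩
  obtain ⟨x', hx'⟩ := v.cosurj a
  rwa [Subsingleton.elim x x']

end CoVal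

instance : Unique starCtx := ⟨⟨⟨0, by simp [starCtx]⟩⟩, fun x => by
  have := x.2
  simp only [starCtx, Finset.mem_singleton] at this
  exact Subtype.ext this⟩

/-! ### Surjections that refine a given map -/

theorem exists_surjective_fiber_eq {Z F : Type*} [Finite Z] (τ : Z → F) :
    ∃ f : Z → (Finset.range (Set.range τ).ncard : Ctx), Function.Surjective f ∧
      ∀ z z', f z = f z' ↔ τ z = τ z' := by
  obtain ⟨e⟩ : Nonempty (Set.range τ ≃ (Finset.range (Set.range τ).ncard : Ctx)) := by
    refine Finite.card_eq.mp ?_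
    rw [Nat.card_eq_fintype_card (α := (Finset.range (Set.range τ).ncard : Ctx)),
      Fintype.card_coe, Finset.card_range, Nat.card_coe_set_eq]
  refine ⟨fun z => e ⟨τ z, Set.mem_range_self z⟩, fun u => ?_, fun z z' => ?_⟩
  · obtain ⟨⟨_, z, rfl⟩, rfl⟩ := e.surjective u
    exact ⟨z, rfl⟩
  · exact e.injective.eq_iff.trans Subtype.mk_eq_mk

/-- A finite set can be partitioned into any prescribed number of pieces, between the number of values
of `τ` and the size of the set, so that `τ` is constant on the pieces. -/
theorem exists_surjective_refining {Z F : Type*} [Finite Z] (τ : Z → F) (n : ℕ)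
    (h1 : (Set.range τ).ncard ≤ n) (h2 : n ≤ Nat.card Z) :
    ∃ f : Z → (Finset.range n : Ctx), Function.Surjective f ∧ ∀ z z', f z = f z' → τ z = τ z' := by
  classical
  have := Fintype.ofFinite Z
  rw [Nat.card_eq_fintype_card] at h2
  choose ρ hρ using fun y : Set.range τ => y.2
  have hinj : Function.Injective ρ := fun y y' h => Subtype.ext ((hρ y).symm.trans (h ▸ hρ y'))
  -- A set `S` of `n` points containing a representative of each fibre of `τ` indexes the pieces.
  obtain ⟨S, hS, -, hcard⟩ := Finset.exists_subsuperset_card_eq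
    (s := (Finset.univ.image ρ)) (t := Finset.univ) (n := n) (Finset.subset_univ _) (by
      rw [Finset.card_image_of_injective _ hinj, Finset.card_univ]
      rwa [← Nat.card_coe_set_eq, Nat.card_eq_fintype_card] at h1) (by simpa using h2)
  have hmem : ∀ y, ρ y ∈ S := fun y => hS (Finset.mem_image_of_mem _ (Finset.mem_univ y))
  have e : S ≃ (Finset.range n : Ctx) := by
    refine Fintype.equivOfCardEq ?_
    simp [hcard]
  let q : Z → S := fun z => if h : z ∈ S then ⟨z, h⟩ else ⟨ρ ⟨τ z, z, rfl⟩, hmem _⟩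
  have hq : ∀ z, τ (q z) = τ z := by
    intro z
    by_cases h : z ∈ S
    · simp [q, h]
    · simp only [q, h, dite_false]
      exact hρ ⟨τ z, z, rfl⟩
  refine ⟨fun z => e (q z), fun u => ?_, fun z z' h => ?_⟩
  · obtain ⟨⟨z, hz⟩, rfl⟩ := e.surjective u
    exact ⟨z, by simp [q, hz]⟩
  · rw [← hq z, ← hq z', e.injective h]

/-! ### The order of a chain and its spectrum -/

namespace OmegaChain

theorem Step.exists_of_succ {P : ℕ → Type} {s : ∀ i, CoVal (P i) (P (i + 1))} {p : Σ i, P i} {j : ℕ}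
    {y : P (j + 1)} (h : Step s p ⟨j + 1, y⟩) : ∃ z : P j, p = ⟨j, z⟩ ∧ (s j).rel z y := by
  cases h with
  | mk h => exact ⟨_, rfl, h⟩

theorem ge_succ_iff {P : ℕ → Type} {s : ∀ i, CoVal (P i) (P (i + 1))} {i j : ℕ} (hij : i ≤ j)
    (x : P i) (y : P (j + 1)) :
    Ge s ⟨i, x⟩ ⟨j + 1, y⟩ ↔ ∃ z : P j, Ge s ⟨i, x⟩ ⟨j, z⟩ ∧ (s j).rel z y := by
  constructor
  · intro h
    rcases Relation.ReflTransGen.cases_tail h with h | ⟨r, h1, h2⟩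
    · have := congrArg Sigma.fst h
      simp only at this
      omega
    · obtain ⟨z, rfl, hz⟩ := h2.exists_of_succ
      exact ⟨z, h1, hz⟩
  · rintro ⟨z, h1, h2⟩
    exact h1.tail (Step.mk h2)

theorem ge_iff_eq {P : ℕ → Type} {s : ∀ i, CoVal (P i) (P (i + 1))} {i : ℕ} (x y : P i) :
    Ge s ⟨i, x⟩ ⟨i, y⟩ ↔ x = y := by
  constructor
  · intro h
    rcases Relation.ReflTransGen.cases_head h with h | ⟨r, h1, h2⟩
    · exact eq_of_heq (Sigma.mk.inj h).2
    · cases h1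
      have := Ge.level_le h2
      simp only at this
      omega
  · rintro rfl
    exact Relation.ReflTransGen.refl

theorem exists_ge_of_le {P : ℕ → Type} (s : ∀ i, CoVal (P i) (P (i + 1))) {i j : ℕ} (h : i ≤ j)
    (y : P j) : ∃ x : P i, Ge s ⟨i, x⟩ ⟨j, y⟩ := by
  obtain ⟨k, rfl⟩ := Nat.exists_eq_add_of_le h
  exact exists_ge_level s i k y

/-- The restriction of the order of a chain to two of its levels. -/
def link {P : ℕ → Type} (s : ∀ i, CoVal (P i) (P (i + 1))) {i j : ℕ} (h : i ≤ j) :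
    CoVal (P i) (P j) where
  rel x y := Ge s ⟨i, x⟩ ⟨j, y⟩
  coinj x := by
    induction j, h using Nat.le_induction with
    | base => exact ⟨x, Relation.ReflTransGen.refl, fun x' h => (ge_iff_eq _ _).1 h⟩
    | succ j hj ih =>
      obtain ⟨z, h1, h2⟩ := ih
      obtain ⟨y, h3, h4⟩ := (s j).coinj z
      refine ⟨y, h1.tail (Step.mk h3), fun x' hx' => ?_⟩
      obtain ⟨z', h5, h6⟩ := (ge_succ_iff hj _ _).1 hx'
      rw [h4 z' h6] at h5
      exact h2 x' h5
  cosurj y := exists_ge_of_le s h y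

theorem link_self {P : ℕ → Type} (s : ∀ i, CoVal (P i) (P (i + 1))) (i : ℕ) :
    link s (le_refl i) = CoVal.refl (P i) := by
  ext x y
  exact ge_iff_eq x y

theorem link_succ {P : ℕ → Type} (s : ∀ i, CoVal (P i) (P (i + 1))) {i j : ℕ} (h : i ≤ j) :
    link s (h.trans j.le_succ) = (link s h).cons (s j) := by
  ext x y
  exact ge_succ_iff h x y

theorem eq_link_cons {P : ℕ → Type} {s : ∀ i, CoVal (P i) (P (i + 1))} {M : Type*}
    {v : ∀ i, CoVal (P i) M} (hv : ∀ i, v i = (s i).cons (v (i + 1))) {i j : ℕ} (h : i ≤ j) :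
    v i = (link s h).cons (v j) := by
  induction j, h using Nat.le_induction with
  | base => rw [link_self, CoVal.refl_cons]
  | succ j hj ih => rw [link_succ s hj, ← CoVal.cons_assoc, ← hv j, ← ih]

theorem link_cons_link {P : ℕ → Type} (s : ∀ i, CoVal (P i) (P (i + 1))) {i j k : ℕ} (h : i ≤ j)
    (h' : j ≤ k) : (link s h).cons (link s h') = link s (h.trans h') := by
  induction k, h' using Nat.le_induction with
  | base => rw [link_self, CoVal.cons_refl]
  | succ k hk ih => rw [link_succ s hk, CoVal.cons_assoc, ih, ← link_succ s (h.trans hk)]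

/-- Two chains with the same steps below level `j` have the same order up to level `j`. -/
theorem link_congr {P : ℕ → Type} {s s' : ∀ i, CoVal (P i) (P (i + 1))} {i j : ℕ} (h : i ≤ j)
    (hs : ∀ k < j, s k = s' k) : link s h = link s' h := by
  induction j, h using Nat.le_induction with
  | base => rw [link_self, link_self]
  | succ j hj ih =>
    rw [link_succ s hj, link_succ s' hj, ih fun k hk => hs k (hk.trans j.lt_succ_self),
      hs j j.lt_succ_self]

theorem isCap_iff {P : ℕ → Type} [∀ i, Finite (P i)] {s : ∀ i, CoVal (P i) (P (i + 1))}
    {C : Set (Σ i, P i)} : IsCap s C ↔ ∃ N, ∀ z : P N, ∃ c ∈ C, Ge s c ⟨N, z⟩ := by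
  constructor
  · rintro ⟨B, ⟨hfin, hcomp⟩, hBC⟩
    obtain ⟨N, hN⟩ := (hfin.image Sigma.fst).bddAbove
    refine ⟨N + 1, fun z => ?_⟩
    obtain ⟨q, hq, hor⟩ := hcomp ⟨N + 1, z⟩
    have hqN : q.1 ≤ N := hN ⟨q, hq, rfl⟩
    rcases hor with h | h
    · have h1 : N + 1 ≤ q.1 := h.level_le
      omega
    · obtain ⟨c, hc, hcq⟩ := hBC q hq
      exact ⟨c, hc, hcq.trans h⟩
  · rintro ⟨N, hN⟩
    obtain ⟨B, hB, hBC⟩ := isCap_level s N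
    refine ⟨B, hB, fun b hb => ?_⟩
    obtain ⟨_, ⟨z, rfl⟩, hz⟩ := hBC b hb
    obtain ⟨c, hc, hcz⟩ := hN z
    exact ⟨c, hc, hcz.trans hz⟩

theorem isSelector_iff {P : ℕ → Type} [∀ i, Finite (P i)] {s : ∀ i, CoVal (P i) (P (i + 1))}
    {S : Set (Σ i, P i)} :
    IsSelector s S ↔ ∀ C : Set (Σ i, P i), (∃ N, ∀ z : P N, ∃ c ∈ C, Ge s c ⟨N, z⟩) →
      (S ∩ C).Nonempty := by
  simp only [IsSelector, isCap_iff]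

/-- Each element of a minimal selector is the only element of the selector in some cap. -/
theorem Spectrum.exists_cap {P : ℕ → Type} {s : ∀ i, CoVal (P i) (P (i + 1))} (S : Spectrum s)
    {p : Σ i, P i} (hp : p ∈ S.1) : ∃ C, IsCap s C ∧ S.1 ∩ C = {p} := by
  have h : ¬ IsSelector s (S.1 \ {p}) := fun h => (S.2.2 h Set.sdiff_subset hp).2 rfl
  simp only [IsSelector, not_forall] at h
  obtain ⟨C, hC, hne⟩ := h
  refine ⟨C, hC, ?_⟩
  have hsub : S.1 ∩ C ⊆ {p} := fun q hq => by
    by_contra hqp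
    exact hne ⟨q, ⟨hq.1, hqp⟩, hq.2⟩
  exact (Set.Nonempty.subset_singleton_iff (S.2.1 C hC)).1 hsub

theorem Spectrum.mem_of_ge {P : ℕ → Type} {s : ∀ i, CoVal (P i) (P (i + 1))} (S : Spectrum s)
    {p q : Σ i, P i} (hp : p ∈ S.1) (hqp : Ge s q p) : q ∈ S.1 := by
  obtain ⟨C, ⟨B, hB, hBC⟩, hSC⟩ := S.exists_cap hp
  have hcap : IsCap s ((C \ {p}) ∪ {q}) := by
    refine ⟨B, hB, fun b hb => ?_⟩
    obtain ⟨c, hc, hcb⟩ := hBC b hb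
    by_cases hcp : c = p
    · exact ⟨q, Or.inr rfl, hqp.trans (hcp ▸ hcb)⟩
    · exact ⟨c, Or.inl ⟨hc, hcp⟩, hcb⟩
  obtain ⟨r, hrS, hr | hr⟩ := S.2.1 _ hcap
  · exact absurd (hSC.subset ⟨hrS, hr.1⟩) hr.2
  · exact Set.mem_singleton_iff.1 hr ▸ hrS

theorem Spectrum.exists_mem_level {P : ℕ → Type} [∀ i, Finite (P i)]
    {s : ∀ i, CoVal (P i) (P (i + 1))} (S : Spectrum s) (i : ℕ) :
    ∃ x : P i, (⟨i, x⟩ : Σ i, P i) ∈ S.1 := by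
  obtain ⟨_, hqS, x, rfl⟩ := S.2.1 _ (isCap_level s i)
  exact ⟨x, hqS⟩

/-- A minimal selector converges: on late levels all its elements are below any given one. -/
theorem Spectrum.eventually_ge {P : ℕ → Type} [∀ i, Finite (P i)]
    {s : ∀ i, CoVal (P i) (P (i + 1))} (S : Spectrum s) {p : Σ i, P i} (hp : p ∈ S.1) :
    ∃ N₀, ∀ N ≥ N₀, ∀ z : P N, (⟨N, z⟩ : Σ i, P i) ∈ S.1 → Ge s p ⟨N, z⟩ := by
  obtain ⟨C, hC, hSC⟩ := S.exists_cap hp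
  obtain ⟨N₀, hN₀⟩ := isCap_iff.1 hC
  refine ⟨N₀, fun N hN z hz => ?_⟩
  obtain ⟨y, hy⟩ := exists_ge_of_le s hN z
  obtain ⟨c, hc, hcy⟩ := hN₀ y
  have : c = p := hSC.subset ⟨S.mem_of_ge hz (hcy.trans hy), hc⟩
  exact this ▸ hcy.trans hy

theorem levelVal_eq_cons {P : ℕ → Type} [∀ i, Finite (P i)] (s : ∀ i, CoVal (P i) (P (i + 1)))
    (i : ℕ) : levelVal s i = (s i).cons (levelVal s (i + 1)) := by
  ext x S
  constructor
  · intro hx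
    obtain ⟨N₀, hN₀⟩ := S.eventually_ge hx
    obtain ⟨z, hz⟩ := S.exists_mem_level (max N₀ (i + 1))
    have hz' := hN₀ _ (le_max_left _ _) z hz
    rcases Relation.ReflTransGen.cases_head hz' with h | ⟨r, h1, h2⟩
    · have h3 := congrArg Sigma.fst h
      simp only at h3
      have := le_max_right N₀ (i + 1)
      omega
    · cases h1 with
      | mk h => exact ⟨_, h, S.mem_of_ge hz h2⟩
  · rintro ⟨y, hxy, hy⟩
    exact S.mem_of_ge hy (Relation.ReflTransGen.single (Step.mk hxy))

/-- The topology of the spectrum, generated by the cells of the levels. -/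
@[reducible] def spectrumTopology {P : ℕ → Type} (s : ∀ i, CoVal (P i) (P (i + 1))) :
    TopologicalSpace (Spectrum s) :=
  TopologicalSpace.generateFrom {U | ∃ p : Σ i, P i, U = {S | p ∈ S.1}}

theorem isOpen_mem {P : ℕ → Type} (s : ∀ i, CoVal (P i) (P (i + 1))) (p : Σ i, P i) :
    IsOpen[spectrumTopology s] {S | p ∈ S.1} :=
  TopologicalSpace.isOpen_generateFrom_of_mem ⟨p, rfl⟩

theorem exists_mem_subset_of_isOpen {P : ℕ → Type} [∀ i, Finite (P i)]
    {s : ∀ i, CoVal (P i) (P (i + 1))} {U : Set (Spectrum s)} (hU : IsOpen[spectrumTopology s] U)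
    {S : Spectrum s} (hS : S ∈ U) : ∃ p ∈ S.1, {S' : Spectrum s | p ∈ S'.1} ⊆ U := by
  induction hU with
  | basic U hU =>
    obtain ⟨p, rfl⟩ := hU
    exact ⟨p, hS, subset_rfl⟩
  | univ =>
    obtain ⟨x, hx⟩ := S.exists_mem_level 0
    exact ⟨_, hx, Set.subset_univ _⟩
  | inter U V _ _ ihU ihV =>
    obtain ⟨p, hp, hpU⟩ := ihU hS.1
    obtain ⟨q, hq, hqV⟩ := ihV hS.2
    obtain ⟨N₁, h1⟩ := S.eventually_ge hp
    obtain ⟨N₂, h2⟩ := S.eventually_ge hq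
    obtain ⟨z, hz⟩ := S.exists_mem_level (max N₁ N₂)
    exact ⟨_, hz, fun S' hS' => ⟨hpU (S'.mem_of_ge hS' (h1 _ (le_max_left _ _) z hz)),
      hqV (S'.mem_of_ge hS' (h2 _ (le_max_right _ _) z hz))⟩⟩
  | sUnion 𝒰 _ ih =>
    obtain ⟨U, hU, hSU⟩ := hS
    obtain ⟨p, hp, hpU⟩ := ih U hU hSU
    exact ⟨p, hp, hpU.trans (Set.subset_sUnion_of_mem hU)⟩

/-- Every open cover of the spectrum is refined by a level: otherwise the elements whose cells lie in
no member of the cover would form a selector, and a minimal selector inside it would not be covered. -/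
theorem exists_level_refining {P : ℕ → Type} [∀ i, Finite (P i)]
    {s : ∀ i, CoVal (P i) (P (i + 1))} (𝒰 : Set (Set (Spectrum s)))
    (hopen : ∀ U ∈ 𝒰, IsOpen[spectrumTopology s] U) (hcov : ⋃₀ 𝒰 = Set.univ) :
    ∃ N, ∀ z : P N, ∃ U ∈ 𝒰, (levelVal s N).cell z ⊆ U := by
  have hC : IsCap s {p | ∃ U ∈ 𝒰, {S : Spectrum s | p ∈ S.1} ⊆ U} := by
    by_contra hC
    have hsel : IsSelector s {p | ∃ U ∈ 𝒰, {S : Spectrum s | p ∈ S.1} ⊆ U}ᶜ := by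
      rintro D ⟨B, hB, hBD⟩
      by_contra hne
      refine hC ⟨B, hB, fun b hb => ?_⟩
      obtain ⟨d, hd, hdb⟩ := hBD b hb
      refine ⟨d, ?_, hdb⟩
      by_contra hd'
      exact hne ⟨d, hd', hd⟩
    obtain ⟨S, hSD, hS⟩ := hsel.exists_minimal
    obtain ⟨U, hU, hSU⟩ : (⟨S, hS⟩ : Spectrum s) ∈ ⋃₀ 𝒰 := hcov ▸ Set.mem_univ _
    obtain ⟨p, hp, hpU⟩ := exists_mem_subset_of_isOpen (hopen U hU) hSU
    exact hSD hp ⟨U, hU, hpU⟩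
  obtain ⟨N, hN⟩ := isCap_iff.1 hC
  refine ⟨N, fun z => ?_⟩
  obtain ⟨p, ⟨U, hU, hpU⟩, hpz⟩ := hN z
  exact ⟨U, hU, fun S hS => hpU (S.mem_of_ge hS hpz)⟩

theorem compactSpace_spectrum {P : ℕ → Type} [∀ i, Finite (P i)]
    (s : ∀ i, CoVal (P i) (P (i + 1))) : @CompactSpace (Spectrum s) (spectrumTopology s) := by
  let _ := spectrumTopology s
  refine ⟨isCompact_of_finite_subcover fun {ι} U hU hcov => ?_⟩
  obtain ⟨N, hN⟩ := exists_level_refining (s := s) (Set.range U) (by rintro _ ⟨i, rfl⟩; exact hU i)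
    (by rw [Set.sUnion_range]; exact Set.univ_subset_iff.1 hcov)
  have hN' : ∀ z : P N, ∃ i, (levelVal s N).cell z ⊆ U i := fun z => by
    obtain ⟨_, ⟨i, rfl⟩, h⟩ := hN z
    exact ⟨i, h⟩
  choose f hf using hN'
  classical
  have := Fintype.ofFinite (P N)
  refine ⟨Finset.univ.image f, fun S _ => ?_⟩
  obtain ⟨z, hz⟩ := S.exists_mem_level N
  exact Set.mem_biUnion (Finset.mem_coe.2 (Finset.mem_image_of_mem f (Finset.mem_univ z))) (hf z hz)

theorem Spectrum.exists_mem_notMem {P : ℕ → Type} {s : ∀ i, CoVal (P i) (P (i + 1))}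
    {S S' : Spectrum s} (h : S ≠ S') : ∃ p ∈ S.1, p ∉ S'.1 := by
  by_contra! hcon
  exact h (Subtype.ext (le_antisymm hcon (S'.2.2 S.2.1 hcon)))

theorem t1Space_spectrum {P : ℕ → Type} (s : ∀ i, CoVal (P i) (P (i + 1))) :
    @T1Space (Spectrum s) (spectrumTopology s) := by
  let _ := spectrumTopology s
  refine t1Space_iff_exists_open.2 fun S S' h => ?_
  obtain ⟨p, hp, hp'⟩ := Spectrum.exists_mem_notMem h
  exact ⟨_, isOpen_mem s p, hp, hp'⟩

end OmegaChain

/-! ### Satisfaction and cores -/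

namespace ProtoStructure

variable {L : FirstOrder.Language}

@[simp] theorem sat_bot (M : ProtoStructure L) {X : Ctx} (v : CoVal X M.carrier) :
    M.Sat .bot v ↔ False := by rw [Sat]

theorem sat_rel (M : ProtoStructure L) {X : Ctx} (v : CoVal X M.carrier) {n : ℕ}
    (R : L.Relations n) (x : Fin n → X) :
    M.Sat (.rel R x) v ↔ ∃ a ∈ M.interp R, ∀ k, a k ∈ v.cell (x k) := by rw [Sat]

@[simp] theorem sat_neg (M : ProtoStructure L) {X : Ctx} (v : CoVal X M.carrier)
    (φ : CoFormula L X) : M.Sat (.neg φ) v ↔ ¬ M.Sat φ v := by rw [Sat]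

@[simp] theorem sat_and (M : ProtoStructure L) {X : Ctx} (v : CoVal X M.carrier)
    (φ ψ : CoFormula L X) : M.Sat (.and φ ψ) v ↔ M.Sat φ v ∧ M.Sat ψ v := by rw [Sat]

theorem sat_exFr (M : ProtoStructure L) {X Y : Ctx} (v : CoVal X M.carrier) (g : CoVal X Y)
    (φ : CoFormula L Y) : M.Sat (.exFr g φ) v ↔ ∃ w ∈ M.adm Y, v = g.cons w ∧ M.Sat φ w := by
  rw [Sat]

theorem sat_rel_cons (M : ProtoStructure L) {X Y : Ctx} (g : CoVal X Y) (w : CoVal Y M.carrier)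
    {n : ℕ} (R : L.Relations n) (x : Fin n → X) :
    M.Sat (.rel R x) (g.cons w) ↔ ∃ y : Fin n → Y, (∀ k, g.rel (x k) (y k)) ∧ M.Sat (.rel R y) w := by
  simp only [sat_rel]
  constructor
  · rintro ⟨a, ha, h⟩
    choose y h1 h2 using h
    exact ⟨y, h1, a, ha, h2⟩
  · rintro ⟨y, h1, a, ha, h2⟩
    exact ⟨a, ha, fun k => ⟨y k, h1 k, h2 k⟩⟩

theorem models_iff (M : ProtoStructure L) [Nonempty M.carrier] {T : CoTheory L}
    {v : CoVal starCtx M.carrier} (hv : v ∈ M.adm starCtx) :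
    M.Models T ↔ ∀ φ ∈ T, M.Sat φ v := by
  constructor
  · rintro ⟨w, -, hw⟩
    rwa [CoVal.eq_single v, ← CoVal.eq_single w]
  · exact fun h => ⟨v, hv, h⟩

theorem IsStructure.single_mem {M : ProtoStructure L} (hM : M.IsStructure)
    [Nonempty M.carrier] : CoVal.single starCtx M.carrier ∈ M.adm starCtx := by
  obtain ⟨X, v, hv⟩ := hM.adm_nonempty
  have : Nonempty X := (v.cosurj (Classical.arbitrary _)).nonempty
  have h := M.adm_cons (CoVal.single starCtx X) v hv
  rwa [CoVal.eq_single ((CoVal.single starCtx X).cons v)] at h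

theorem adm_of_coarser {M : ProtoStructure L} {X Y : Ctx} {u : CoVal X M.carrier}
    {w : CoVal Y M.carrier} (h : u.Coarser w) (hw : w ∈ M.adm Y) : u ∈ M.adm X := by
  obtain ⟨g, rfl⟩ := h
  exact M.adm_cons g w hw

open OmegaChain in
/-- Two structures with cores that have the same steps and satisfy the same atomic formulas satisfy the
same formulas. -/
theorem sat_iff_of_isCore {M N : ProtoStructure L} {Y : ℕ → Ctx} {s : ∀ i, CoVal (Y i) (Y (i + 1))}
    {v : ∀ i, CoVal (Y i) M.carrier} {v' : ∀ i, CoVal (Y i) N.carrier}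
    (hv : M.IsCore Y v) (hv' : N.IsCore Y v')
    (hs : ∀ i, v i = (s i).cons (v (i + 1))) (hs' : ∀ i, v' i = (s i).cons (v' (i + 1)))
    (hat : ∀ i {n : ℕ} (R : L.Relations n) (x : Fin n → Y i),
      M.Sat (.rel R x) (v i) ↔ N.Sat (.rel R x) (v' i))
    {X : Ctx} (φ : CoFormula L X) (i : ℕ) (h : CoVal X (Y i)) :
    M.Sat φ (h.cons (v i)) ↔ N.Sat φ (h.cons (v' i)) := by
  induction φ generalizing i with
  | bot => simp
  | rel R x => simp only [sat_rel_cons, hat]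
  | neg φ ih => simp only [sat_neg, ih]
  | and φ ψ ih1 ih2 => simp only [sat_and, ih1, ih2]
  | @exFr X Z g φ ih =>
    -- Equations between consolidations of members of a core only depend on the steps.
    have key : ∀ {M N : ProtoStructure L} {v : ∀ i, CoVal (Y i) M.carrier}
        {v' : ∀ i, CoVal (Y i) N.carrier} (_ : ∀ i, v i = (s i).cons (v (i + 1)))
        (_ : ∀ i, v' i = (s i).cons (v' (i + 1))) (i j : ℕ) (h : CoVal X (Y i)) (h' : CoVal X (Y j)),
        h.cons (v i) = h'.cons (v j) → h.cons (v' i) = h'.cons (v' j) := by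
      intro M N v v' hs hs' i j h h' heq
      rw [eq_link_cons (P := fun i => Y i) hs (le_max_left i j),
        eq_link_cons (P := fun i => Y i) hs (le_max_right i j),
        CoVal.cons_assoc, CoVal.cons_assoc] at heq
      rw [eq_link_cons (P := fun i => Y i) hs' (le_max_left i j),
        eq_link_cons (P := fun i => Y i) hs' (le_max_right i j),
        CoVal.cons_assoc, CoVal.cons_assoc, CoVal.cons_right_cancel _ heq]
    simp only [sat_exFr]
    constructor
    · rintro ⟨w, hw, heq, hsat⟩
      obtain ⟨j, h', rfl⟩ := hv.generates w hw
      rw [CoVal.cons_assoc] at heq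
      exact ⟨h'.cons (v' j), N.adm_cons _ _ (hv'.mem j),
        (key hs hs' i j h _ heq).trans (CoVal.cons_assoc _ _ _).symm, (ih j h').1 hsat⟩
    · rintro ⟨w, hw, heq, hsat⟩
      obtain ⟨j, h', rfl⟩ := hv'.generates w hw
      rw [CoVal.cons_assoc] at heq
      exact ⟨h'.cons (v j), M.adm_cons _ _ (hv.mem j),
        (key hs' hs i j h _ heq).trans (CoVal.cons_assoc _ _ _).symm, (ih j h').2 hsat⟩

open OmegaChain in
theorem sat_rel_of_ge {M : ProtoStructure L} {Y : ℕ → Ctx} {s : ∀ i, CoVal (Y i) (Y (i + 1))}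
    {v : ∀ i, CoVal (Y i) M.carrier} (hs : ∀ i, v i = (s i).cons (v (i + 1))) {n : ℕ}
    (R : L.Relations n) {i : ℕ} {y : Fin n → Y i} (hy : M.Sat (.rel R y) (v i)) {j : ℕ}
    (x : Fin n → Y j) (hxy : ∀ k, Ge (P := fun i => Y i) s ⟨j, x k⟩ ⟨i, y k⟩) :
    M.Sat (.rel R x) (v j) := by
  cases n with
  | zero =>
    obtain ⟨a, ha, -⟩ := (sat_rel _ _ _ _).1 hy
    exact (sat_rel _ _ _ _).2 ⟨a, ha, fun k => k.elim0⟩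
  | succ n =>
    have hji : j ≤ i := (hxy 0).level_le
    rw [eq_link_cons (P := fun i => Y i) hs hji]
    exact (sat_rel_cons _ _ _ _ _).2 ⟨y, hxy, hy⟩

end ProtoStructure

/-! ### The compact structure of a chain of contexts -/

section Chain

open OmegaChain ProtoStructure

variable {L : FirstOrder.Language} [L.IsRelational] {Y : ℕ → Ctx}
  {s : ∀ i, CoVal (Y i) (Y (i + 1))} {holds : ∀ (i : ℕ) {n : ℕ}, L.Relations n → (Fin n → Y i) → Prop}

/-- The proto-structure of a chain of contexts of arbitrary sizes with sets of tuples on its levels. For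
the contexts `levelCtx i` this is the structure of a code. -/
def chainStr (Y : ℕ → Ctx) (s : ∀ i, CoVal (Y i) (Y (i + 1)))
    (holds : ∀ (i : ℕ) {n : ℕ}, L.Relations n → (Fin n → Y i) → Prop) : ProtoStructure L where
  carrier := Spectrum (P := fun i => Y i) s
  str :=
    { funMap := fun f _ => isEmptyElim f
      RelMap := fun R S => ∀ i (x : Fin _ → Y i),
        (∀ k, (⟨i, x k⟩ : Σ i, Y i) ∈ (S k).1) → holds i R x }
  adm X := {w | ∃ i, ∃ g : CoVal X (Y i), w = g.cons (levelVal (P := fun i => Y i) s i)}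
  adm_cons := by
    rintro X Z g w ⟨i, h, rfl⟩
    exact ⟨i, g.cons h, CoVal.cons_assoc g h _⟩

/-- The canonical core of the structure of a chain. -/
def chainVal (s : ∀ i, CoVal (Y i) (Y (i + 1)))
    (holds : ∀ (i : ℕ) {n : ℕ}, L.Relations n → (Fin n → Y i) → Prop) (i : ℕ) :
    CoVal (Y i) (chainStr Y s holds).carrier :=
  levelVal (P := fun i => Y i) s i

theorem chainVal_eq_cons (i : ℕ) :
    chainVal s holds i = (s i).cons (chainVal s holds (i + 1)) :=
  levelVal_eq_cons (P := fun i => Y i) s i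

theorem isCore_chainVal : (chainStr Y s holds).IsCore Y (chainVal s holds) where
  mem i := ⟨i, CoVal.refl _, (CoVal.refl_cons _).symm⟩
  chain i := ⟨s i, chainVal_eq_cons i⟩
  generates := fun _ hw => hw

/-- Witnesses exist on a level so late that the finitely many points concerned have pairwise disjoint
sets of elements there. The witness is the partition of that level with these sets as classes. -/
theorem chainStr_exists_witness {X : Ctx} (v : CoVal X (chainStr Y s holds).carrier)
    (hv : v ∈ (chainStr Y s holds).adm X) {n : ℕ} (R : L.Relations n) (x : Fin n → X)
    (h : (chainStr Y s holds).Sat (.rel R x) v) :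
    ∃ (Z : Ctx), ∃ w ∈ (chainStr Y s holds).adm Z, (chainStr Y s holds).IsWitness R v x w := by
  obtain ⟨i, g, rfl⟩ := hv
  obtain ⟨a, ha, hax⟩ := (sat_rel _ _ _ _).1 h
  choose z hgz hza using hax
  let S : Fin n → Spectrum (P := fun i => Y i) s := a
  have hfar : ∀ k, ∃ N₀, ∀ N ≥ N₀, ∀ y : Y N, (⟨N, y⟩ : Σ i, Y i) ∈ (S k).1 →
      Ge (P := fun i => Y i) s ⟨i, z k⟩ ⟨N, y⟩ := fun k => (S k).eventually_ge (hza k)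
  have hsep : ∀ k l, ∃ N₀, ∀ N ≥ N₀, ∀ y : Y N, (⟨N, y⟩ : Σ i, Y i) ∈ (S k).1 →
      (⟨N, y⟩ : Σ i, Y i) ∈ (S l).1 → S k = S l := by
    intro k l
    by_cases hkl : S k = S l
    · exact ⟨0, fun _ _ _ _ _ => hkl⟩
    · obtain ⟨p, hp, hp'⟩ := Spectrum.exists_mem_notMem hkl
      obtain ⟨N₀, hN₀⟩ := (S k).eventually_ge hp
      exact ⟨N₀, fun N hN y hy hy' => absurd ((S l).mem_of_ge hy' (hN₀ N hN y hy)) hp'⟩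
  choose N₁ hN₁ using hfar
  choose N₂ hN₂ using hsep
  obtain ⟨N, hN⟩ : ∃ N, (∀ k, N₁ k ≤ N) ∧ ∀ k l, N₂ k l ≤ N := by
    refine ⟨(Finset.univ.sup N₁) + Finset.univ.sup (fun p : Fin n × Fin n => N₂ p.1 p.2),
      fun k => ?_, fun k l => ?_⟩
    · exact (Finset.le_sup (f := N₁) (Finset.mem_univ k)).trans (Nat.le_add_right _ _)
    · exact (Finset.le_sup (f := fun p : Fin n × Fin n => N₂ p.1 p.2)
        (Finset.mem_univ (k, l))).trans (Nat.le_add_left _ _)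
  classical
  let τ : Y N → Spectrum (P := fun i => Y i) s ⊕ Y N := fun y =>
    if hy : ∃ k, (⟨N, y⟩ : Σ i, Y i) ∈ (S k).1 then Sum.inl (S hy.choose) else Sum.inr y
  have hτ : ∀ y k, (⟨N, y⟩ : Σ i, Y i) ∈ (S k).1 → τ y = Sum.inl (S k) := by
    intro y k hy
    have hex : ∃ k, (⟨N, y⟩ : Σ i, Y i) ∈ (S k).1 := ⟨k, hy⟩
    simp only [τ, hex, dite_true]
    rw [hN₂ _ _ N (hN.2 _ _) y hex.choose_spec hy]
  have hτ' : ∀ y k, τ y = Sum.inl (S k) → (⟨N, y⟩ : Σ i, Y i) ∈ (S k).1 := by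
    intro y k hy
    by_cases hex : ∃ k, (⟨N, y⟩ : Σ i, Y i) ∈ (S k).1
    · simp only [τ, hex, dite_true, Sum.inl.injEq] at hy
      exact hy ▸ hex.choose_spec
    · simp [τ, hex] at hy
  obtain ⟨f, hf, hfτ⟩ := exists_surjective_fiber_eq τ
  choose t ht using fun k => (S k).exists_mem_level N
  refine ⟨_, (CoVal.ofSurj f hf).cons (chainVal s holds N),
    ⟨N, CoVal.ofSurj f hf, rfl⟩, fun k => f (t k), a, fun k => ⟨⟨t k, rfl, ht k⟩, ?_⟩, fun k => ?_, ha⟩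
  · rintro u ⟨y, rfl, hy⟩
    exact (hfτ _ _).2 ((hτ y k hy).trans (hτ _ k (ht k)).symm)
  · rintro b ⟨y, hy, hyb⟩
    have hyS := hτ' y k (((hfτ _ _).1 hy).trans (hτ _ k (ht k)))
    exact ⟨z k, hgz k, Spectrum.mem_of_ge b hyb (hN₁ k N (hN.1 k) y hyS)⟩

theorem chainStr_isStructure [Nonempty (Y 0)] : (chainStr Y s holds).IsStructure where
  nonempty := by
    obtain ⟨S, -⟩ := exists_private (P := fun i => Y i) s 0 (Classical.arbitrary (Y 0))
    exact ⟨S⟩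
  adm_nonempty := ⟨_, _, isCore_chainVal.mem 0⟩
  directed := by
    have hv : ∀ i, chainVal s holds i = (s i).cons (chainVal s holds (i + 1)) := chainVal_eq_cons
    rintro X X' u ⟨i, g, rfl⟩ v ⟨j, h, rfl⟩
    refine ⟨_, _, isCore_chainVal.mem (max i j), g.cons (link (P := fun i => Y i) s (le_max_left i j)),
      h.cons (link (P := fun i => Y i) s (le_max_right i j)), ?_, ?_⟩
    · rw [← CoVal.cons_assoc]
      exact congrArg g.cons (eq_link_cons (P := fun i => Y i) hv _)
    · rw [← CoVal.cons_assoc]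
      exact congrArg h.cons (eq_link_cons (P := fun i => Y i) hv _)
  witness := fun R _ v hv x h => chainStr_exists_witness v hv R x h

theorem chainStr_isCompact : (chainStr Y s holds).IsCompact := by
  let _ : TopologicalSpace (Spectrum (P := fun i => Y i) s) := spectrumTopology _
  let _ : TopologicalSpace (chainStr Y s holds).carrier := spectrumTopology (P := fun i => Y i) s
  refine ⟨spectrumTopology (P := fun i => Y i) s, compactSpace_spectrum (P := fun i => Y i) s,
    t1Space_spectrum (P := fun i => Y i) s, ?_, ?_, ?_⟩
  · rintro X _ ⟨i, g, rfl⟩ x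
    have : (g.cons (levelVal (P := fun i => Y i) s i)).cell x =
        ⋃ z ∈ {z | g.rel x z}, {S : Spectrum (P := fun i => Y i) s | (⟨i, z⟩ : Σ i, Y i) ∈ S.1} := by
      ext S
      simp [CoVal.cell, CoVal.cons, levelVal]
    exact this ▸ isOpen_biUnion fun z _ => isOpen_mem (P := fun i => Y i) s _
  · intro 𝒰 hopen hcov
    obtain ⟨N, hN⟩ := exists_level_refining (P := fun i => Y i) 𝒰 hopen hcov
    exact ⟨_, _, isCore_chainVal.mem N, hN⟩
  · intro n R
    have : (chainStr Y s holds).interp R = ⋂ i, ⋂ x ∈ {x : Fin n → Y i | ¬ holds i R x},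
        (⋂ k, {S : Fin n → (chainStr Y s holds).carrier |
          (⟨i, x k⟩ : Σ i, Y i) ∈ (S k : Spectrum (P := fun i => Y i) s).1})ᶜ := by
      ext S
      simp only [Set.mem_iInter, Set.mem_compl_iff]
      exact forall_congr' fun i => forall_congr' fun x => not_imp_not.symm
    rw [this]
    refine isClosed_iInter fun i => isClosed_biInter fun x _ => IsOpen.isClosed_compl ?_
    refine isOpen_iInter_of_finite fun k => ?_
    have hk : IsOpen {T : (chainStr Y s holds).carrier |
        (⟨i, x k⟩ : Σ i, Y i) ∈ (T : Spectrum (P := fun i => Y i) s).1} :=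
      isOpen_mem (P := fun i => Y i) s ⟨i, x k⟩
    exact hk.preimage (f := fun S : Fin n → (chainStr Y s holds).carrier => S k)
      (continuous_apply k)

/-- The structure of a chain is always a compact `ω`-structure. -/
theorem chainStr_isCompactOmega [Nonempty (Y 0)] : (chainStr Y s holds).IsCompactOmega where
  isStructure := chainStr_isStructure
  isCompact := chainStr_isCompact
  hasCore := ⟨_, _, isCore_chainVal⟩

open Filter in
/-- A sequence of tuples in the relation, one on each late level, has a limit: a tuple of points in the
interpretation of the relation, each of whose elements is above the corresponding entry of some tuple
of the sequence. It consists of minimal selectors inside the sets of those elements that are above the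
entries for most levels, in the sense of a non-principal ultrafilter. -/
theorem exists_interp_of_tuples
    (hup : ∀ {n : ℕ} (R : L.Relations n) (i : ℕ) (y : Fin n → Y i), holds i R y →
      ∀ (j : ℕ) (x : Fin n → Y j), (∀ k, Ge (P := fun i => Y i) s ⟨j, x k⟩ ⟨i, y k⟩) → holds j R x)
    {n : ℕ} (R : L.Relations n) (j : ℕ) (y : ∀ i, Fin n → Y i) (hy : ∀ i ≥ j, holds i R (y i)) :
    ∃ S ∈ (chainStr Y s holds).interp R, ∀ k, ∀ p ∈ (S k : Spectrum (P := fun i => Y i) s).1,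
      ∃ i ≥ j, Ge (P := fun i => Y i) s p ⟨i, y i k⟩ := by
  have hD : ∀ k, IsSelector (P := fun i => Y i) s
      {p | ∀ᶠ i in (hyperfilter ℕ : Filter ℕ), Ge (P := fun i => Y i) s p ⟨i, y i k⟩} := by
    intro k
    rw [isSelector_iff]
    rintro C ⟨N, hN⟩
    have h1 : ∀ᶠ i in (hyperfilter ℕ : Filter ℕ),
        i ∈ ⋃ z ∈ (Set.univ : Set (Y N)), {i | Ge (P := fun i => Y i) s ⟨N, z⟩ ⟨i, y i k⟩} := by
      have : ∀ᶠ i in (hyperfilter ℕ : Filter ℕ), N ≤ i :=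
        (Nat.cofinite_eq_atTop ▸ hyperfilter_le_cofinite) (eventually_ge_atTop N)
      filter_upwards [this] with i hi
      obtain ⟨z, hz⟩ := exists_ge_of_le (P := fun i => Y i) s hi (y i k)
      exact Set.mem_biUnion (Set.mem_univ z) hz
    obtain ⟨z, -, hz⟩ := (Ultrafilter.finite_biUnion_mem_iff Set.finite_univ).1 h1
    obtain ⟨c, hc, hcz⟩ := hN z
    refine ⟨c, ?_, hc⟩
    filter_upwards [hz] with i hi
    exact hcz.trans hi
  choose S hSD hS using fun k => (hD k).exists_minimal
  have hfar : ∀ᶠ i in (hyperfilter ℕ : Filter ℕ), j ≤ i :=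
    (Nat.cofinite_eq_atTop ▸ hyperfilter_le_cofinite) (eventually_ge_atTop j)
  refine ⟨fun k => ⟨S k, hS k⟩, ?_, fun k p hp => ?_⟩
  · intro i x hx
    have h1 : ∀ᶠ i' in (hyperfilter ℕ : Filter ℕ),
        ∀ k, Ge (P := fun i => Y i) s ⟨i, x k⟩ ⟨i', y i' k⟩ :=
      eventually_all.2 fun k => hSD k (hx k)
    obtain ⟨i', h2, h3⟩ := (h1.and hfar).exists
    exact hup R i' _ (hy i' h3) i x h2
  · obtain ⟨i, h2, h3⟩ := ((hSD k hp).and hfar).exists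
    exact ⟨i, h3, h2⟩

/-- A structure with a core satisfies the same formulas as the compact structure of the chain formed by
the core. -/
theorem sat_chainStr_iff {M : ProtoStructure L} (hM : M.IsStructure)
    {v : ∀ i, CoVal (Y i) M.carrier} (hv : M.IsCore Y v)
    (hs : ∀ i, v i = (s i).cons (v (i + 1)))
    (hholds : ∀ i {n : ℕ} (R : L.Relations n) (x : Fin n → Y i),
      holds i R x ↔ M.Sat (.rel R x) (v i))
    {X : Ctx} (φ : CoFormula L X) (i : ℕ) (h : CoVal X (Y i)) :
    (chainStr Y s holds).Sat φ (h.cons (chainVal s holds i)) ↔ M.Sat φ (h.cons (v i)) := by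
  refine sat_iff_of_isCore isCore_chainVal hv chainVal_eq_cons hs ?_ φ i h
  intro i n R x
  have hup : ∀ {n : ℕ} (R : L.Relations n) (i : ℕ) (y : Fin n → Y i), holds i R y →
      ∀ (j : ℕ) (x : Fin n → Y j), (∀ k, Ge (P := fun i => Y i) s ⟨j, x k⟩ ⟨i, y k⟩) →
        holds j R x :=
    fun R i y hy j x hxy => (hholds j R x).2 (sat_rel_of_ge hs R ((hholds i R y).1 hy) x hxy)
  rw [← hholds, sat_rel]
  constructor
  · rintro ⟨a, ha, hax⟩
    exact ha i x hax
  · intro hx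
    obtain ⟨Z, w, hw, y, a, hya, hyx, haR⟩ := hM.witness R (v i) (hv.mem i) x ((hholds _ _ _).1 hx)
    obtain ⟨j, g, rfl⟩ := hv.generates w hw
    choose t ht using fun (i : ℕ) (k : Fin n) => (v i).cosurj (a k)
    obtain ⟨S, hSR, hS⟩ := exists_interp_of_tuples (s := s) hup R (max i j) t
      fun i' _ => (hholds _ _ _).2 ((sat_rel _ _ _ _).2 ⟨a, haR, fun k => ht i' k⟩)
    refine ⟨S, hSR, fun k => ?_⟩
    -- On level `j` the point `S k` only has elements inside the cell `y k` of the witness.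
    obtain ⟨z, hz⟩ := Spectrum.exists_mem_level (P := fun i => Y i) (S k) (max i j)
    obtain ⟨i', hi', hzi'⟩ := hS k _ hz
    obtain ⟨q, hq⟩ := exists_ge_of_le (P := fun i => Y i) s (le_max_right i j) z
    have haq : a k ∈ (v j).cell q := by
      rw [eq_link_cons (P := fun i => Y i) hs ((le_max_right i j).trans hi')]
      exact ⟨_, hq.trans hzi', ht i' k⟩
    obtain ⟨y', hy'⟩ := g.cosurj q
    have hyy : y' = y k := (hya k).2 y' ⟨q, hy', haq⟩
    subst hyy
    have hsub : (v (max i j)).cell z ⊆ (v i).cell (x k) := by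
      refine subset_trans ?_ (hyx k)
      refine subset_trans ?_ (CoVal.cell_cons_subset hy')
      rw [eq_link_cons (P := fun i => Y i) hs (le_max_right i j)]
      exact CoVal.cell_cons_subset (g := link (P := fun i => Y i) s (le_max_right i j)) hq
    rw [eq_link_cons (P := fun i => Y i) hs (le_max_left i j)] at hsub
    exact Spectrum.mem_of_ge (P := fun i => Y i) (S k) hz (CoVal.rel_of_cell_subset hsub)

end Chain

/-! ### Covers of prescribed size -/

namespace CoVal

theorem card_ctx (X : Ctx) : Nat.card X = X.card := by
  rw [Nat.card_eq_fintype_card, Fintype.card_coe]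

theorem coarser_ofSurj_cons {X Z U M : Type*} (p : CoVal X Z) (w : CoVal Z M) (f : Z → U)
    (hf : Function.Surjective f) (h : ∀ z z', f z = f z' → {x | p.rel x z} = {x | p.rel x z'}) :
    (p.cons w).Coarser ((ofSurj f hf).cons w) := by
  obtain ⟨p', hp'⟩ := exists_factor p f hf fun z z' hz x => (Set.ext_iff.1 (h z z' hz) x).1
  exact ⟨p', by rw [cons_assoc, ← hp']⟩

/-- A co-valuation in `X` has a fragmentation of any size from `2 ^ |X|` to the size of `Z` between
itself and a given fragmentation in `Z`: elements of `Z` below the same elements of `X` may be merged. -/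
theorem exists_between {X Z : Ctx} {M : Type*} {u : CoVal X M} {w : CoVal Z M} (h : u.Coarser w)
    {n : ℕ} (h1 : 2 ^ X.card ≤ n) (h2 : n ≤ Z.card) :
    ∃ v : CoVal (Finset.range n : Ctx) M, u.Coarser v ∧ v.Coarser w := by
  obtain ⟨p, rfl⟩ := h
  obtain ⟨f, hf, hτ⟩ := exists_surjective_refining (fun z => {x | p.rel x z}) n
    (((Set.ncard_le_card _).trans (by
      rw [Nat.card_eq_fintype_card, Fintype.card_set, Fintype.card_coe])).trans h1)
    (by rwa [card_ctx])
  exact ⟨_, coarser_ofSurj_cons p w f hf hτ, coarser_cons _ _⟩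

theorem ncard_range_pair_le {X Y Z : Ctx} (p : CoVal X Z) (q : CoVal Y Z) :
    (Set.range fun z => ({x | p.rel x z}, {y | q.rel y z})).ncard ≤ 2 ^ (X.card + Y.card) := by
  refine (Set.ncard_le_card _).trans ?_
  rw [Nat.card_eq_fintype_card, Fintype.card_prod, Fintype.card_set, Fintype.card_set,
    Fintype.card_coe, Fintype.card_coe, pow_add]

/-- Two co-valuations with a common fragmentation in `Z` have one of any size from `2 ^ (|X| + |Y|)` to
the size of `Z`. -/
theorem exists_common_between {X Y Z : Ctx} {M : Type*} {u : CoVal X M} {v : CoVal Y M}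
    {w : CoVal Z M} (hu : u.Coarser w) (hv : v.Coarser w) {n : ℕ}
    (h1 : 2 ^ (X.card + Y.card) ≤ n) (h2 : n ≤ Z.card) :
    ∃ t : CoVal (Finset.range n : Ctx) M, u.Coarser t ∧ v.Coarser t ∧ t.Coarser w := by
  obtain ⟨p, rfl⟩ := hu
  obtain ⟨q, rfl⟩ := hv
  obtain ⟨f, hf, hτ⟩ := exists_surjective_refining
    (fun z => ({x | p.rel x z}, {y | q.rel y z})) n ((ncard_range_pair_le p q).trans h1)
    (by rwa [card_ctx])
  exact ⟨_, coarser_ofSurj_cons p w f hf fun z z' h => congrArg Prod.fst (hτ z z' h),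
    coarser_ofSurj_cons q w f hf fun z z' h => congrArg Prod.snd (hτ z z' h), coarser_cons _ _⟩

/-- Two co-valuations with a common fragmentation have one of bounded size. -/
theorem exists_small_common {X Y Z : Ctx} {M : Type*} {u : CoVal X M} {v : CoVal Y M}
    {w : CoVal Z M} (hu : u.Coarser w) (hv : v.Coarser w) :
    ∃ n ≤ 2 ^ (X.card + Y.card), ∃ t : CoVal (Finset.range n : Ctx) M,
      u.Coarser t ∧ v.Coarser t ∧ t.Coarser w := by
  obtain ⟨p, rfl⟩ := hu
  obtain ⟨q, rfl⟩ := hv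
  obtain ⟨f, hf, hτ⟩ := exists_surjective_fiber_eq fun z => ({x | p.rel x z}, {y | q.rel y z})
  exact ⟨_, ncard_range_pair_le p q, _,
    coarser_ofSurj_cons p w f hf fun z z' h => congrArg Prod.fst ((hτ z z').1 h),
    coarser_ofSurj_cons q w f hf fun z z' h => congrArg Prod.snd ((hτ z z').1 h),
    coarser_cons _ _⟩

end CoVal

/-! ### Finite combinations and translations of formulas -/

namespace CoFormula

open ProtoStructure

variable {L : FirstOrder.Language}

theorem exists_iAnd {ι : Type*} [Finite ι] {X : Ctx} (f : ι → CoFormula L X) :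
    ∃ ψ : CoFormula L X, ∀ (M : ProtoStructure L) (v : CoVal X M.carrier),
      M.Sat ψ v ↔ ∀ i, M.Sat (f i) v := by
  obtain ⟨n, ⟨e⟩⟩ := Finite.exists_equiv_fin ι
  have key : ∀ (n : ℕ) (f : Fin n → CoFormula L X), ∃ ψ : CoFormula L X,
      ∀ (M : ProtoStructure L) (v : CoVal X M.carrier), M.Sat ψ v ↔ ∀ i, M.Sat (f i) v := by
    intro n
    induction n with
    | zero => exact fun f => ⟨.neg .bot, fun M v => by simp⟩
    | succ n ih =>
      intro f
      obtain ⟨ψ, hψ⟩ := ih fun i => f i.succ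
      exact ⟨.and (f 0) ψ, fun M v => by rw [sat_and, hψ, Fin.forall_fin_succ]⟩
  obtain ⟨ψ, hψ⟩ := key n (f ∘ e.symm)
  exact ⟨ψ, fun M v => (hψ M v).trans (e.symm.forall_congr_left.trans (by simp))⟩

theorem exists_iOr {ι : Type*} [Finite ι] {X : Ctx} (f : ι → CoFormula L X) :
    ∃ ψ : CoFormula L X, ∀ (M : ProtoStructure L) (v : CoVal X M.carrier),
      M.Sat ψ v ↔ ∃ i, M.Sat (f i) v := by
  obtain ⟨ψ, hψ⟩ := exists_iAnd fun i => neg (f i)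
  exact ⟨.neg ψ, fun M v => by simp [hψ]⟩

/-- Satisfaction at a consolidation of `v` can be expressed at `v`. For the quantifier this uses that
two members of a directed family have a common fragmentation of bounded size. -/
theorem exists_translation {Y : Ctx} (φ : CoFormula L Y) : ∀ {X : Ctx} (h : CoVal Y X),
    ∃ ψ : CoFormula L X, ∀ M : ProtoStructure L, M.IsStructure → ∀ v ∈ M.adm X,
      (M.Sat ψ v ↔ M.Sat φ (h.cons v)) := by
  induction φ with
  | bot => exact fun h => ⟨.bot, fun M _ v _ => by simp⟩
  | @rel Y n R x =>
    intro X h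
    obtain ⟨ψ, hψ⟩ := exists_iOr fun y : {y : Fin n → X // ∀ k, h.rel (x k) (y k)} => rel R y.1
    exact ⟨ψ, fun M _ v _ => by rw [hψ, sat_rel_cons, Subtype.exists]; simp only [exists_prop]⟩
  | neg φ ih =>
    intro X h
    obtain ⟨ψ, hψ⟩ := ih h
    exact ⟨.neg ψ, fun M hM v hv => by rw [sat_neg, sat_neg, hψ M hM v hv]⟩
  | and φ φ' ih ih' =>
    intro X h
    obtain ⟨ψ, hψ⟩ := ih h
    obtain ⟨ψ', hψ'⟩ := ih' h
    exact ⟨.and ψ ψ', fun M hM v hv => by rw [sat_and, sat_and, hψ M hM v hv, hψ' M hM v hv]⟩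
  | @exFr Y Y' g φ ih =>
    intro X h
    choose tr htr using @ih
    obtain ⟨ψ, hψ⟩ := exists_iOr
      (ι := Σ n : Fin (2 ^ (X.card + Y'.card) + 1), {pq : CoVal X (Finset.range n : Ctx) ×
        CoVal Y' (Finset.range n : Ctx) // h.cons pq.1 = g.cons pq.2})
      (fun k => exFr k.2.1.1 (tr k.2.1.2))
    refine ⟨ψ, fun M hM v hv => ?_⟩
    simp only [hψ, sat_exFr]
    constructor
    · rintro ⟨⟨n, ⟨p, q⟩, hpq⟩, t, ht, rfl, hsat⟩
      refine ⟨q.cons t, M.adm_cons q t ht, ?_, (htr q M hM t ht).1 hsat⟩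
      rw [CoVal.cons_assoc, CoVal.cons_assoc, hpq]
    · rintro ⟨w, hw, heq, hsat⟩
      obtain ⟨Z, z, hz, p₀, q₀, hp₀, hq₀⟩ := hM.directed v hv w hw
      obtain ⟨n, hn, t, ⟨p, rfl⟩, ⟨q, rfl⟩, htz⟩ :=
        CoVal.exists_small_common (u := v) (v := w) (w := z) ⟨p₀, hp₀⟩ ⟨q₀, hq₀⟩
      have ht := adm_of_coarser htz hz
      rw [CoVal.cons_assoc, CoVal.cons_assoc] at heq
      exact ⟨⟨⟨n, Nat.lt_succ_of_le hn⟩, ⟨p, q⟩, CoVal.cons_right_cancel t heq⟩, t, ht, rfl,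
        (htr q M hM t ht).2 hsat⟩

end CoFormula

/-! ### Countability -/

theorem exists_countable_closed {α : Type*} {B : Set α} (hB : B.Countable) (E : α → α → Set α)
    (hE : ∀ a b, (E a b).Countable) :
    ∃ D : Set α, B ⊆ D ∧ D.Countable ∧ ∀ a ∈ D, ∀ b ∈ D, E a b ⊆ D := by
  let D : ℕ → Set α := fun n => Nat.rec B (fun _ A => A ∪ ⋃ a ∈ A, ⋃ b ∈ A, E a b) n
  have hsucc : ∀ n, D (n + 1) = D n ∪ ⋃ a ∈ D n, ⋃ b ∈ D n, E a b := fun _ => rfl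
  have hmono : Monotone D := monotone_nat_of_le_succ fun n => by
    rw [hsucc]
    exact Set.subset_union_left
  refine ⟨⋃ n, D n, Set.subset_iUnion D 0, Set.countable_iUnion fun n => ?_, ?_⟩
  · induction n with
    | zero => exact hB
    | succ n ih =>
      rw [hsucc]
      exact ih.union (ih.biUnion fun a _ => ih.biUnion fun b _ => hE a b)
  · intro a ha b hb c hc
    obtain ⟨i, hi⟩ := Set.mem_iUnion.1 ha
    obtain ⟨j, hj⟩ := Set.mem_iUnion.1 hb
    refine Set.mem_iUnion.2 ⟨max i j + 1, ?_⟩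
    rw [hsucc]
    exact Or.inr (Set.mem_biUnion (hmono (le_max_left i j) hi)
      (Set.mem_biUnion (hmono (le_max_right i j) hj) hc))

instance CoFormula.countable_sigma {L : FirstOrder.Language} [Countable (Σ n, L.Relations n)] :
    Countable (Σ X : Ctx, CoFormula L X) := by
  have hrel : Countable (Σ X : Ctx, Σ R : (Σ n, L.Relations n), Fin R.1 → X) := inferInstance
  obtain ⟨D, hB, hD, hclosed⟩ := exists_countable_closed
    (α := Σ X : Ctx, CoFormula L X)
    (B := Set.range (fun X : Ctx => ⟨X, .bot⟩) ∪
      Set.range (fun r : Σ X : Ctx, Σ R : (Σ n, L.Relations n), Fin R.1 → X =>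
        ⟨r.1, .rel r.2.1.2 r.2.2⟩))
    ((Set.countable_range _).union (Set.countable_range _))
    (fun a b => {⟨a.1, .neg a.2⟩} ∪ {c | ∃ h : b.1 = a.1, c = ⟨a.1, .and a.2 (h ▸ b.2)⟩} ∪
      Set.range (fun g : Σ X : Ctx, CoVal X a.1 => ⟨g.1, .exFr g.2 a.2⟩))
    (fun a b => ((Set.countable_singleton _).union (Set.Subsingleton.countable (by
      rintro _ ⟨h, rfl⟩ _ ⟨h', rfl⟩
      rfl))).union (Set.countable_range _))
  have hmem : ∀ {X : Ctx} (φ : CoFormula L X), (⟨X, φ⟩ : Σ X : Ctx, CoFormula L X) ∈ D := by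
    intro X φ
    induction φ with
    | @bot X => exact hB (Or.inl ⟨X, rfl⟩)
    | @rel X n R x => exact hB (Or.inr ⟨⟨X, ⟨n, R⟩, x⟩, rfl⟩)
    | neg φ ih => exact hclosed _ ih _ ih (Or.inl (Or.inl rfl))
    | and φ ψ ih ih' => exact hclosed _ ih _ ih' (Or.inl (Or.inr ⟨rfl, rfl⟩))
    | exFr g φ ih => exact hclosed _ ih _ ih (Or.inr ⟨⟨_, g⟩, rfl⟩)
  exact Set.countable_univ_iff.1 (hD.mono fun a _ => hmem a.2)

instance CoFormula.countable {L : FirstOrder.Language} [Countable (Σ n, L.Relations n)] (X : Ctx) :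
    Countable (CoFormula L X) :=
  Function.Injective.countable (f := fun φ => (⟨X, φ⟩ : Σ X : Ctx, CoFormula L X))
    fun _ _ h => eq_of_heq (Sigma.mk.inj h).2

/-! ### Compact models from arbitrary models -/

open OmegaChain ProtoStructure in
/-- Downward Löwenheim–Skolem: every co-valuation of a structure has the same type as a co-valuation of
a compact `ω`-structure with the same theory. A countable elementary family of admissible
co-valuations has a core, and the chain formed by the core gives the compact structure. -/
theorem ProtoStructure.IsStructure.exists_isCompactOmega {L : FirstOrder.Language} [L.IsRelational]
    [Countable (Σ n, L.Relations n)] {M : ProtoStructure L} (hM : M.IsStructure) {X : Ctx}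
    {v : CoVal X M.carrier} (hv : v ∈ M.adm X) :
    ∃ N : ProtoStructure L, N.IsCompactOmega ∧ (∀ T : CoTheory L, M.Models T → N.Models T) ∧
      ∃ v' ∈ N.adm X, ∀ φ : CoFormula L X, N.Sat φ v' ↔ M.Sat φ v := by
  let α := Σ X : Ctx, {v : CoVal X M.carrier // v ∈ M.adm X}
  -- Choices of witnesses for quantifiers, for relations, and for directedness.
  have hex : ∀ (a : α) (k : Σ Z : Ctx, CoVal a.1 Z × CoFormula L Z), ∃ b : α,
      M.Sat (.exFr k.2.1 k.2.2) a.2.1 → ∃ w : CoVal k.1 M.carrier, ∃ hw : w ∈ M.adm k.1,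
        b = ⟨k.1, w, hw⟩ ∧ a.2.1 = k.2.1.cons w ∧ M.Sat k.2.2 w := by
    intro a k
    by_cases h : M.Sat (.exFr k.2.1 k.2.2) a.2.1
    · obtain ⟨w, hw, h1, h2⟩ := (sat_exFr _ _ _ _).1 h
      exact ⟨⟨k.1, w, hw⟩, fun _ => ⟨w, hw, rfl, h1, h2⟩⟩
    · exact ⟨a, fun h' => absurd h' h⟩
  have hwit : ∀ (a : α) (k : Σ R : (Σ n, L.Relations n), Fin R.1 → a.1), ∃ b : α,
      M.Sat (.rel k.1.2 k.2) a.2.1 → M.IsWitness k.1.2 a.2.1 k.2 b.2.1 := by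
    intro a k
    by_cases h : M.Sat (.rel k.1.2 k.2) a.2.1
    · obtain ⟨Z, w, hw, h1⟩ := hM.witness k.1.2 a.2.1 a.2.2 k.2 h
      exact ⟨⟨Z, w, hw⟩, fun _ => h1⟩
    · exact ⟨a, fun h' => absurd h' h⟩
  have hdir : ∀ a b : α, ∃ c : α, a.2.1.Coarser c.2.1 ∧ b.2.1.Coarser c.2.1 := by
    intro a b
    obtain ⟨Z, w, hw, g, h, h1, h2⟩ := hM.directed a.2.1 a.2.2 b.2.1 b.2.2
    exact ⟨⟨Z, w, hw⟩, ⟨g, h1⟩, ⟨h, h2⟩⟩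
  choose ex hex using hex
  choose wit hwit using hwit
  choose dir hdir using hdir
  have hc1 : ∀ a : α, Countable (Σ Z : Ctx, CoVal a.1 Z × CoFormula L Z) := fun a => inferInstance
  have hc2 : ∀ a : α, Countable (Σ R : (Σ n, L.Relations n), Fin R.1 → a.1) := fun a => inferInstance
  obtain ⟨D, hB, hD, hclosed⟩ := exists_countable_closed (Set.countable_singleton (⟨X, v, hv⟩ : α))
    (fun a b => {dir a b} ∪ Set.range (ex a) ∪ Set.range (wit a) ∪
      Set.range fun g : Σ Z : Ctx, CoVal Z a.1 => (⟨g.1, g.2.cons a.2.1, M.adm_cons _ _ a.2.2⟩ : α))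
    (fun a b => (((Set.countable_singleton _).union (Set.countable_range _)).union
      (Set.countable_range _)).union (Set.countable_range _))
  have hvD : (⟨X, v, hv⟩ : α) ∈ D := hB rfl
  let M' : ProtoStructure L :=
    { carrier := M.carrier
      str := M.str
      adm := fun Z => {w | ∃ hw : w ∈ M.adm Z, (⟨Z, w, hw⟩ : α) ∈ D}
      adm_cons := by
        rintro Z Z' g w ⟨hw, hwD⟩
        exact ⟨M.adm_cons g w hw, hclosed _ hwD _ hwD (Or.inr ⟨⟨Z, g⟩, rfl⟩)⟩ }
  have hsat : ∀ {Z : Ctx} (φ : CoFormula L Z) (w : CoVal Z M.carrier), w ∈ M'.adm Z →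
      (M'.Sat φ w ↔ M.Sat φ w) := by
    intro Z φ
    induction φ with
    | bot => intro w _; exact (sat_bot _ _).trans (sat_bot M w).symm
    | rel R x => intro w _; exact (sat_rel M' _ _ _).trans (sat_rel M _ _ _).symm
    | neg φ ih =>
      exact fun w hw => (sat_neg M' _ _).trans ((not_congr (ih w hw)).trans (sat_neg M _ _).symm)
    | and φ ψ ih ih' =>
      exact fun w hw => (sat_and M' _ _ _).trans
        ((and_congr (ih w hw) (ih' w hw)).trans (sat_and M _ _ _).symm)
    | @exFr Z Z' g φ ih =>
      rintro w ⟨hw, hwD⟩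
      refine (sat_exFr M' _ _ _).trans (Iff.trans ?_ (sat_exFr M _ _ _).symm)
      constructor
      · rintro ⟨t, ht, h1, h2⟩
        exact ⟨t, ht.1, h1, (ih t ht).1 h2⟩
      · intro h
        obtain ⟨t, ht, h1, h2, h3⟩ := hex ⟨Z, w, hw⟩ ⟨Z', g, φ⟩ ((sat_exFr _ _ _ _).2 h)
        have htD : t ∈ M'.adm Z' :=
          ⟨ht, h1 ▸ hclosed _ hwD _ hwD (Or.inl (Or.inl (Or.inr ⟨_, rfl⟩)))⟩
        exact ⟨t, htD, h2, (ih t htD).2 h3⟩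
  have hM' : M'.IsStructure :=
    { nonempty := hM.nonempty
      adm_nonempty := ⟨X, v, hv, hvD⟩
      directed := by
        rintro Z Z' u ⟨hu, huD⟩ w ⟨hw, hwD⟩
        obtain ⟨⟨g, h1⟩, ⟨h, h2⟩⟩ := hdir ⟨Z, u, hu⟩ ⟨Z', w, hw⟩
        exact ⟨_, _, ⟨(dir ⟨Z, u, hu⟩ ⟨Z', w, hw⟩).2.2,
          hclosed _ huD _ hwD (Or.inl (Or.inl (Or.inl rfl)))⟩, g, h, h1, h2⟩
      witness := by
        rintro n R Z w ⟨hw, hwD⟩ x hx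
        exact ⟨_, _, ⟨(wit ⟨Z, w, hw⟩ ⟨⟨n, R⟩, x⟩).2.2,
          hclosed _ hwD _ hwD (Or.inl (Or.inr ⟨_, rfl⟩))⟩,
          hwit ⟨Z, w, hw⟩ ⟨⟨n, R⟩, x⟩ ((hsat _ w ⟨hw, hwD⟩).1 hx)⟩ }
  -- The countable directed family has a cofinal sequence.
  have := hD.to_subtype
  let _ : Encodable D := Encodable.ofCountable D
  let _ : Inhabited D := ⟨⟨_, hvD⟩⟩
  have hdirD : Directed (fun a b : α => a.2.1.Coarser b.2.1) (fun d : D => (d : α)) := by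
    rintro ⟨a, ha⟩ ⟨b, hb⟩
    exact ⟨⟨dir a b, hclosed a ha b hb (Or.inl (Or.inl (Or.inl rfl)))⟩, hdir a b⟩
  let Y : ℕ → Ctx := fun i => (hdirD.sequence _ i : α).1
  let c : ∀ i, CoVal (Y i) M'.carrier := fun i => (hdirD.sequence _ i : α).2.1
  have hcore : M'.IsCore Y c :=
    { mem := fun i => ⟨(hdirD.sequence _ i : α).2.2, (hdirD.sequence _ i).2⟩
      chain := fun i => hdirD.sequence_mono_nat i
      generates := by
        rintro Z w ⟨hw, hwD⟩
        exact ⟨_, hdirD.rel_sequence ⟨_, hwD⟩⟩ }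
  choose s hs using hcore.chain
  have : Nonempty M'.carrier := hM.nonempty
  have : Nonempty M.carrier := hM.nonempty
  have : Nonempty (Y 0) := ((c 0).cosurj (Classical.arbitrary _)).nonempty
  let N : ProtoStructure L := chainStr Y s fun i _ R x => M'.Sat (.rel R x) (c i)
  have hN : ∀ {Z : Ctx} (φ : CoFormula L Z) (i : ℕ) (h : CoVal Z (Y i)),
      N.Sat φ (h.cons (chainVal s _ i)) ↔ M'.Sat φ (h.cons (c i)) :=
    fun φ i h => sat_chainStr_iff hM' hcore hs (fun _ _ _ _ => Iff.rfl) φ i h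
  refine ⟨N, chainStr_isCompactOmega, ?_, ?_⟩
  · rintro T ⟨t, ht, hT⟩
    refine ⟨(CoVal.single starCtx (Y 0)).cons (chainVal s _ 0),
      N.adm_cons _ _ (isCore_chainVal.mem 0), fun φ hφ => (hN φ 0 _).2 ?_⟩
    refine (hsat φ _ (M'.adm_cons _ _ (hcore.mem 0))).2 ?_
    have h1 := CoVal.eq_single t
    have h2 := CoVal.eq_single (M := M.carrier) ((CoVal.single starCtx (Y 0)).cons (c 0))
    rw [h2, ← h1]
    exact hT φ hφ
  · obtain ⟨i, g, hg⟩ := hcore.generates v ⟨hv, hvD⟩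
    refine ⟨g.cons (chainVal s _ i), N.adm_cons _ _ (isCore_chainVal.mem i), fun φ => ?_⟩
    rw [hN φ i g, ← hg]
    exact hsat φ v ⟨hv, hvD⟩

/-! ### Cores in the fixed contexts with bounded witnesses -/

theorem lt_levelSize (i : ℕ) : i < levelSize i := by
  induction i with
  | zero => exact Nat.zero_lt_one
  | succ i ih => exact lt_of_le_of_lt (Nat.succ_le_of_lt ih) Nat.lt_two_pow_self

theorem levelSize_mono : Monotone levelSize :=
  monotone_nat_of_le_succ fun _ => Nat.lt_two_pow_self.le

theorem card_levelCtx (i : ℕ) : (levelCtx i).card = levelSize i := Finset.card_range _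

instance (i : ℕ) : Nonempty (levelCtx i) :=
  ⟨⟨0, Finset.mem_range.2 ((Nat.zero_le i).trans_lt (lt_levelSize i))⟩⟩

/-- A sequence of states with prescribed steps. -/
theorem exists_seq_of_forall {St : Type*} {P : ℕ → St → Prop} {Q : ℕ → St → St → Prop} {a : St}
    (h0 : P 0 a) (h : ∀ d s, P d s → ∃ s', P (d + 1) s' ∧ Q d s s') :
    ∃ V : ℕ → St, V 0 = a ∧ (∀ d, P d (V d)) ∧ ∀ d, Q d (V d) (V (d + 1)) := by
  choose f hf hf' using h
  let V : ∀ d, {s // P d s} := fun d => Nat.rec ⟨a, h0⟩ (fun d s => ⟨f d s.1 s.2, hf d s.1 s.2⟩) d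
  exact ⟨fun d => (V d).1, rfl, fun d => (V d).2, fun d => hf' d (V d).1 (V d).2⟩

/-- The triples of a level, a relation symbol and a tuple in the level. -/
abbrev RelTuple (L : FirstOrder.Language) : Type _ :=
  Σ i : ℕ, Σ R : (Σ n, L.Relations n), Fin R.1 → Lev i

namespace RelTuple

variable {L : FirstOrder.Language} [Countable (Σ n, L.Relations n)]

/-- An injective numbering of the triples, with the level bounded by the number. -/
noncomputable def code (t : RelTuple L) : ℕ :=
  Nat.pair t.1 ((Countable.exists_injective_nat (RelTuple L)).choose t)

theorem code_injective : Function.Injective (code (L := L)) := fun _ _ h =>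
  (Countable.exists_injective_nat (RelTuple L)).choose_spec (Nat.pair_eq_pair.1 h).2

theorem fst_le_code (t : RelTuple L) : t.1 ≤ code t := Nat.left_le_pair _ _

open Classical in
/-- The arity of the relation symbol in the triple with a given number. -/
noncomputable def arity (L : FirstOrder.Language) [Countable (Σ n, L.Relations n)] (e : ℕ) : ℕ :=
  if h : ∃ t : RelTuple L, code t = e then h.choose.2.1.1 else 0

theorem arity_code (t : RelTuple L) : arity L (code t) = t.2.1.1 := by
  have h : ∃ t' : RelTuple L, code t' = code t := ⟨t, rfl⟩
  rw [arity, dif_pos h, code_injective h.choose_spec]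

end RelTuple

open RelTuple

/-- The levels at which the stages of the construction of a core begin. Stage `e` takes care of the
triple with number `e`; its length leaves room for a common refinement of the cover reached so far, a
witness for the triple and a cover of size at most `e`. -/
noncomputable def checkpoint (L : FirstOrder.Language) [Countable (Σ n, L.Relations n)] : ℕ → ℕ
  | 0 => 0
  | e + 1 => checkpoint L e + 1 + 2 ^ (levelSize (checkpoint L e) + 2 ^ (arity L e + 1 + (e + 1)))

section

variable {L : FirstOrder.Language} [Countable (Σ n, L.Relations n)]

theorem checkpoint_lt_succ (e : ℕ) : checkpoint L e < checkpoint L (e + 1) := by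
  rw [checkpoint]
  exact (Nat.lt_succ_self _).trans_le (Nat.le_add_right _ _)

theorem checkpoint_strictMono : StrictMono (checkpoint L) := strictMono_nat_of_lt_succ checkpoint_lt_succ

theorem two_pow_le_levelSize_checkpoint (e : ℕ) :
    2 ^ (levelSize (checkpoint L e) + 2 ^ (arity L e + 1 + (e + 1))) ≤
      levelSize (checkpoint L (e + 1)) := by
  refine le_trans ?_ (lt_levelSize _).le
  rw [checkpoint]
  exact Nat.le_add_left _ _

end

/-- The bound on the levels of witnesses. -/
noncomputable def witnessBound (L : FirstOrder.Language) [Countable (Σ n, L.Relations n)] :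
    LevelBound L :=
  fun i n R x => checkpoint L (code (L := L) ⟨i, ⟨n, R⟩, x⟩ + 1)

namespace ProtoStructure

variable {L : FirstOrder.Language}

/-- The admissible co-valuations are not bounded in size. -/
def HasLargeCovers (M : ProtoStructure L) : Prop :=
  ∀ n, ∃ (Z : Ctx), (M.adm Z).Nonempty ∧ n ≤ Z.card

theorem IsCompactOmega.hasLargeCovers {M : ProtoStructure L} (hM : M.IsCompactOmega)
    [Infinite M.carrier] : M.HasLargeCovers := by
  intro n
  obtain ⟨τ, -, _, -, href, -⟩ := hM.isCompact
  obtain ⟨F, hF⟩ := Infinite.exists_subset_card_eq M.carrier (n + 1)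
  have hne : F.Nonempty := Finset.card_pos.1 (hF ▸ n.succ_pos)
  -- A cover that refines the complements of the sets `F \ {a}` separates the points of `F`.
  obtain ⟨X, v, hv, hX⟩ := href {U | ∃ a ∈ F, U = ((F : Set M.carrier) \ {a})ᶜ}
    (by
      rintro _ ⟨a, -, rfl⟩
      exact (F.finite_toSet.subset Set.sdiff_subset).isClosed.isOpen_compl)
    (by
      refine Set.eq_univ_of_forall fun b => ?_
      by_cases hb : b ∈ F
      · exact ⟨_, ⟨b, hb, rfl⟩, fun h => h.2 rfl⟩
      · exact ⟨_, ⟨_, hne.choose_spec, rfl⟩, fun h => hb h.1⟩)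
  refine ⟨X, ⟨v, hv⟩, ?_⟩
  choose x hx using v.cosurj
  have hinj : Set.InjOn x F := by
    intro a ha b hb hab
    obtain ⟨_, ⟨c, -, rfl⟩, hc⟩ := hX (x a)
    have h1 : a = c := by
      by_contra h
      exact hc (hx a) ⟨ha, h⟩
    have h2 : b = c := by
      by_contra h
      exact hc (show b ∈ v.cell (x a) from hab ▸ hx b) ⟨hb, h⟩
    exact h1.trans h2.symm
  have := Finset.card_le_card_of_injOn x (fun a _ => Finset.mem_univ (x a)) hinj
  rw [Finset.card_univ, Fintype.card_coe] at this
  omega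

theorem HasLargeCovers.exists_mem_adm {M : ProtoStructure L} (hM : M.HasLargeCovers) (i : ℕ) :
    ∃ v : CoVal (Lev i) M.carrier, v ∈ M.adm (levelCtx i) := by
  obtain ⟨Z, ⟨w, hw⟩, hZ⟩ := hM (levelSize i)
  obtain ⟨f, hf, -⟩ := exists_surjective_refining (fun _ : Z => ()) (levelSize i)
    ((Set.ncard_le_one_of_subsingleton _).trans ((Nat.zero_le i).trans_lt (lt_levelSize i)))
    (by rwa [CoVal.card_ctx])
  exact ⟨_, M.adm_cons (CoVal.ofSurj f hf) w hw⟩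

/-- A witness has a consolidation of bounded size that is still a witness: merge all elements outside
the tuple of the witness. -/
theorem IsWitness.exists_small {M : ProtoStructure L} {n : ℕ} {R : L.Relations n} {X Y : Ctx}
    {v : CoVal X M.carrier} {x : Fin n → X} {w : CoVal Y M.carrier} (h : M.IsWitness R v x w) :
    ∃ m ≤ n + 1, ∃ w' : CoVal (Finset.range m : Ctx) M.carrier,
      w'.Coarser w ∧ M.IsWitness R v x w' := by
  classical
  obtain ⟨y, a, h1, h2, ha⟩ := h
  let τ : Y → Option (Fin n) := fun z => if hz : ∃ k, y k = z then some hz.choose else none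
  have hτ : ∀ z k, τ z = τ (y k) → z = y k := by
    intro z k hz
    have hex : ∃ l, y l = y k := ⟨k, rfl⟩
    by_cases hz' : ∃ l, y l = z
    · simp only [τ, hz', hex, dite_true, Option.some.injEq] at hz
      exact hz'.choose_spec.symm.trans ((congrArg y hz).trans hex.choose_spec)
    · simp [τ, hz'] at hz
  obtain ⟨f, hf, hfτ⟩ := exists_surjective_fiber_eq τ
  refine ⟨_, (Set.ncard_le_card _).trans (by simp), (CoVal.ofSurj f hf).cons w,
    CoVal.coarser_cons _ _, fun k => f (y k), a, fun k => ⟨⟨_, rfl, (h1 k).1⟩, ?_⟩, fun k => ?_, ha⟩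
  · rintro u ⟨z, rfl, hz⟩
    rw [(h1 k).2 z hz]
  · rintro b ⟨z, hz, hb⟩
    rw [hτ z k ((hfτ _ _).1 hz)] at hb
    exact h2 k hb

/-- Interpolation in the fixed contexts between a co-valuation and a fragmentation of it. -/
theorem exists_interpolation {M : Type*} (k : ℕ) (d : ℕ) : ∀ (i : ℕ), i + d + 1 = k →
    ∀ (V : ∀ j, CoVal (Lev j) M) (a : CoVal (Lev i) M) (b : CoVal (Lev k) M), a.Coarser b →
      ∃ f : ∀ j, CoVal (Lev j) M, f i = a ∧ f k = b ∧ (∀ j < i, f j = V j) ∧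
        (∀ j, i ≤ j → j < k → (f j).Coarser (f (j + 1))) ∧
          ∀ j, i ≤ j → j ≤ k → (f j).Coarser b := by
  induction d with
  | zero =>
    rintro i rfl V a b hab
    refine ⟨Function.update (Function.update V i a) (i + 1) b, ?_, ?_, fun j hj => ?_,
      fun j h1 h2 => ?_, fun j h1 h2 => ?_⟩
    · rw [Function.update_of_ne (by omega), Function.update_self]
    · rw [Function.update_self]
    · rw [Function.update_of_ne (by omega), Function.update_of_ne (by omega)]
    · obtain rfl : j = i := by omega
      rwa [Function.update_self, Function.update_of_ne (by omega), Function.update_self]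
    · rcases (by omega : j = i ∨ j = i + 1) with rfl | rfl
      · rwa [Function.update_of_ne (by omega), Function.update_self]
      · rw [Function.update_self]
        exact CoVal.Coarser.rfl' b
  | succ d ih =>
    intro i hik V a b hab
    obtain ⟨c, hac, hcb⟩ := CoVal.exists_between (X := levelCtx i) (Z := levelCtx k) hab
      (n := levelSize (i + 1)) (by rw [card_levelCtx]; rfl)
      (by rw [card_levelCtx]; exact levelSize_mono (by omega))
    obtain ⟨f, h1, h2, h3, h4, h5⟩ := ih (i + 1) (by omega) V c b hcb
    refine ⟨Function.update f i a, ?_, ?_, fun j hj => ?_, fun j hj1 hj2 => ?_,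
      fun j hj1 hj2 => ?_⟩
    · rw [Function.update_self]
    · rw [Function.update_of_ne (by omega), h2]
    · rw [Function.update_of_ne (by omega), h3 j (by omega)]
    · rw [Function.update_of_ne (a := j + 1) (by omega)]
      rcases hj1.eq_or_lt with rfl | hlt
      · rwa [Function.update_self, h1]
      · rw [Function.update_of_ne (by omega)]
        exact h4 j hlt hj2
    · rcases hj1.eq_or_lt with rfl | hlt
      · rwa [Function.update_self]
      · rw [Function.update_of_ne (by omega)]
        exact h5 j hlt hj2

variable [Countable (Σ n, L.Relations n)]

/-- One stage of the construction of a core. -/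
theorem IsStructure.exists_stage {M : ProtoStructure L} (hM : M.IsStructure) (hbig : M.HasLargeCovers)
    {Y : Ctx} {w : CoVal Y M.carrier} (hw : w ∈ M.adm Y) (e : ℕ) (V : ∀ i, CoVal (Lev i) M.carrier)
    (hV : ∀ i ≤ checkpoint L e, V i ∈ M.adm (levelCtx i)) :
    ∃ V' : ∀ i, CoVal (Lev i) M.carrier, (∀ i ≤ checkpoint L e, V' i = V i) ∧
      (∀ i ≤ checkpoint L (e + 1), V' i ∈ M.adm (levelCtx i)) ∧
      (∀ i, checkpoint L e ≤ i → i < checkpoint L (e + 1) → (V' i).Coarser (V' (i + 1))) ∧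
      (∀ t : RelTuple L, code t = e → M.Sat (.rel t.2.1.2 t.2.2) (V t.1) →
        ∃ (Z : Ctx) (g : CoVal Z (Lev (checkpoint L (e + 1)))),
          M.IsWitness t.2.1.2 (V t.1) t.2.2 (g.cons (V' (checkpoint L (e + 1))))) ∧
      (Y.card ≤ e → w.Coarser (V' (checkpoint L (e + 1)))) := by
  have := hM.nonempty
  have hstar := hM.single_mem
  obtain ⟨A, a, ha, hA, hwit⟩ : ∃ (A : Ctx), ∃ a ∈ M.adm A, A.card ≤ arity L e + 1 ∧
      ∀ t : RelTuple L, code t = e → M.Sat (.rel t.2.1.2 t.2.2) (V t.1) →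
        M.IsWitness t.2.1.2 (V t.1) t.2.2 a := by
    by_cases h : ∃ t : RelTuple L, code t = e ∧ M.Sat (.rel t.2.1.2 t.2.2) (V t.1)
    · obtain ⟨t, rfl, ht⟩ := h
      obtain ⟨Z, z, hz, hzw⟩ := hM.witness t.2.1.2 (V t.1)
        (hV _ ((fst_le_code t).trans (checkpoint_strictMono.id_le _))) t.2.2 ht
      obtain ⟨m, hm, a, haz, haw⟩ := hzw.exists_small
      refine ⟨_, a, adm_of_coarser haz hz, ?_, fun t' ht' _ => ?_⟩
      · rw [Finset.card_range, arity_code]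
        exact hm
      · cases code_injective ht'
        exact haw
    · exact ⟨starCtx, _, hstar, Nat.le_add_left _ _, fun t h1 h2 => absurd ⟨t, h1, h2⟩ h⟩
  obtain ⟨B, b, hb, hB, hwb⟩ : ∃ (B : Ctx), ∃ b ∈ M.adm B, B.card ≤ e + 1 ∧
      (Y.card ≤ e → w.Coarser b) := by
    by_cases h : Y.card ≤ e
    · exact ⟨Y, w, hw, h.trans e.le_succ, fun _ => CoVal.Coarser.rfl' w⟩
    · exact ⟨starCtx, _, hstar, Nat.le_add_left _ _, fun h' => absurd h' h⟩
  have hdir : ∀ {X X' : Ctx} {u : CoVal X M.carrier} {v : CoVal X' M.carrier}, u ∈ M.adm X →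
      v ∈ M.adm X' → ∃ (Z : Ctx), ∃ z ∈ M.adm Z, u.Coarser z ∧ v.Coarser z := by
    intro X X' u v hu hv
    obtain ⟨Z, z, hz, g, h, h1, h2⟩ := hM.directed u hu v hv
    exact ⟨Z, z, hz, ⟨g, h1⟩, ⟨h, h2⟩⟩
  obtain ⟨C, ⟨c, hc⟩, hC⟩ := hbig (levelSize (checkpoint L (e + 1)))
  obtain ⟨Z₁, z₁, hz₁, h1a, h1b⟩ := hdir ha hb
  obtain ⟨Z₂, z₂, hz₂, h2a, h2b⟩ := hdir (hV _ le_rfl) hc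
  obtain ⟨Z, z, hz, hz1, hz2⟩ := hdir hz₁ hz₂
  have hcard : levelSize (checkpoint L (e + 1)) ≤ Z.card := by
    have := (h2b.trans hz2).card_le
    rw [CoVal.card_ctx, CoVal.card_ctx] at this
    exact hC.trans this
  have hpow := two_pow_le_levelSize_checkpoint (L := L) e
  obtain ⟨d, had, hbd, hdz⟩ := CoVal.exists_common_between (h1a.trans hz1) (h1b.trans hz1)
    (n := 2 ^ (arity L e + 1 + (e + 1))) (Nat.pow_le_pow_right Nat.two_pos (Nat.add_le_add hA hB))
    (le_trans (le_trans (Nat.le_add_left _ _) Nat.lt_two_pow_self.le) (hpow.trans hcard))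
  obtain ⟨t, hVt, hdt, htz⟩ := CoVal.exists_common_between (X := levelCtx (checkpoint L e))
    (h2a.trans hz2) hdz (n := levelSize (checkpoint L (e + 1)))
    (by rw [card_levelCtx, Finset.card_range]; exact hpow) hcard
  obtain ⟨f, hf1, hf2, hf3, hf4, hf5⟩ := exists_interpolation (checkpoint L (e + 1))
    (checkpoint L (e + 1) - checkpoint L e - 1) (checkpoint L e)
    (by have := checkpoint_lt_succ (L := L) e; omega) V (V (checkpoint L e)) t hVt
  have hagree : ∀ i ≤ checkpoint L e, f i = V i := fun i hi => by
    rcases hi.eq_or_lt with rfl | hlt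
    · exact hf1
    · exact hf3 i hlt
  refine ⟨f, hagree, fun i hi => ?_, hf4, fun r hr hsat => ?_, fun hY => ?_⟩
  · rcases le_total i (checkpoint L e) with h | h
    · exact hagree i h ▸ hV i h
    · exact adm_of_coarser (X := levelCtx i) ((hf5 i h hi).trans htz) hz
  · obtain ⟨g, hg⟩ := had.trans hdt
    have h := hwit r hr hsat
    rw [hg] at h
    exact ⟨A, g, by rw [hf2]; exact h⟩
  · rw [hf2]
    exact (hwb hY).trans (hbd.trans hdt)

/-- A finite chain of admissible co-valuations in the contexts `levelCtx i`, with `i` up to the beginning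
of stage `e₀`, extends to a core in which the triples with numbers from `e₀` on have witnesses in
time. -/
theorem IsStructure.exists_core_extension {M : ProtoStructure L} (hM : M.IsStructure)
    (hcore : ∃ (Y : ℕ → Ctx) (w : ∀ i, CoVal (Y i) M.carrier), M.IsCore Y w)
    (hbig : M.HasLargeCovers) (e₀ : ℕ) (u : ∀ i, CoVal (Lev i) M.carrier)
    (hu : ∀ i ≤ checkpoint L e₀, u i ∈ M.adm (levelCtx i))
    (hchain : ∀ i < checkpoint L e₀, (u i).Coarser (u (i + 1))) :
    ∃ v : ∀ i, CoVal (Lev i) M.carrier, M.IsCore levelCtx v ∧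
      (∀ i ≤ checkpoint L e₀, v i = u i) ∧
      ∀ t : RelTuple L, e₀ ≤ code t → M.Sat (.rel t.2.1.2 t.2.2) (v t.1) →
        ∃ (Z : Ctx) (g : CoVal Z (Lev (checkpoint L (code t + 1)))),
          M.IsWitness t.2.1.2 (v t.1) t.2.2 (g.cons (v (checkpoint L (code t + 1)))) := by
  obtain ⟨Y, w, hw⟩ := hcore
  obtain ⟨V, hV0, hV, hstep⟩ := exists_seq_of_forall (a := u)
    (P := fun d V => ∀ i ≤ checkpoint L (e₀ + d), V i ∈ M.adm (levelCtx i))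
    (Q := fun d V V' => (∀ i ≤ checkpoint L (e₀ + d), V' i = V i) ∧
      (∀ i, checkpoint L (e₀ + d) ≤ i → i < checkpoint L (e₀ + d + 1) →
        (V' i).Coarser (V' (i + 1))) ∧
      (∀ t : RelTuple L, code t = e₀ + d → M.Sat (.rel t.2.1.2 t.2.2) (V t.1) →
        ∃ (Z : Ctx) (g : CoVal Z (Lev (checkpoint L (e₀ + d + 1)))),
          M.IsWitness t.2.1.2 (V t.1) t.2.2 (g.cons (V' (checkpoint L (e₀ + d + 1))))) ∧
      ((Y (e₀ + d).unpair.1).card ≤ e₀ + d →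
        (w (e₀ + d).unpair.1).Coarser (V' (checkpoint L (e₀ + d + 1)))))
    hu (fun d V hV => by
      obtain ⟨V', h1, h2, h3⟩ := hM.exists_stage hbig (hw.mem (e₀ + d).unpair.1) (e₀ + d) V hV
      exact ⟨V', h2, h1, h3⟩)
  have hle : ∀ d, d ≤ checkpoint L (e₀ + d) := fun d =>
    (Nat.le_add_left d e₀).trans (checkpoint_strictMono.id_le _)
  have hagree : ∀ d d', d ≤ d' → ∀ i ≤ checkpoint L (e₀ + d), V d' i = V d i := by
    intro d d' hdd' i hi
    induction d', hdd' using Nat.le_induction with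
    | base => rfl
    | succ d' hd' ih =>
      rw [(hstep d').1 i (hi.trans (checkpoint_strictMono.monotone (by omega))), ih]
  have hdiag : ∀ d, ∀ i ≤ checkpoint L (e₀ + d), V i i = V d i := by
    intro d i hi
    rcases le_total d i with h | h
    · exact hagree d i h i hi
    · exact (hagree i d h i (hle i)).symm
  have hVchain : ∀ d, ∀ i < checkpoint L (e₀ + d), (V d i).Coarser (V d (i + 1)) := by
    intro d
    induction d with
    | zero => rw [hV0]; exact hchain
    | succ d ih =>
      intro i hi
      rcases lt_or_ge i (checkpoint L (e₀ + d)) with h | h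
      · rw [hagree d (d + 1) d.le_succ i h.le, hagree d (d + 1) d.le_succ (i + 1) h]
        exact ih i h
      · exact (hstep d).2.1 i h hi
  refine ⟨fun i => V i i, ⟨fun i => hV i i (hle i), fun i => ?_, fun {X} x hx => ?_⟩,
    fun i hi => (hdiag 0 i hi).trans (by rw [hV0]), fun t ht hsat => ?_⟩
  · change (V i i).Coarser (V (i + 1) (i + 1))
    rw [hdiag (i + 1) i ((Nat.le_succ i).trans (hle _))]
    exact hVchain (i + 1) i ((Nat.lt_succ_self i).trans_le (hle _))
  · obtain ⟨m, g, hg⟩ := hw.generates x hx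
    -- The cover `w m` is dealt with at every sufficiently late stage `Nat.pair m k`.
    have hk : (Y m).card + e₀ ≤ Nat.pair m ((Y m).card + e₀) := Nat.right_le_pair _ _
    obtain ⟨d, hd⟩ := Nat.exists_eq_add_of_le ((Nat.le_add_left _ _).trans hk)
    have h := (hstep d).2.2.2
    rw [← hd, Nat.unpair_pair] at h
    have h' := h ((Nat.le_add_right _ _).trans hk)
    refine ⟨checkpoint L (Nat.pair m ((Y m).card + e₀) + 1), ?_⟩
    rw [hdiag (d + 1) _ (by rw [hd]; exact le_rfl)]
    exact CoVal.Coarser.trans ⟨g, hg⟩ h'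
  · obtain ⟨d, hd⟩ := Nat.exists_eq_add_of_le ht
    have h := (hstep d).2.2.1 t hd
    have h1 : t.1 ≤ checkpoint L (e₀ + d) :=
      (fst_le_code t).trans (hd ▸ checkpoint_strictMono.id_le _)
    simp only at hsat ⊢
    rw [hdiag d _ h1] at hsat ⊢
    rw [hd, hdiag (d + 1) (checkpoint L (e₀ + d + 1)) le_rfl]
    exact h hsat

theorem isAdequate_witnessBound : (witnessBound L).IsAdequate := by
  intro M hM _
  have hbig := hM.hasLargeCovers
  choose u hu using hbig.exists_mem_adm
  obtain ⟨v, hv, -, hwit⟩ := hM.isStructure.exists_core_extension hM.hasCore hbig 0 u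
    (fun i _ => hu i) (fun i hi => absurd hi (Nat.not_lt_zero i))
  refine ⟨v, hv, fun i n R x hx => ⟨_, le_rfl, ?_⟩⟩
  exact hwit ⟨i, ⟨n, R⟩, x⟩ (Nat.zero_le _) hx

end ProtoStructure

/-! ### Clopen and `Gδ` conditions -/

section Conditions

variable {E : Type*} [TopologicalSpace E]

theorem isClopen_setOf_const (P : Prop) : IsClopen {_e : E | P} := by
  by_cases h : P
  · simpa [h] using isClopen_univ
  · simpa [h] using isClopen_empty

theorem isClopen_setOf_not {P : E → Prop} (hP : IsClopen {e | P e}) : IsClopen {e | ¬ P e} :=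
  hP.compl

theorem isClopen_setOf_and {P Q : E → Prop} (hP : IsClopen {e | P e}) (hQ : IsClopen {e | Q e}) :
    IsClopen {e | P e ∧ Q e} :=
  hP.inter hQ

theorem isClopen_setOf_imp {P Q : E → Prop} (hP : IsClopen {e | P e}) (hQ : IsClopen {e | Q e}) :
    IsClopen {e | P e → Q e} := by
  simp only [imp_iff_not_or]
  exact hP.compl.union hQ

theorem isClosed_setOf_imp {P Q : E → Prop} (hP : IsClopen {e | P e}) (hQ : IsClosed {e | Q e}) :
    IsClosed {e | P e → Q e} := by
  simp only [imp_iff_not_or]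
  exact hP.isOpen.isClosed_compl.union hQ

theorem isClopen_setOf_iff {P Q : E → Prop} (hP : IsClopen {e | P e}) (hQ : IsClopen {e | Q e}) :
    IsClopen {e | P e ↔ Q e} := by
  simp only [iff_def]
  exact (isClopen_setOf_imp hP hQ).inter (isClopen_setOf_imp hQ hP)

theorem isClopen_setOf_forall {ι : Sort*} [Finite ι] {P : ι → E → Prop}
    (hP : ∀ i, IsClopen {e | P i e}) : IsClopen {e | ∀ i, P i e} := by
  rw [Set.ofPred_forall]
  exact isClopen_iInter_of_finite hP

theorem isClopen_setOf_exists {ι : Sort*} [Finite ι] {P : ι → E → Prop}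
    (hP : ∀ i, IsClopen {e | P i e}) : IsClopen {e | ∃ i, P i e} := by
  rw [Set.ofPred_exists]
  exact isClopen_iUnion_of_finite hP

theorem isOpen_setOf_exists {ι : Sort*} {P : ι → E → Prop}
    (hP : ∀ i, IsOpen {e | P i e}) : IsOpen {e | ∃ i, P i e} := by
  rw [Set.ofPred_exists]
  exact isOpen_iUnion hP

theorem isClosed_setOf_exists {ι : Sort*} [Finite ι] {P : ι → E → Prop}
    (hP : ∀ i, IsClosed {e | P i e}) : IsClosed {e | ∃ i, P i e} := by
  rw [Set.ofPred_exists]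
  exact isClosed_iUnion_of_finite hP

theorem isClosed_setOf_forall {ι : Sort*} {P : ι → E → Prop}
    (hP : ∀ i, IsClosed {e | P i e}) : IsClosed {e | ∀ i, P i e} := by
  rw [Set.ofPred_forall]
  exact isClosed_iInter hP

theorem isGδ_setOf_forall {ι : Sort*} [Countable ι] {P : ι → E → Prop}
    (hP : ∀ i, IsGδ {e | P i e}) : IsGδ {e | ∀ i, P i e} := by
  rw [Set.ofPred_forall]
  exact IsGδ.iInter hP

theorem isGδ_setOf_and {P Q : E → Prop} (hP : IsGδ {e | P e}) (hQ : IsGδ {e | Q e}) :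
    IsGδ {e | P e ∧ Q e} :=
  hP.inter hQ

/-- A `Gδ` subspace of a Polish space is Polish: it is homeomorphic to the diagonal of a product of
open subspaces, which is closed. -/
theorem IsGδ.polishSpace [PolishSpace E] {s : Set E} (hs : IsGδ s) : PolishSpace s := by
  obtain ⟨U, hU, rfl⟩ := isGδ_iff_eq_iInter_nat.1 hs
  have : ∀ n, PolishSpace (U n) := fun n => (hU n).polishSpace
  let f : (⋂ n, U n : Set E) → ∀ n, U n := fun x n => ⟨x.1, Set.mem_iInter.1 x.2 n⟩
  have hcont : Continuous f := continuous_pi fun n => continuous_subtype_val.subtype_mk _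
  have hemb : IsEmbedding f := by
    refine .of_comp hcont (g := fun y => (y 0).1) (by fun_prop) ?_
    exact IsEmbedding.subtypeVal
  refine (IsClosedEmbedding.mk hemb ?_).polishSpace
  have : Set.range f = ⋂ n, {y : ∀ n, U n | (y n).1 = (y 0).1} := by
    ext y
    simp only [Set.mem_iInter]
    constructor
    · rintro ⟨x, rfl⟩ n
      rfl
    · intro hy
      refine ⟨⟨(y 0).1, Set.mem_iInter.2 fun n => ?_⟩, ?_⟩
      · rw [← show (y n).1 = (y 0).1 from hy n]
        exact (y n).2
      · ext n
        exact (hy n).symm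
  rw [this]
  exact isClosed_iInter fun n => isClosed_eq (by fun_prop) (by fun_prop)

end Conditions

/-! ### The structures of codes -/

instance CoVal.instTopologicalSpace (X M : Type*) : TopologicalSpace (CoVal X M) := ⊥

instance CoVal.instDiscreteTopology (X M : Type*) : DiscreteTopology (CoVal X M) := ⟨rfl⟩

namespace Code

open OmegaChain ProtoStructure

variable {L : FirstOrder.Language} [L.IsRelational]

theorem isCompactOmega_toStr (μ : Code L) : μ.toStr.IsCompactOmega :=
  chainStr_isCompactOmega (Y := levelCtx) (s := μ.step) (holds := μ.holds)

/-- The canonical co-valuations of the structure of a code, with the carrier of the structure as the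
set of values. -/
def coVal (μ : Code L) (i : ℕ) : CoVal (levelCtx i) μ.toStr.carrier := μ.val i

theorem isCore_coVal (μ : Code L) : μ.toStr.IsCore levelCtx μ.coVal :=
  isCore_chainVal (Y := levelCtx) (s := μ.step) (holds := μ.holds)

theorem coVal_eq_cons (μ : Code L) (i : ℕ) : μ.coVal i = (μ.step i).cons (μ.coVal (i + 1)) :=
  levelVal_eq_cons (P := Lev) μ.step i

theorem coVal_eq_link_cons (μ : Code L) {i j : ℕ} (h : i ≤ j) :
    μ.coVal i = (link (P := Lev) μ.step h).cons (μ.coVal j) :=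
  eq_link_cons (P := Lev) μ.coVal_eq_cons h

theorem cons_coVal_mem (μ : Code L) {X : Ctx} {i : ℕ} (h : CoVal X (levelCtx i)) :
    h.cons (μ.coVal i) ∈ μ.toStr.adm X := ⟨i, h, rfl⟩

theorem models_toStr_iff (μ : Code L) (T : CoTheory L) : μ.toStr.Models T ↔
    ∀ φ ∈ T, μ.toStr.Sat φ ((CoVal.single starCtx (levelCtx 0)).cons (μ.coVal 0)) := by
  have := μ.isCompactOmega_toStr.isStructure.nonempty
  exact models_iff _ (μ.cons_coVal_mem _)

theorem sat_exFr_coVal_iff (μ : Code L) {X Z : Ctx} {i : ℕ} (h : CoVal X (levelCtx i))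
    (g : CoVal X Z) (φ : CoFormula L Z) :
    μ.toStr.Sat (.exFr g φ) (h.cons (μ.coVal i)) ↔
      ∃ (j : ℕ) (hij : i ≤ j) (h' : CoVal Z (levelCtx j)),
        h.cons (link (P := Lev) μ.step hij) = g.cons h' ∧ μ.toStr.Sat φ (h'.cons (μ.coVal j)) := by
  rw [sat_exFr]
  constructor
  · rintro ⟨w, hw, heq, hsat⟩
    obtain ⟨j, h', rfl⟩ := μ.isCore_coVal.generates w hw
    rw [μ.coVal_eq_link_cons (le_max_right i j), CoVal.cons_assoc] at heq hsat
    rw [μ.coVal_eq_link_cons (le_max_left i j), CoVal.cons_assoc, CoVal.cons_assoc] at heq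
    exact ⟨_, le_max_left i j, _, (CoVal.cons_right_cancel _ heq).trans
      (CoVal.cons_assoc _ _ _).symm, hsat⟩
  · rintro ⟨j, hij, h', heq, hsat⟩
    refine ⟨_, μ.cons_coVal_mem h', ?_, hsat⟩
    rw [μ.coVal_eq_link_cons hij, CoVal.cons_assoc, heq, ← CoVal.cons_assoc]

end Code

/-- The code that is an element of `Mod(L)`. -/
def ModL.code {L : FirstOrder.Language} {β : LevelBound L} (μ : ModL β) : Code L := μ.1

open OmegaChain ProtoStructure in
/-- In the structure of a code in `Mod(L)` the relations hold at the canonical co-valuations exactly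
where the code says so. -/
theorem ModL.sat_rel_iff {L : FirstOrder.Language} [L.IsRelational] {β : LevelBound L} (μ : ModL β)
    {i n : ℕ} (R : L.Relations n) (x : Fin n → Lev i) :
    μ.code.toStr.Sat (.rel R x) (μ.code.coVal i) ↔ μ.code.holds i R x := by
  rw [sat_rel]
  constructor
  · rintro ⟨S, hS, hSx⟩
    exact hS i x hSx
  · intro hx
    obtain ⟨j, -, C, A, -, -, hAx, hj⟩ := μ.2.2 R i x hx
    have hj' : ∀ j', ∃ y : Fin n → Lev j', j' ≥ j → μ.code.holds j' R y ∧
        ∀ k, ∀ z : Lev j, μ.code.Ge ⟨j, z⟩ ⟨j', y k⟩ → z ∈ A k := by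
      intro j'
      by_cases h : j' ≥ j
      · obtain ⟨y, hy⟩ := hj j' h
        exact ⟨y, fun _ => hy⟩
      · exact ⟨fun _ => Classical.arbitrary _, fun h' => absurd h' h⟩
    choose y hy using hj'
    obtain ⟨S, hSR, hS⟩ := exists_interp_of_tuples (Y := levelCtx) (s := μ.code.step)
      (holds := μ.code.holds) μ.2.1 R j y fun j' h => (hy j' h).1
    refine ⟨S, hSR, fun k => ?_⟩
    obtain ⟨z, hz⟩ := Spectrum.exists_mem_level (P := Lev) (S k) j
    obtain ⟨j', hj', hzy⟩ := hS k _ hz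
    exact Spectrum.mem_of_ge (P := Lev) (S k) hz (hAx k z ((hy j' hj').2 k z hzy))

/-! ### The space of models is Polish -/

section Polish

open OmegaChain ProtoStructure Code

variable {L : FirstOrder.Language}

/-- The pairs of a formula and a consolidation of a canonical co-valuation at which it can be
evaluated. -/
abbrev EvalIndex (L : FirstOrder.Language) : Type _ :=
  Σ i : ℕ, Σ X : Ctx, CoVal X (levelCtx i) × CoFormula L X

/-- The Polish space in which spaces of codes are embedded, by recording the steps of a code and the
truth values of all formulas at all consolidations of the canonical co-valuations. -/
abbrev TruthSpace (L : FirstOrder.Language) : Type _ :=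
  (∀ i, CoVal (Lev i) (Lev (i + 1))) × (EvalIndex L → Bool)

theorem isClopen_setOf_ge (p q : Σ i, Lev i) :
    IsClopen {e : TruthSpace L | Ge (P := Lev) e.1 p q} := by
  obtain ⟨i, x⟩ := p
  obtain ⟨j, y⟩ := q
  rcases le_or_gt i j with hij | hij
  · induction j, hij using Nat.le_induction with
    | base => simpa only [ge_iff_eq] using isClopen_setOf_const _
    | succ j hj ih =>
      simp only [ge_succ_iff (P := Lev) hj]
      refine isClopen_setOf_exists fun z => isClopen_setOf_and (ih z) ?_
      exact (isClopen_discrete {g : CoVal (Lev j) (Lev (j + 1)) | g.rel z y}).preimage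
        (f := fun e : TruthSpace L => e.1 j) (by fun_prop)
  · have h : ∀ e : TruthSpace L, ¬ Ge (P := Lev) e.1 ⟨i, x⟩ ⟨j, y⟩ := fun e h =>
      absurd h.level_le (not_le.2 hij)
    simpa only [h] using isClopen_setOf_const False

theorem isClopen_setOf_truth (k : EvalIndex L) : IsClopen {e : TruthSpace L | e.2 k = true} :=
  (isClopen_discrete {b : Bool | b = true}).preimage (f := fun e : TruthSpace L => e.2 k)
    (by fun_prop)

theorem isClopen_setOf_link {i j : ℕ} (hij : i ≤ j) (A : Set (CoVal (Lev i) (Lev j))) :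
    IsClopen {e : TruthSpace L | link (P := Lev) e.1 hij ∈ A} := by
  have : Continuous fun e : TruthSpace L => link (P := Lev) e.1 hij := by
    refine continuous_discrete_rng.2 fun g => ?_
    have h : (fun e : TruthSpace L => link (P := Lev) e.1 hij) ⁻¹' {g} =
        {e | ∀ x y, Ge (P := Lev) e.1 ⟨i, x⟩ ⟨j, y⟩ ↔ g.rel x y} := by
      ext e
      exact ⟨fun h x y => by rw [← show link (P := Lev) e.1 hij = g from h]; rfl,
        fun h => CoVal.ext (funext fun x => funext fun y => propext (h x y))⟩
    rw [h]
    exact (isClopen_setOf_forall fun x : Lev i => isClopen_setOf_forall fun y : Lev j =>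
      isClopen_setOf_iff (isClopen_setOf_ge ⟨i, x⟩ ⟨j, y⟩)
        (isClopen_setOf_const (g.rel x y))).isOpen
  exact (isClopen_discrete A).preimage this

/-- The relation `b_R` read off from a point of the truth space. -/
def TruthSpace.holds (e : TruthSpace L) (i : ℕ) {n : ℕ} (R : L.Relations n) (x : Fin n → Lev i) :
    Prop :=
  e.2 ⟨i, levelCtx i, CoVal.refl _, .rel R x⟩ = true

/-- The code given by a point of the truth space. -/
def TruthSpace.toCode (e : TruthSpace L) : Code L := ⟨e.1, fun i _ R x => TruthSpace.holds e i R x⟩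

theorem TruthSpace.isClosed_setOf_isUpward :
    IsClosed {e : TruthSpace L | (TruthSpace.toCode e).IsUpward} := by
  simp only [Code.IsUpward]
  exact isClosed_setOf_forall fun n => isClosed_setOf_forall fun R => isClosed_setOf_forall fun i =>
    isClosed_setOf_forall fun y => isClosed_setOf_imp (isClopen_setOf_truth _) <|
    isClosed_setOf_forall fun j => isClosed_setOf_forall fun x => isClosed_setOf_imp
      (isClopen_setOf_forall fun k => isClopen_setOf_ge _ _) (isClopen_setOf_truth _).isClosed

theorem TruthSpace.isClosed_setOf_isWitnessed (β : LevelBound L) :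
    IsClosed {e : TruthSpace L | (TruthSpace.toCode e).IsWitnessed β} := by
  simp only [Code.IsWitnessed]
  refine isClosed_setOf_forall fun n => isClosed_setOf_forall fun R => isClosed_setOf_forall fun i =>
    isClosed_setOf_forall fun x => isClosed_setOf_imp (isClopen_setOf_truth _) ?_
  have hj : ∀ j, IsClosed {e : TruthSpace L | ∃ (C : Set (Set (Lev j))) (A : Fin n → Set (Lev j)),
      IsMinCover C ∧ (∀ k, A k ∈ C) ∧
      (∀ k, ∀ z ∈ A k, (TruthSpace.toCode e).Ge ⟨i, x k⟩ ⟨j, z⟩) ∧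
      ∀ j' ≥ j, ∃ y : Fin n → Lev j', (TruthSpace.toCode e).holds j' R y ∧
        ∀ k, ∀ z : Lev j, (TruthSpace.toCode e).Ge ⟨j, z⟩ ⟨j', y k⟩ → z ∈ A k} := by
    intro j
    refine isClosed_setOf_exists fun C => isClosed_setOf_exists fun A => ?_
    refine (isClopen_setOf_const _).isClosed.inter ((isClopen_setOf_const _).isClosed.inter
      (IsClosed.inter ?_ ?_))
    · exact isClosed_setOf_forall fun k => isClosed_setOf_forall fun z => isClosed_setOf_forall
        fun _ => (isClopen_setOf_ge _ _).isClosed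
    · refine isClosed_setOf_forall fun j' => isClosed_setOf_forall fun _ => ?_
      refine (isClopen_setOf_exists fun y : Fin n → Lev j' => isClopen_setOf_and
        (isClopen_setOf_truth _) (isClopen_setOf_forall fun k : Fin n =>
          isClopen_setOf_forall fun z : Lev j =>
            isClopen_setOf_imp (isClopen_setOf_ge ⟨j, z⟩ ⟨j', y k⟩)
              (isClopen_setOf_const (z ∈ A k)))).isClosed
  convert (Set.finite_Iic (β i R x)).isClosed_biUnion fun j _ => hj j using 1
  ext e
  simp only [Set.mem_iUnion, exists_prop]
  rfl

/-- The conditions for a point of the truth space to be in the range of the embedding of `Mod(T)`: the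
recursive clauses of the definition of satisfaction, and those of the definition of `Mod(T)`. -/
structure TruthSpace.IsCoherent (β : LevelBound L) (T : CoTheory L) (e : TruthSpace L) : Prop where
  bot : ∀ (i : ℕ) (X : Ctx) (h : CoVal X (levelCtx i)), ¬ e.2 ⟨i, X, h, .bot⟩ = true
  rel : ∀ (i : ℕ) (X : Ctx) (h : CoVal X (levelCtx i)) (n : ℕ) (R : L.Relations n) (x : Fin n → X),
    e.2 ⟨i, X, h, .rel R x⟩ = true ↔
      ∃ y : Fin n → Lev i, (∀ k, h.rel (x k) (y k)) ∧ TruthSpace.holds e i R y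
  neg : ∀ (i : ℕ) (X : Ctx) (h : CoVal X (levelCtx i)) (φ : CoFormula L X),
    e.2 ⟨i, X, h, .neg φ⟩ = true ↔ ¬ e.2 ⟨i, X, h, φ⟩ = true
  and : ∀ (i : ℕ) (X : Ctx) (h : CoVal X (levelCtx i)) (φ ψ : CoFormula L X),
    e.2 ⟨i, X, h, .and φ ψ⟩ = true ↔ e.2 ⟨i, X, h, φ⟩ = true ∧ e.2 ⟨i, X, h, ψ⟩ = true
  exFr : ∀ (i : ℕ) (X : Ctx) (h : CoVal X (levelCtx i)) (Z : Ctx) (g : CoVal X Z)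
    (φ : CoFormula L Z), e.2 ⟨i, X, h, .exFr g φ⟩ = true ↔
      ∃ (j : ℕ) (hij : i ≤ j) (h' : CoVal Z (levelCtx j)),
        h.cons (link (P := Lev) e.1 hij) = g.cons h' ∧ e.2 ⟨j, Z, h', φ⟩ = true
  upward : (TruthSpace.toCode e).IsUpward
  witnessed : (TruthSpace.toCode e).IsWitnessed β
  theory : ∀ φ : T, e.2 ⟨0, starCtx, CoVal.single starCtx (levelCtx 0), φ⟩ = true

/-- The bound `β` makes the existence of witnesses a closed condition; the clause for the quantifier is
`Gδ`, and all other clauses are closed. -/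
theorem TruthSpace.isGδ_setOf_isCoherent [Countable (Σ n, L.Relations n)] (β : LevelBound L)
    (T : CoTheory L) : IsGδ {e | TruthSpace.IsCoherent β T e} := by
  have ht := fun k : EvalIndex L => isClopen_setOf_truth k
  have hiff : ∀ e : TruthSpace L, TruthSpace.IsCoherent β T e ↔ _ ∧ _ ∧ _ ∧ _ ∧ _ ∧
      (TruthSpace.toCode e).IsUpward ∧ (TruthSpace.toCode e).IsWitnessed β ∧ _ :=
    fun e => ⟨fun h => ⟨h.bot, h.rel, h.neg, h.and, h.exFr, h.upward, h.witnessed, h.theory⟩,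
      fun h => ⟨h.1, h.2.1, h.2.2.1, h.2.2.2.1, h.2.2.2.2.1, h.2.2.2.2.2.1, h.2.2.2.2.2.2.1,
        h.2.2.2.2.2.2.2⟩⟩
  simp only [hiff]
  refine isGδ_setOf_and ?_ (isGδ_setOf_and ?_ (isGδ_setOf_and ?_ (isGδ_setOf_and ?_
    (isGδ_setOf_and ?_ (isGδ_setOf_and ?_ (isGδ_setOf_and ?_ ?_))))))
  · exact (isClosed_setOf_forall fun i => isClosed_setOf_forall fun X => isClosed_setOf_forall fun h =>
      (isClopen_setOf_not (ht _)).isClosed).isGδ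
  · exact (isClosed_setOf_forall fun i => isClosed_setOf_forall fun X : Ctx =>
      isClosed_setOf_forall fun h : CoVal X (levelCtx i) => isClosed_setOf_forall fun n =>
      isClosed_setOf_forall fun R : L.Relations n => isClosed_setOf_forall fun x : Fin n → X =>
      (isClopen_setOf_iff (ht _) (isClopen_setOf_exists fun y : Fin n → Lev i =>
        isClopen_setOf_and (isClopen_setOf_const (∀ k, h.rel (x k) (y k)))
          (ht ⟨i, levelCtx i, CoVal.refl _, .rel R y⟩))).isClosed).isGδ
  · exact (isClosed_setOf_forall fun i => isClosed_setOf_forall fun X => isClosed_setOf_forall fun h =>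
      isClosed_setOf_forall fun φ =>
      (isClopen_setOf_iff (ht _) (isClopen_setOf_not (ht _))).isClosed).isGδ
  · exact (isClosed_setOf_forall fun i => isClosed_setOf_forall fun X => isClosed_setOf_forall fun h =>
      isClosed_setOf_forall fun φ => isClosed_setOf_forall fun ψ =>
      (isClopen_setOf_iff (ht _) (isClopen_setOf_and (ht _) (ht _))).isClosed).isGδ
  · refine isGδ_setOf_forall fun i => isGδ_setOf_forall fun X => isGδ_setOf_forall fun h =>
      isGδ_setOf_forall fun Z => isGδ_setOf_forall fun g => isGδ_setOf_forall fun φ => ?_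
    have hopen : IsOpen {e : TruthSpace L | ∃ (j : ℕ) (hij : i ≤ j) (h' : CoVal Z (levelCtx j)),
        h.cons (link (P := Lev) e.1 hij) = g.cons h' ∧ e.2 ⟨j, Z, h', φ⟩ = true} :=
      isOpen_setOf_exists fun j => isOpen_setOf_exists fun hij => isOpen_setOf_exists fun h' =>
        (isClopen_setOf_and (isClopen_setOf_link hij {c | h.cons c = g.cons h'}) (ht _)).isOpen
    simp only [iff_def, imp_iff_not_or]
    exact IsGδ.inter ((ht _).compl.isOpen.union hopen).isGδ
      (hopen.isClosed_compl.union (ht _).isClosed).isGδ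
  · exact (TruthSpace.isClosed_setOf_isUpward (L := L)).isGδ
  · exact (TruthSpace.isClosed_setOf_isWitnessed β).isGδ
  · exact (isClosed_setOf_forall fun φ => (ht _).isClosed).isGδ

variable [L.IsRelational]

namespace ModL

variable {β : LevelBound L}

theorem isOpen_setOf_sat_val (i : ℕ) (φ : CoFormula L (levelCtx i)) :
    IsOpen {μ : ModL β | μ.code.toStr.Sat φ (μ.code.coVal i)} :=
  TopologicalSpace.isOpen_generateFrom_of_mem (Or.inr ⟨i, φ, rfl⟩)

theorem isClopen_setOf_sat {X : Ctx} {i : ℕ} (h : CoVal X (levelCtx i)) (φ : CoFormula L X) :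
    IsClopen {μ : ModL β | μ.code.toStr.Sat φ (h.cons (μ.code.coVal i))} := by
  obtain ⟨ψ, hψ⟩ := φ.exists_translation h
  have hiff : ∀ μ : ModL β, μ.code.toStr.Sat φ (h.cons (μ.code.coVal i)) ↔
      μ.code.toStr.Sat ψ (μ.code.coVal i) :=
    fun μ => (hψ _ μ.code.isCompactOmega_toStr.isStructure _ (μ.code.isCore_coVal.mem i)).symm
  refine ⟨⟨?_⟩, ?_⟩
  · convert isOpen_setOf_sat_val (β := β) i (.neg ψ) using 1
    ext μ
    exact (not_congr (hiff μ)).trans (sat_neg _ _ _).symm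
  · simpa only [hiff] using isOpen_setOf_sat_val i ψ

theorem isOpen_setOf_step_eq (i : ℕ) (g : CoVal (Lev i) (Lev (i + 1))) :
    IsOpen {μ : ModL β | μ.code.step i = g} := by
  refine isOpen_iff_forall_mem_open.2 fun μ hμ => ⟨{ν | ∀ p q : Σ i, Lev i, p.1 ≤ i + 1 →
    q.1 ≤ i + 1 → (ν.code.Ge p q ↔ μ.code.Ge p q)}, fun ν hν => ?_, ?_, fun _ _ _ _ => Iff.rfl⟩
  · have hrel : ∀ (ν : ModL β) x y, ν.code.Ge ⟨i, x⟩ ⟨i + 1, y⟩ ↔ (ν.code.step i).rel x y := by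
      intro ν x y
      refine (ge_succ_iff (P := Lev) le_rfl x y).trans ?_
      simp only [ge_iff_eq, exists_eq_left']
    rw [← show μ.code.step i = g from hμ]
    change ν.code.step i = μ.code.step i
    ext x y
    rw [← hrel, ← hrel]
    exact hν ⟨i, x⟩ ⟨i + 1, y⟩ i.le_succ le_rfl
  · exact TopologicalSpace.isOpen_generateFrom_of_mem (Or.inl ⟨i + 1, _, rfl⟩)

end ModL

open Classical in
/-- The embedding of the space of codes. -/
noncomputable def ModL.truth {β : LevelBound L} (μ : ModL β) : TruthSpace L :=
  (μ.code.step, fun k => decide (μ.code.toStr.Sat k.2.2.2 (k.2.2.1.cons (μ.code.coVal k.1))))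

theorem ModL.truth_eq_true_iff {β : LevelBound L} (μ : ModL β) {X : Ctx} {i : ℕ}
    (h : CoVal X (levelCtx i)) (φ : CoFormula L X) :
    (ModL.truth μ).2 ⟨i, X, h, φ⟩ = true ↔ μ.code.toStr.Sat φ (h.cons (μ.code.coVal i)) := by
  simp [ModL.truth]

theorem ModL.isEmbedding_truth {β : LevelBound L} :
    IsEmbedding (ModL.truth : ModL β → TruthSpace L) := by
  refine ⟨⟨le_antisymm ?_ ?_⟩, ?_⟩
  · rw [← continuous_iff_le_induced]
    refine Continuous.prodMk (continuous_pi fun i => ?_) (continuous_pi fun k => ?_)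
    · exact continuous_discrete_rng.2 fun g => ModL.isOpen_setOf_step_eq i g
    · refine continuous_discrete_rng.2 fun b => ?_
      cases b
      · convert (ModL.isClopen_setOf_sat (β := β) k.2.2.1 k.2.2.2).compl.isOpen using 1
        ext μ
        simp
      · convert (ModL.isClopen_setOf_sat (β := β) k.2.2.1 k.2.2.2).isOpen using 1
        ext μ
        simp
  · refine le_generateFrom ?_
    rintro _ (⟨i, r, rfl⟩ | ⟨i, φ, rfl⟩)
    · have hfin : {p : Σ i, Lev i | p.1 ≤ i}.Finite := by
        refine ((Finset.range (i + 1)).sigma fun j => (Finset.univ : Finset (Lev j))).finite_toSet.subset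
          fun p hp => ?_
        simpa [Nat.lt_succ_iff] using hp
      refine ⟨{e | ∀ p q : Σ i, Lev i, p.1 ≤ i → q.1 ≤ i → (Ge (P := Lev) e.1 p q ↔ r p q)}, ?_, rfl⟩
      have : {e : TruthSpace L | ∀ p q : Σ i, Lev i, p.1 ≤ i → q.1 ≤ i →
          (Ge (P := Lev) e.1 p q ↔ r p q)} = ⋂ p ∈ {p : Σ i, Lev i | p.1 ≤ i},
            ⋂ q ∈ {q : Σ i, Lev i | q.1 ≤ i}, {e | Ge (P := Lev) e.1 p q ↔ r p q} := by
        ext e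
        simp only [Set.mem_iInter]
        exact ⟨fun h p hp q hq => h p q hp hq, fun h p q hp hq => h p hp q hq⟩
      rw [this]
      exact hfin.isOpen_biInter fun p _ => hfin.isOpen_biInter fun q _ =>
        (isClopen_setOf_iff (isClopen_setOf_ge p q) (isClopen_setOf_const _)).isOpen
    · refine ⟨{e | e.2 ⟨i, levelCtx i, CoVal.refl _, φ⟩ = true}, (isClopen_setOf_truth _).isOpen, ?_⟩
      ext μ
      refine (ModL.truth_eq_true_iff μ _ _).trans ?_
      rw [CoVal.refl_cons]
      rfl
  · intro μ ν h
    have hstep : μ.code.step = ν.code.step := congrArg Prod.fst h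
    have hholds : ∀ i {n : ℕ} (R : L.Relations n) (x : Fin n → Lev i),
        μ.code.holds i R x ↔ ν.code.holds i R x := by
      intro i n R x
      rw [← ModL.sat_rel_iff μ, ← ModL.sat_rel_iff ν, ← CoVal.refl_cons (μ.code.coVal i),
        ← CoVal.refl_cons (ν.code.coVal i), ← ModL.truth_eq_true_iff μ, ← ModL.truth_eq_true_iff ν, h]
    obtain ⟨⟨s, b⟩, _⟩ := μ
    obtain ⟨⟨s', b'⟩, _⟩ := ν
    obtain rfl : s = s' := hstep
    obtain rfl : @b = @b' := by
      funext i n R x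
      exact propext (hholds i R x)
    rfl

theorem ModL.isCoherent_truth {β : LevelBound L} {T : CoTheory L} (μ : ModT β T) :
    TruthSpace.IsCoherent β T (ModL.truth μ.1) := by
  have hcode : TruthSpace.toCode (ModL.truth μ.1) = μ.1.code := by
    have : ∀ i {n : ℕ} (R : L.Relations n) (x : Fin n → Lev i),
        TruthSpace.holds (ModL.truth μ.1) i R x ↔ μ.1.code.holds i R x := by
      intro i n R x
      rw [← ModL.sat_rel_iff μ.1, ← CoVal.refl_cons (μ.1.code.coVal i)]
      exact ModL.truth_eq_true_iff μ.1 _ _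
    obtain ⟨⟨⟨s, b⟩, _⟩, _⟩ := μ
    refine congrArg (Code.mk s) ?_
    funext i n R x
    exact propext (this i R x)
  refine ⟨?_, ?_, ?_, ?_, ?_, ?_, ?_, ?_⟩
  · intro i X h
    simp [ModL.truth_eq_true_iff]
  · intro i X h n R x
    simp only [TruthSpace.holds, ModL.truth_eq_true_iff, sat_rel_cons, CoVal.refl_cons]
  · intro i X h φ
    simp only [ModL.truth_eq_true_iff, sat_neg]
  · intro i X h φ ψ
    simp only [ModL.truth_eq_true_iff, sat_and]
  · intro i X h Z g φ
    simp only [ModL.truth_eq_true_iff, sat_exFr_coVal_iff]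
    rfl
  · rw [hcode]
    exact μ.1.2.1
  · rw [hcode]
    exact μ.1.2.2
  · rintro ⟨φ, hφ⟩
    rw [ModL.truth_eq_true_iff]
    exact (μ.1.code.models_toStr_iff T).1 μ.2 φ hφ

theorem TruthSpace.IsCoherent.exists_eq_truth {β : LevelBound L} {T : CoTheory L} {e : TruthSpace L}
    (he : TruthSpace.IsCoherent β T e) : ∃ μ : ModT β T, ModL.truth μ.1 = e := by
  let μ : ModL β := ⟨TruthSpace.toCode e, he.upward, he.witnessed⟩
  have key : ∀ {X : Ctx} (φ : CoFormula L X) (i : ℕ) (h : CoVal X (levelCtx i)),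
      μ.code.toStr.Sat φ (h.cons (μ.code.coVal i)) ↔ e.2 ⟨i, X, h, φ⟩ = true := by
    intro X φ
    induction φ with
    | bot => exact fun i h => (sat_bot _ _).trans ⟨False.elim, he.bot i _ h⟩
    | rel R x =>
      intro i h
      rw [sat_rel_cons, he.rel]
      simp only [ModL.sat_rel_iff μ]
      rfl
    | neg φ ih => exact fun i h => by rw [sat_neg, he.neg, ih]
    | and φ ψ ih ih' => exact fun i h => by rw [sat_and, he.and, ih, ih']
    | exFr g φ ih =>
      intro i h
      rw [sat_exFr_coVal_iff, he.exFr]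
      simp only [ih]
      rfl
  refine ⟨⟨μ, (μ.code.models_toStr_iff T).2 fun φ hφ => (key φ 0 _).2 (he.theory ⟨φ, hφ⟩)⟩, ?_⟩
  refine Prod.ext rfl (funext fun k => Bool.eq_iff_iff.2 ?_)
  exact (ModL.truth_eq_true_iff μ _ _).trans (key _ _ _)

/-- `Mod(T)` is Polish, for any bound on the levels of witnesses. -/
theorem ModT.polishSpace [Countable (Σ n, L.Relations n)] (β : LevelBound L) (T : CoTheory L) :
    PolishSpace (ModT β T) := by
  have hemb : IsEmbedding fun μ : ModT β T => ModL.truth μ.1 :=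
    ModL.isEmbedding_truth.comp IsEmbedding.subtypeVal
  have hrange : Set.range (fun μ : ModT β T => ModL.truth μ.1) =
      {e | TruthSpace.IsCoherent β T e} := by
    ext e
    constructor
    · rintro ⟨μ, rfl⟩
      exact ModL.isCoherent_truth μ
    · exact fun he => he.exists_eq_truth
  have : PolishSpace (Set.range fun μ : ModT β T => ModL.truth μ.1) :=
    (hrange ▸ TruthSpace.isGδ_setOf_isCoherent β T).polishSpace
  exact hemb.toHomeomorph.isClosedEmbedding.polishSpace

end Polish

/-! ### Type spaces -/

namespace TypeSpace

open ProtoStructure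

variable {L : FirstOrder.Language} {T : CoTheory L} {X : Ctx}

/-- The complete type of a co-valuation in a model. -/
def ofVal {M : ProtoStructure L} (hM : M.IsStructure) (hT : M.Models T) {v : CoVal X M.carrier}
    (hv : v ∈ M.adm X) : TypeSpace T X :=
  ⟨{φ | M.Sat φ v}, fun φ => (em (M.Sat φ v)).imp id (sat_neg M v φ).2, M, hM, hT, v, hv,
    fun _ h => h⟩

theorem exists_eq_ofVal (r : TypeSpace T X) :
    ∃ (M : ProtoStructure L) (hM : M.IsStructure) (hT : M.Models T) (v : CoVal X M.carrier)
      (hv : v ∈ M.adm X), r = ofVal hM hT hv := by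
  obtain ⟨p, hp, M, hM, hT, v, hv, hpv⟩ := r
  refine ⟨M, hM, hT, v, hv, Subtype.ext (Set.Subset.antisymm hpv fun φ hφ => ?_)⟩
  exact (hp φ).resolve_right fun h => (sat_neg _ _ _).1 (hpv _ h) hφ

theorem isClopen_setOf_mem (φ : CoFormula L X) : IsClopen {r : TypeSpace T X | φ ∈ r.1} := by
  have hopen : ∀ φ : CoFormula L X, IsOpen {r : TypeSpace T X | φ ∈ r.1} := fun φ =>
    TopologicalSpace.isOpen_generateFrom_of_mem ⟨φ, rfl⟩
  refine ⟨⟨?_⟩, hopen φ⟩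
  have : {r : TypeSpace T X | φ ∈ r.1}ᶜ = {r : TypeSpace T X | CoFormula.neg φ ∈ r.1} := by
    refine Set.ext fun (r : TypeSpace T X) => ?_
    obtain ⟨M, hM, hT, v, hv, rfl⟩ := r.exists_eq_ofVal
    exact (sat_neg M v φ).symm
  exact this ▸ hopen _

theorem exists_mem_subset_of_isOpen {U : Set (TypeSpace T X)} (hU : IsOpen U) {r : TypeSpace T X}
    (hr : r ∈ U) : ∃ φ ∈ r.1, {r' : TypeSpace T X | φ ∈ r'.1} ⊆ U := by
  induction hU with
  | basic U hU =>
    obtain ⟨φ, rfl⟩ := hU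
    exact ⟨φ, hr, subset_rfl⟩
  | univ =>
    refine ⟨.neg .bot, ?_, Set.subset_univ _⟩
    obtain ⟨M, hM, hT, v, hv, rfl⟩ := r.exists_eq_ofVal
    exact (sat_neg _ _ _).2 (sat_bot _ _).1
  | inter U V _ _ ihU ihV =>
    obtain ⟨φ, hφ, hφU⟩ := ihU hr.1
    obtain ⟨ψ, hψ, hψV⟩ := ihV hr.2
    have hand : ∀ r' : TypeSpace T X, CoFormula.and φ ψ ∈ r'.1 ↔ φ ∈ r'.1 ∧ ψ ∈ r'.1 := by
      intro r'
      obtain ⟨M, hM, hT, v, hv, rfl⟩ := r'.exists_eq_ofVal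
      exact sat_and M v φ ψ
    exact ⟨.and φ ψ, (hand r).2 ⟨hφ, hψ⟩,
      fun r' hr' => ⟨hφU ((hand r').1 hr').1, hψV ((hand r').1 hr').2⟩⟩
  | sUnion 𝒰 _ ih =>
    obtain ⟨U, hU, hrU⟩ := hr
    obtain ⟨φ, hφ, hφU⟩ := ih U hU hrU
    exact ⟨φ, hφ, hφU.trans (Set.subset_sUnion_of_mem hU)⟩

/-- The set of extensions of a non-isolated type is closed, and has no interior points. -/
theorem isMeagre_setOf_subset {p : CoType L X} (hp : ¬ IsIsolatedType T p) :
    IsMeagre {r : TypeSpace T X | p ⊆ r.1} := by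
  have hclosed : IsClosed {r : TypeSpace T X | p ⊆ r.1} := by
    have : {r : TypeSpace T X | p ⊆ r.1} = ⋂ φ ∈ p, {r : TypeSpace T X | φ ∈ r.1} := by
      ext r
      simp only [Set.mem_iInter]
      rfl
    rw [this]
    exact isClosed_biInter fun φ _ => (isClopen_setOf_mem φ).isClosed
  refine IsNowhereDense.isMeagre (hclosed.isNowhereDense_iff.2 ?_)
  by_contra hne
  obtain ⟨r, hr⟩ := Set.nonempty_iff_ne_empty.2 hne
  obtain ⟨φ, hφ, hsub⟩ := exists_mem_subset_of_isOpen isOpen_interior hr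
  obtain ⟨M, hM, hT, v, hv, rfl⟩ := r.exists_eq_ofVal
  refine hp ⟨φ, ⟨M, hM, hT, v, hv, ?_⟩, fun N hN hNT w hw hφw => ?_⟩
  · rintro _ rfl
    exact hφ
  · exact fun ψ hψ => interior_subset (hsub (show ofVal hN hNT hw ∈ _ from hφw)) hψ

end TypeSpace

/-! ### Codes from cores -/

open OmegaChain ProtoStructure

variable {L : FirstOrder.Language}

/-- The condition on the tuples in a relation in the definition of `Mod(L)`, for a single tuple. -/
def Code.WitnessedAt (μ : Code L) {n : ℕ} (R : L.Relations n) (i : ℕ) (x : Fin n → Lev i) (b : ℕ) :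
    Prop :=
  ∃ j ≤ b, ∃ (C : Set (Set (Lev j))) (A : Fin n → Set (Lev j)),
    IsMinCover C ∧ (∀ k, A k ∈ C) ∧
    (∀ k, ∀ z ∈ A k, μ.Ge ⟨i, x k⟩ ⟨j, z⟩) ∧
    ∀ j' ≥ j, ∃ y : Fin n → Lev j', μ.holds j' R y ∧
      ∀ k, ∀ z : Lev j, μ.Ge ⟨j, z⟩ ⟨j', y k⟩ → z ∈ A k

/-- The code given by a core in the contexts `levelCtx i`. -/
def coreCode (M : ProtoStructure L) (s : ∀ i, CoVal (Lev i) (Lev (i + 1)))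
    (v : ∀ i, CoVal (Lev i) M.carrier) : Code L :=
  ⟨s, fun i _ R x => M.Sat (X := levelCtx i) (.rel R x) (v i)⟩

theorem CoVal.isMinCover_range {X Y : Type*} (g : CoVal X Y) : IsMinCover (Set.range g.cell) := by
  refine ⟨Set.eq_univ_of_forall fun y => ?_, fun B hB hBU => hB.antisymm ?_⟩
  · obtain ⟨x, hx⟩ := g.cosurj y
    exact ⟨_, ⟨x, rfl⟩, hx⟩
  · rintro _ ⟨x, rfl⟩
    obtain ⟨y, hy, hyx⟩ := g.coinj x
    obtain ⟨b, hb, hyb⟩ : y ∈ ⋃₀ B := hBU ▸ Set.mem_univ y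
    obtain ⟨x', rfl⟩ := hB hb
    rwa [← hyx x' hyb]

section CoreCode

variable {M : ProtoStructure L} {s : ∀ i, CoVal (Lev i) (Lev (i + 1))}
  {v : ∀ i, CoVal (Lev i) M.carrier}

theorem coreCode_isUpward (hs : ∀ i, v i = (s i).cons (v (i + 1))) : (coreCode M s v).IsUpward :=
  fun R _ _ hy _ x hxy => sat_rel_of_ge (Y := levelCtx) hs R hy x hxy

theorem coreCode_witnessedAt_of_isWitness (hs : ∀ i, v i = (s i).cons (v (i + 1))) {n : ℕ}
    {R : L.Relations n} {i j b : ℕ} (hij : i ≤ j) (hjb : j ≤ b) {x : Fin n → Lev i} {Z : Ctx}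
    {g : CoVal Z (Lev j)} (h : M.IsWitness (X := levelCtx i) R (v i) x (g.cons (v j))) :
    (coreCode M s v).WitnessedAt R i x b := by
  obtain ⟨y, a, hya, hyx, ha⟩ := h
  refine ⟨j, hjb, _, fun k => g.cell (y k), g.isMinCover_range, fun k => ⟨y k, rfl⟩,
    fun k z hz => ?_, fun j' hj' => ?_⟩
  · have hsub : (v j).cell z ⊆ (v i).cell (x k) := (CoVal.cell_cons_subset hz).trans (hyx k)
    rw [eq_link_cons (P := Lev) hs hij] at hsub
    exact CoVal.rel_of_cell_subset hsub
  · choose t ht using fun k => (v j').cosurj (a k)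
    refine ⟨t, (sat_rel (X := levelCtx j') _ _ _ _).2 ⟨a, ha, ht⟩, fun k z hz => ?_⟩
    obtain ⟨y', hy'⟩ := g.cosurj z
    have haz : (v j).rel z (a k) := by
      rw [eq_link_cons (P := Lev) hs hj']
      exact ⟨t k, hz, ht k⟩
    rwa [(hya k).2 y' ⟨z, hy', haz⟩] at hy'

theorem sat_toStr_coreCode_iff [L.IsRelational] (hM : M.IsStructure) (hv : M.IsCore levelCtx v)
    (hs : ∀ i, v i = (s i).cons (v (i + 1))) {X : Ctx} (φ : CoFormula L X) (i : ℕ)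
    (h : CoVal X (levelCtx i)) :
    (coreCode M s v).toStr.Sat φ (h.cons ((coreCode M s v).coVal i)) ↔ M.Sat φ (h.cons (v i)) :=
  sat_chainStr_iff (Y := levelCtx) hM hv hs (fun _ _ _ _ => Iff.rfl) φ i h

theorem models_toStr_coreCode [L.IsRelational] {T : CoTheory L} (hM : M.IsStructure)
    (hT : M.Models T) (hv : M.IsCore levelCtx v)
    (hs : ∀ i, v i = (s i).cons (v (i + 1))) : (coreCode M s v).toStr.Models T := by
  have := hM.nonempty
  refine ((coreCode M s v).models_toStr_iff T).2 fun φ hφ => ?_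
  refine (sat_toStr_coreCode_iff hM hv hs φ 0 _).2 ?_
  exact (models_iff M (M.adm_cons _ _ (hv.mem 0))).1 hT φ hφ

end CoreCode

/-- A formula expressing that every fragmentation `u` of bounded size has a tuple in the relation `R`
whose entries lie only below elements of the sets `A k`. -/
theorem exists_witness_formula {X : Ctx} {n : ℕ} (R : L.Relations n) (A : Fin n → Set X) :
    ∃ ψ : CoFormula L X, ∀ (M : ProtoStructure L) (v : CoVal X M.carrier), M.Sat ψ v ↔
      ∀ (m : Fin (2 ^ X.card + 1)) (g : CoVal X (Finset.range m : Ctx)),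
        ∀ u ∈ M.adm (Finset.range m), v = g.cons u → ∃ y : Fin n → (Finset.range m : Ctx),
          (∀ k z, g.rel z (y k) → z ∈ A k) ∧ M.Sat (.rel R y) u := by
  have h1 : ∀ (m : Fin (2 ^ X.card + 1)) (g : CoVal X (Finset.range m : Ctx)),
      ∃ ψ : CoFormula L (Finset.range m), ∀ (M : ProtoStructure L) (u : CoVal _ M.carrier),
        M.Sat ψ u ↔ ∃ y : Fin n → (Finset.range m : Ctx),
          (∀ k z, g.rel z (y k) → z ∈ A k) ∧ M.Sat (.rel R y) u := by
    intro m g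
    obtain ⟨ψ, hψ⟩ := CoFormula.exists_iOr
      (ι := {y : Fin n → (Finset.range m : Ctx) // ∀ k z, g.rel z (y k) → z ∈ A k})
      (fun y => CoFormula.rel R y.1)
    exact ⟨ψ, fun M u => by rw [hψ, Subtype.exists]; simp only [exists_prop]⟩
  choose ψ hψ using h1
  obtain ⟨θ, hθ⟩ := CoFormula.exists_iAnd
    (ι := Σ m : Fin (2 ^ X.card + 1), CoVal X (Finset.range m : Ctx))
    (fun k => .neg (.exFr k.2 (.neg (ψ k.1 k.2))))
  refine ⟨θ, fun M v => ?_⟩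
  rw [hθ, Sigma.forall]
  refine forall_congr' fun m => forall_congr' fun g => ?_
  rw [sat_neg, sat_exFr]
  push Not
  refine forall_congr' fun u => forall_congr' fun _ => forall_congr' fun _ => ?_
  rw [sat_neg, not_not, hψ]

/-- For a core, the formula about fragmentations of bounded size is equivalent to the condition on all
late levels: the elements of a level that are below the same elements of level `j` may be merged. -/
theorem witness_formula_iff {M : ProtoStructure L} {Y : ℕ → Ctx}
    {s : ∀ i, CoVal (Y i) (Y (i + 1))} {v : ∀ i, CoVal (Y i) M.carrier} (hv : M.IsCore Y v)
    (hs : ∀ i, v i = (s i).cons (v (i + 1))) (j : ℕ) {n : ℕ} (R : L.Relations n)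
    (A : Fin n → Set (Y j)) :
    (∀ (m : Fin (2 ^ (Y j).card + 1)) (g : CoVal (Y j) (Finset.range m : Ctx)),
        ∀ u ∈ M.adm (Finset.range m), v j = g.cons u → ∃ y : Fin n → (Finset.range m : Ctx),
          (∀ k z, g.rel z (y k) → z ∈ A k) ∧ M.Sat (.rel R y) u) ↔
      ∀ j' ≥ j, ∃ y : Fin n → Y j', M.Sat (.rel R y) (v j') ∧
        ∀ k, ∀ z : Y j, Ge (P := fun i => Y i) s ⟨j, z⟩ ⟨j', y k⟩ → z ∈ A k := by
  constructor
  · intro h j' hj'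
    obtain ⟨f, hf, hτ⟩ := exists_surjective_fiber_eq
      fun z : Y j' => {x | (link (P := fun i => Y i) s hj').rel x z}
    obtain ⟨g, hg⟩ := CoVal.exists_factor (link (P := fun i => Y i) s hj') f hf
      fun z z' hz x => (Set.ext_iff.1 ((hτ z z').1 hz) x).1
    obtain ⟨y, hyA, hyR⟩ := h ⟨_, Nat.lt_succ_of_le ((Set.ncard_le_card _).trans (by
        rw [Nat.card_eq_fintype_card, Fintype.card_set, Fintype.card_coe]))⟩ g
      ((CoVal.ofSurj f hf).cons (v j')) (M.adm_cons _ _ (hv.mem j'))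
      (by rw [CoVal.cons_assoc, ← hg]; exact eq_link_cons (P := fun i => Y i) hs hj')
    obtain ⟨y', hy', hy'R⟩ := (sat_rel_cons _ _ _ _ _).1 hyR
    refine ⟨y', hy'R, fun k z hz => hyA k z ?_⟩
    have hz' : (link (P := fun i => Y i) s hj').rel z (y' k) := hz
    rw [hg] at hz'
    obtain ⟨t, ht, ht'⟩ := hz'
    have h1 : f (y' k) = t := ht'
    have h2 : f (y' k) = y k := hy' k
    rwa [← h2, h1]
  · intro h m g u hu hvu
    obtain ⟨i, p, rfl⟩ := hv.generates u hu
    obtain ⟨y, hyR, hyA⟩ := h (max j i) (le_max_left j i)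
    rw [eq_link_cons (P := fun i => Y i) hs (le_max_right j i), CoVal.cons_assoc] at hvu ⊢
    rw [eq_link_cons (P := fun i => Y i) hs (le_max_left j i), CoVal.cons_assoc] at hvu
    have hlink := CoVal.cons_right_cancel _ hvu
    choose y' hy' using fun k => (p.cons (link (P := fun i => Y i) s (le_max_right j i))).cosurj (y k)
    refine ⟨y', fun k z hz => hyA k z ?_, (sat_rel_cons _ _ _ _ _).2 ⟨y, hy', hyR⟩⟩
    change (link (P := fun i => Y i) s (le_max_left j i)).rel z (y k)
    rw [hlink, ← CoVal.cons_assoc]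
    exact ⟨y' k, hz, hy' k⟩

/-! ### Density of the models that avoid a nowhere dense set of types -/

section Density

open OmegaChain ProtoStructure RelTuple

variable {L : FirstOrder.Language} [L.IsRelational]

/-- Basic neighbourhoods in `Mod(L)`: the steps below some level, together with a single formula at the
canonical co-valuation of that level. -/
theorem ModL.exists_formula_of_isOpen {β : LevelBound L} {U : Set (ModL β)} (hU : IsOpen U)
    {μ : ModL β} (hμ : μ ∈ U) :
    ∃ i₀, ∀ i ≥ i₀, ∃ θ : CoFormula L (levelCtx i), μ.code.toStr.Sat θ (μ.code.coVal i) ∧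
      ∀ ν : ModL β, (∀ k < i, ν.code.step k = μ.code.step k) →
        ν.code.toStr.Sat θ (ν.code.coVal i) → ν ∈ U := by
  induction hU with
  | basic U hU =>
    rcases hU with ⟨i₀, r, rfl⟩ | ⟨i₀, φ, rfl⟩
    · refine ⟨i₀, fun i hi => ⟨.neg .bot, by simp, fun ν hν _ p q hp hq => ?_⟩⟩
      have hpq : ν.code.Ge p q ↔ μ.code.Ge p q := by
        rcases le_or_gt p.1 q.1 with h | h
        · have := link_congr (P := Lev) h fun k hk => hν k (hk.trans_le (hq.trans hi))
          exact iff_of_eq (congrArg (fun c : CoVal (Lev p.1) (Lev q.1) => c.rel p.2 q.2) this)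
        · exact iff_of_false (fun h' => absurd h'.level_le (not_le.2 h))
            (fun h' => absurd h'.level_le (not_le.2 h))
      exact hpq.trans (hμ p q hp hq)
    · refine ⟨i₀, fun i hi => ?_⟩
      obtain ⟨θ, hθ⟩ := φ.exists_translation (link (P := Lev) μ.code.step hi)
      have key : ∀ ν : ModL β, (∀ k < i, ν.code.step k = μ.code.step k) →
          (ν.code.toStr.Sat θ (ν.code.coVal i) ↔ ν.code.toStr.Sat φ (ν.code.coVal i₀)) := by
        intro ν hν
        rw [hθ _ ν.code.isCompactOmega_toStr.isStructure _ (ν.code.isCore_coVal.mem i),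
          ν.code.coVal_eq_link_cons hi, link_congr (P := Lev) hi hν]
      exact ⟨θ, (key μ fun _ _ => rfl).2 hμ, fun ν hν hsat => (key ν hν).1 hsat⟩
  | univ => exact ⟨0, fun i _ => ⟨.neg .bot, by simp, fun _ _ _ => trivial⟩⟩
  | inter U V _ _ ihU ihV =>
    obtain ⟨i₁, h1⟩ := ihU hμ.1
    obtain ⟨i₂, h2⟩ := ihV hμ.2
    refine ⟨max i₁ i₂, fun i hi => ?_⟩
    obtain ⟨θ, hθ, hθU⟩ := h1 i ((le_max_left _ _).trans hi)
    obtain ⟨θ', hθ', hθV⟩ := h2 i ((le_max_right _ _).trans hi)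
    refine ⟨.and θ θ', (sat_and _ _ _ _).2 ⟨hθ, hθ'⟩, fun ν hν hsat => ?_⟩
    rw [sat_and] at hsat
    exact ⟨hθU ν hν hsat.1, hθV ν hν hsat.2⟩
  | sUnion 𝒰 _ ih =>
    obtain ⟨U, hU, hμU⟩ := hμ
    obtain ⟨i₀, h⟩ := ih U hU hμU
    refine ⟨i₀, fun i hi => ?_⟩
    obtain ⟨θ, hθ, hθU⟩ := h i hi
    exact ⟨θ, hθ, fun ν hν hsat => ⟨U, hU, hθU ν hν hsat⟩⟩

/-- The existence of a witness in time for a given tuple is preserved by passing to another code that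
has the same steps up to level `l` and satisfies a suitable formula there. -/
theorem ModL.exists_formula_witnessedAt {β : LevelBound L} (μ : ModL β) {n : ℕ} (R : L.Relations n)
    (i : ℕ) (x : Fin n → Lev i) (l : ℕ) (hil : i ≤ l) (hβ : β i R x ≤ l) :
    ∃ ψ : CoFormula L (levelCtx l), μ.code.toStr.Sat ψ (μ.code.coVal l) ∧
      ∀ (M : ProtoStructure L) (s : ∀ i, CoVal (Lev i) (Lev (i + 1)))
        (v : ∀ i, CoVal (Lev i) M.carrier), M.IsStructure → M.IsCore levelCtx v →
        (∀ i, v i = (s i).cons (v (i + 1))) → (∀ k < l, s k = μ.code.step k) →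
        M.Sat (X := levelCtx l) ψ (v l) → (coreCode M s v).holds i R x →
          (coreCode M s v).WitnessedAt R i x (β i R x) := by
  by_cases hx : μ.code.holds i R x
  · obtain ⟨j, hj, C, A, hC, hAC, hAx, hA⟩ := μ.2.2 R i x hx
    have hjl : j ≤ l := hj.trans hβ
    obtain ⟨ψ₀, hψ₀⟩ := exists_witness_formula (X := levelCtx j) R A
    obtain ⟨ψ, hψ⟩ := ψ₀.exists_translation (link (P := Lev) μ.code.step hjl)
    refine ⟨ψ, ?_, fun M s v hM hv hs hsμ hsat _ => ?_⟩
    · rw [hψ _ μ.code.isCompactOmega_toStr.isStructure _ (μ.code.isCore_coVal.mem l),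
        ← μ.code.coVal_eq_link_cons hjl, hψ₀, witness_formula_iff (Y := levelCtx)
          μ.code.isCore_coVal μ.code.coVal_eq_cons]
      intro j' hj'
      obtain ⟨y, hy, hyA⟩ := hA j' hj'
      exact ⟨y, (μ.sat_rel_iff R y).2 hy, hyA⟩
    · rw [hψ M hM _ (hv.mem l), ← link_congr (P := Lev) hjl hsμ] at hsat
      rw [← eq_link_cons (P := Lev) hs hjl, hψ₀, witness_formula_iff (Y := levelCtx) hv hs] at hsat
      refine ⟨j, hj, C, A, hC, hAC, fun k z hz => ?_, hsat⟩
      have hge := hAx k z hz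
      have hij : i ≤ j := Ge.level_le hge
      have hlink := link_congr (P := Lev) hij fun k hk => hsμ k (hk.trans_le hjl)
      change (link (P := Lev) s hij).rel (x k) z
      rw [hlink]
      exact hge
  · obtain ⟨ψ, hψ⟩ := CoFormula.exists_translation (.neg (.rel (X := levelCtx i) R x))
      (link (P := Lev) μ.code.step hil)
    refine ⟨ψ, ?_, fun M s v hM hv hs hsμ hsat hholds => ?_⟩
    · rw [hψ _ μ.code.isCompactOmega_toStr.isStructure _ (μ.code.isCore_coVal.mem l),
        ← μ.code.coVal_eq_link_cons hil, sat_neg]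
      exact fun h => hx ((μ.sat_rel_iff R x).1 h)
    · rw [hψ M hM _ (hv.mem l), ← link_congr (P := Lev) hil hsμ,
        ← eq_link_cons (P := Lev) hs hil, sat_neg] at hsat
      exact absurd hholds hsat

variable {T : CoTheory L}

/-- The type that `h.cons (v_j)` realizes in the structure of a code. -/
def ModT.typeAt {β : LevelBound L} {X : Ctx} {j : ℕ} (h : CoVal X (levelCtx j)) (μ : ModT β T) :
    TypeSpace T X :=
  TypeSpace.ofVal (M := μ.1.code.toStr) μ.1.code.isCompactOmega_toStr.isStructure μ.2
    (μ.1.code.cons_coVal_mem h)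

theorem ModT.continuous_typeAt {β : LevelBound L} {X : Ctx} {j : ℕ} (h : CoVal X (levelCtx j)) :
    Continuous (ModT.typeAt h : ModT β T → TypeSpace T X) := by
  refine continuous_generateFrom_iff.2 ?_
  rintro _ ⟨φ, rfl⟩
  exact (ModL.isClopen_setOf_sat h φ).isOpen.preimage continuous_subtype_val

variable [Countable (Σ n, L.Relations n)]

/-- The extension of a finite part of a core, given by the steps of a code, to a code in `Mod(T)`: the
triples with numbers below `e₀` have witnesses by assumption, the others get them from the construction
of the core. -/
theorem exists_modT_extension {N : ProtoStructure L} (hN : N.IsStructure) (hNT : N.Models T)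
    (hcore : ∃ (Y : ℕ → Ctx) (w : ∀ i, CoVal (Y i) N.carrier), N.IsCore Y w)
    (hbig : N.HasLargeCovers) (s₀ : ∀ i, CoVal (Lev i) (Lev (i + 1))) (e₀ : ℕ)
    {v₀ : CoVal (Lev (checkpoint L e₀)) N.carrier}
    (hv₀ : v₀ ∈ N.adm (levelCtx (checkpoint L e₀)))
    (hold : ∀ (s : ∀ i, CoVal (Lev i) (Lev (i + 1))) (v : ∀ i, CoVal (Lev i) N.carrier),
      N.IsCore levelCtx v → (∀ i, v i = (s i).cons (v (i + 1))) →
      (∀ k < checkpoint L e₀, s k = s₀ k) → v (checkpoint L e₀) = v₀ →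
      ∀ t : RelTuple L, code t < e₀ → (coreCode N s v).holds t.1 t.2.1.2 t.2.2 →
        (coreCode N s v).WitnessedAt t.2.1.2 t.1 t.2.2 (witnessBound L t.1 t.2.1.2 t.2.2)) :
    ∃ ν : ModT (witnessBound L) T, (∀ k < checkpoint L e₀, ν.1.code.step k = s₀ k) ∧
      ∀ {X : Ctx} (φ : CoFormula L X) (i : ℕ) (hi : i ≤ checkpoint L e₀) (h : CoVal X (levelCtx i)),
        ν.1.code.toStr.Sat φ (h.cons (ν.1.code.coVal i)) ↔
          N.Sat φ (h.cons ((link (P := Lev) s₀ hi).cons v₀)) := by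
  choose u' hu' using hbig.exists_mem_adm
  let u : ∀ i, CoVal (Lev i) N.carrier := fun i =>
    if h : i ≤ checkpoint L e₀ then (link (P := Lev) s₀ h).cons v₀ else u' i
  have hu : ∀ i (h : i ≤ checkpoint L e₀), u i = (link (P := Lev) s₀ h).cons v₀ := fun i h =>
    dif_pos h
  have hustep : ∀ i < checkpoint L e₀, u i = (s₀ i).cons (u (i + 1)) := by
    intro i hi
    rw [hu i hi.le, hu (i + 1) hi, CoVal.cons_assoc]
    have h1 : link (P := Lev) s₀ i.le_succ = s₀ i := by
      rw [link_succ s₀ le_rfl, link_self, CoVal.refl_cons]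
    rw [← h1, link_cons_link]
  obtain ⟨v, hv, hvu, hwit⟩ := hN.exists_core_extension hcore hbig e₀ u
    (fun i hi => by rw [hu i hi]; exact N.adm_cons _ _ hv₀) (fun i hi => ⟨_, hustep i hi⟩)
  have hex : ∀ i, ∃ g : CoVal (Lev i) (Lev (i + 1)), v i = g.cons (v (i + 1)) ∧
      (i < checkpoint L e₀ → g = s₀ i) := by
    intro i
    by_cases hi : i < checkpoint L e₀
    · exact ⟨s₀ i, by rw [hvu i hi.le, hvu (i + 1) hi, hustep i hi], fun _ => rfl⟩
    · obtain ⟨g, hg⟩ := hv.chain i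
      exact ⟨g, hg, fun h => absurd h hi⟩
  choose s hs hss₀ using hex
  have hvv₀ : v (checkpoint L e₀) = v₀ := by
    rw [hvu _ le_rfl, hu _ le_rfl, link_self, CoVal.refl_cons]
  have hwitnessed : (coreCode N s v).IsWitnessed (witnessBound L) := by
    intro n R i x hx
    rcases lt_or_ge (code (L := L) ⟨i, ⟨n, R⟩, x⟩) e₀ with h | h
    · exact hold s v hv hs hss₀ hvv₀ ⟨i, ⟨n, R⟩, x⟩ h hx
    · obtain ⟨Z, g, hg⟩ := hwit ⟨i, ⟨n, R⟩, x⟩ h hx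
      exact coreCode_witnessedAt_of_isWitness hs ((fst_le_code (L := L) ⟨i, ⟨n, R⟩, x⟩).trans
        ((checkpoint_strictMono.id_le _).trans (checkpoint_lt_succ _).le)) le_rfl hg
  refine ⟨⟨⟨coreCode N s v, coreCode_isUpward hs, hwitnessed⟩,
    models_toStr_coreCode hN hNT hv hs⟩, hss₀, fun φ i hi h => ?_⟩
  refine (sat_toStr_coreCode_iff hN hv hs φ i h).trans ?_
  rw [hvu i hi, hu i hi]

/-- `Mod(T)` is non-empty: a model of `T` may be taken compact, and being infinite it then has a core in the
fixed contexts with witnesses in time. -/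
theorem nonempty_modT {M : ProtoStructure L} (hM : M.IsStructure) (hT : M.Models T)
    (hbig : ∀ N : ProtoStructure L, N.IsCompactOmega → N.Models T → Infinite N.carrier) :
    Nonempty (ModT (witnessBound L) T) := by
  obtain ⟨X, w, hw⟩ := hM.adm_nonempty
  obtain ⟨N, hN, hNT, -⟩ := hM.exists_isCompactOmega hw
  have := hbig N hN (hNT T hT)
  obtain ⟨v₀, hv₀⟩ := hN.hasLargeCovers.exists_mem_adm (checkpoint L 0)
  obtain ⟨c, hc⟩ := hN.hasLargeCovers.exists_mem_adm 0
  have hne : ∀ i, Nonempty (CoVal (Lev i) (Lev (i + 1))) := by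
    intro i
    obtain ⟨f, hf, -⟩ := exists_surjective_refining (fun _ : Lev (i + 1) => ()) (levelSize i)
      ((Set.ncard_le_one_of_subsingleton _).trans ((Nat.zero_le i).trans_lt (lt_levelSize i)))
      (by rw [CoVal.card_ctx, card_levelCtx]; exact levelSize_mono i.le_succ)
    exact ⟨CoVal.ofSurj f hf⟩
  obtain ⟨ν, -⟩ := exists_modT_extension hN.isStructure (hNT T hT) hN.hasCore hN.hasLargeCovers
    (fun i => (hne i).some) 0 hv₀ (fun _ _ _ _ _ _ t ht => absurd ht (Nat.not_lt_zero _))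
  exact ⟨ν⟩

/-- The codes at which a given co-valuation has a type outside a nowhere dense set are dense in
`Mod(T)`. The formula defining a neighbourhood, strengthened by formulas that guarantee witnesses for
the finitely many tuples concerned, holds in some model together with a formula that excludes the
nowhere dense set, and that model may be taken compact. -/
theorem dense_setOf_typeAt_notMem
    (hT : ∀ M : ProtoStructure L, M.IsCompactOmega → M.Models T → Infinite M.carrier) {X : Ctx}
    {K : Set (TypeSpace T X)} (hK : IsNowhereDense K) {j : ℕ} (h : CoVal X (levelCtx j)) :
    Dense {μ : ModT (witnessBound L) T | ModT.typeAt h μ ∉ closure K} := by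
  rw [dense_iff_inter_open]
  rintro _ ⟨U, hU, rfl⟩ ⟨μ, hμU⟩
  obtain ⟨i₀, hi₀⟩ := ModL.exists_formula_of_isOpen hU hμU
  -- A stage beginning beyond level `j` and the neighbourhood.
  obtain ⟨e₀, hje, hie⟩ : ∃ e₀, j ≤ checkpoint L e₀ ∧ i₀ ≤ checkpoint L e₀ :=
    ⟨max j i₀, (le_max_left _ _).trans (checkpoint_strictMono.id_le _),
      (le_max_right _ _).trans (checkpoint_strictMono.id_le _)⟩
  obtain ⟨θ, hθ, hθU⟩ := hi₀ _ hie
  have hfin : Finite {t : RelTuple L // code t < e₀} :=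
    Finite.of_injective (fun t => (⟨code t.1, t.2⟩ : Fin e₀)) fun t t' htt' =>
      Subtype.ext (code_injective (Fin.mk.inj htt'))
  choose ψ hψ hψw using fun t : {t : RelTuple L // code t < e₀} =>
    μ.1.exists_formula_witnessedAt t.1.2.1.2 t.1.1 t.1.2.2 (checkpoint L e₀)
      ((fst_le_code t.1).trans (t.2.le.trans (checkpoint_strictMono.id_le _)))
      (checkpoint_strictMono.monotone (Nat.succ_le_of_lt t.2))
  obtain ⟨ψ', hψ'⟩ := CoFormula.exists_iAnd ψ
  let χ : CoFormula L X := .exFr (h.cons (link (P := Lev) μ.1.code.step hje)) (.and θ ψ')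
  have hχμ : χ ∈ (ModT.typeAt h μ).1 := by
    refine (sat_exFr _ _ _ _).2 ⟨_, μ.1.code.isCore_coVal.mem (checkpoint L e₀), ?_,
      (sat_and _ _ _ _).2 ⟨hθ, (hψ' _ _).2 hψ⟩⟩
    rw [μ.1.code.coVal_eq_link_cons hje, CoVal.cons_assoc]
  obtain ⟨q, hqχ, hqK⟩ : ∃ q : TypeSpace T X, χ ∈ q.1 ∧ q ∉ closure K := by
    by_contra! hcon
    have : ModT.typeAt h μ ∈ interior (closure K) :=
      (TypeSpace.isClopen_setOf_mem χ).isOpen.subset_interior_iff.2 (fun q hq => hcon q hq) hχμ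
    rwa [show interior (closure K) = ∅ from hK] at this
  obtain ⟨δ, hδ, hδsub⟩ := TypeSpace.exists_mem_subset_of_isOpen
    ((TypeSpace.isClopen_setOf_mem χ).isOpen.inter isClosed_closure.isOpen_compl)
    (show q ∈ {r : TypeSpace T X | χ ∈ r.1} ∩ (closure K)ᶜ from ⟨hqχ, hqK⟩)
  obtain ⟨M, hM, hMT, w, hw, rfl⟩ := q.exists_eq_ofVal
  obtain ⟨N, hN, hNT, w', hw', hww'⟩ := hM.exists_isCompactOmega hw
  have hNT := hNT T hMT
  have := hT N hN hNT
  have hN' : TypeSpace.ofVal hN.isStructure hNT hw' ∈ {r : TypeSpace T X | χ ∈ r.1} ∩ (closure K)ᶜ :=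
    hδsub ((hww' δ).2 hδ)
  obtain ⟨v₀, hv₀, hw'v₀, hsat⟩ := (sat_exFr _ _ _ _).1 hN'.1
  rw [sat_and, hψ'] at hsat
  obtain ⟨ν, hνstep, hν⟩ := exists_modT_extension hN.isStructure hNT hN.hasCore hN.hasLargeCovers
    μ.1.code.step e₀ hv₀ (fun s v hv hs hsμ hvv₀ t ht hx =>
      hψw ⟨t, ht⟩ N s v hN.isStructure hv hs hsμ (hvv₀ ▸ hsat.2 ⟨t, ht⟩) hx)
  refine ⟨ν, hθU ν.1 hνstep ?_, ?_⟩
  · have := hν θ _ le_rfl (CoVal.refl _)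
    rw [CoVal.refl_cons, CoVal.refl_cons, link_self, CoVal.refl_cons] at this
    exact this.2 hsat.1
  · have : ModT.typeAt h ν = TypeSpace.ofVal hN.isStructure hNT hw' := by
      refine Subtype.ext (Set.ext fun φ => ?_)
      refine (hν φ j hje h).trans ?_
      rw [CoVal.cons_assoc, ← hw'v₀]
      rfl
    change ModT.typeAt h ν ∉ closure K
    rw [this]
    exact hN'.2

/-- Comeagerly many codes in `Mod(T)` give structures omitting all types of a meager set. -/
theorem eventually_residual_omits
    (hT : ∀ M : ProtoStructure L, M.IsCompactOmega → M.Models T → Infinite M.carrier) {X : Ctx}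
    {F : Set (TypeSpace T X)} (hF : IsMeagre F) :
    ∀ᶠ μ : ModT (witnessBound L) T in residual (ModT (witnessBound L) T),
      ∀ p ∈ F, μ.1.code.toStr.Omits p.1 := by
  obtain ⟨S, hS, hSc, hFS⟩ := isMeagre_iff_countable_union_isNowhereDense.1 hF
  have := hSc.to_subtype
  have hall : ∀ᶠ μ : ModT (witnessBound L) T in residual (ModT (witnessBound L) T),
      ∀ (K : S) (j : ℕ) (h : CoVal X (levelCtx j)), ModT.typeAt h μ ∉ closure K.1 := by
    refine eventually_countable_forall.2 fun K => eventually_countable_forall.2 fun j =>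
      eventually_countable_forall.2 fun h => ?_
    exact residual_of_dense_open
      (isClosed_closure.isOpen_compl.preimage (ModT.continuous_typeAt h))
      (dense_setOf_typeAt_notMem hT (hS K.1 K.2) h)
  refine hall.mono fun μ hμ p hp => ?_
  rintro ⟨w, hw, hpw⟩
  obtain ⟨j, h, rfl⟩ := μ.1.code.isCore_coVal.generates w hw
  have hpt : p = ModT.typeAt h μ := by
    refine Subtype.ext (Set.Subset.antisymm hpw fun φ hφ => ?_)
    exact (p.2.1 φ).resolve_right fun hn => (sat_neg _ _ _).1 (hpw _ hn) hφ
  obtain ⟨K, hK, hpK⟩ := hFS hp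
  exact hμ ⟨K, hK⟩ j h (hpt ▸ subset_closure hpK)

end Density

/-! ### Models with a largest admissible cover -/

section Finite

open ProtoStructure

/-- A co-valuation in a context that is at least as large as the set of values is the graph of a
bijection. -/
theorem CoVal.exists_cons_eq_refl {Y Z : Type*} [Finite Z] (p : CoVal Y Z)
    (h : Nat.card Z ≤ Nat.card Y) : ∃ q : CoVal Z Y, q.cons p = CoVal.refl Z := by
  choose f hf hu using p.coinj
  have hinj : Function.Injective f := fun x x' hx => (hu x x' (hx ▸ hf x')).symm
  have := Finite.of_injective f hinj
  have hsurj : Function.Surjective f :=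
    ((Nat.bijective_iff_injective_and_card f).2 ⟨hinj,
      le_antisymm (Nat.card_le_card_of_injective f hinj) h⟩).2
  refine ⟨CoVal.ofSurj f hsurj, CoVal.ext (funext₂ fun z z' => propext ⟨?_, ?_⟩)⟩
  · rintro ⟨y, rfl, hy⟩
    obtain ⟨y', rfl⟩ := hsurj z'
    exact congrArg f (hu y' y hy)
  · intro hz
    obtain ⟨y, rfl⟩ := hsurj z
    exact ⟨y, rfl, (show f y = z' from hz) ▸ hf y⟩

variable {L : FirstOrder.Language}

/-- An admissible co-valuation in a context of the largest possible size. -/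
def ProtoStructure.IsLargest (M : ProtoStructure L) {Y : Ctx} (w : CoVal Y M.carrier) : Prop :=
  w ∈ M.adm Y ∧ ∀ Z : Ctx, (M.adm Z).Nonempty → Z.card ≤ Y.card

/-- A largest admissible cover is a fragmentation of all admissible covers: its common fragmentations with
them have the same size, so they differ from it by a bijection. -/
theorem ProtoStructure.IsLargest.isCore {M : ProtoStructure L} (hM : M.IsStructure) {Y : Ctx}
    {w : CoVal Y M.carrier} (hw : M.IsLargest w) : M.IsCore (fun _ => Y) fun _ => w where
  mem _ := hw.1
  chain _ := ⟨CoVal.refl Y, (CoVal.refl_cons w).symm⟩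
  generates := by
    intro X u hu
    obtain ⟨Z, z, hz, g, p, rfl, hp⟩ := hM.directed u hu w hw.1
    obtain ⟨q, hq⟩ := p.exists_cons_eq_refl
      (by rw [CoVal.card_ctx, CoVal.card_ctx]; exact hw.2 Z ⟨z, hz⟩)
    refine ⟨0, g.cons q, ?_⟩
    rw [hp, CoVal.cons_assoc, ← CoVal.cons_assoc g q p, hq, CoVal.cons_refl]

/-- Being of the largest possible size is expressible: a larger admissible cover gives rise to a
fragmentation that is larger, but of bounded size. -/
theorem exists_largest_formula (L : FirstOrder.Language) (Y : Ctx) :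
    ∃ χ : CoFormula L Y, ∀ M : ProtoStructure L, M.IsStructure → ∀ w ∈ M.adm Y,
      (M.Sat χ w ↔ M.IsLargest w) := by
  obtain ⟨χ, hχ⟩ := CoFormula.exists_iAnd (L := L) (X := Y)
    (ι := Σ n : {n : Fin (2 ^ Y.card + Y.card + 2) // Y.card < n},
      CoVal Y (Finset.range n.1 : Ctx))
    (fun k => .neg (.exFr k.2 (.neg .bot)))
  refine ⟨χ, fun M hM w hw => ⟨fun h => ⟨hw, ?_⟩, fun h => ?_⟩⟩
  · rintro Z ⟨u, hu⟩
    by_contra! hlt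
    obtain ⟨Z', z, hz, g, p, rfl, rfl⟩ := hM.directed u hu w hw
    have hcard := g.card_le
    rw [CoVal.card_ctx, CoVal.card_ctx] at hcard
    let τ : Z' → Set Y := fun z' => {y | p.rel y z'}
    have hτ : (Set.range τ).ncard ≤ 2 ^ Y.card := (Set.ncard_le_card _).trans (by
      rw [Nat.card_eq_fintype_card, Fintype.card_set, Fintype.card_coe])
    have hτ' : (Set.range τ).ncard ≤ Z'.card := by
      rw [← CoVal.card_ctx, ← Nat.card_coe_set_eq]
      exact Nat.card_le_card_of_surjective _ Set.rangeFactorization_surjective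
    obtain ⟨f, hf, hfτ⟩ := exists_surjective_refining τ (max (Set.range τ).ncard (Y.card + 1))
      (le_max_left _ _) (by rw [CoVal.card_ctx]; omega)
    obtain ⟨p', hp'⟩ := CoVal.exists_factor p f hf fun z z' hzz' y =>
      (Set.ext_iff.1 (hfτ z z' hzz') y).1
    refine (sat_neg _ _ _).1 ((hχ M _).1 h ⟨⟨⟨max (Set.range τ).ncard (Y.card + 1), by omega⟩,
      Nat.lt_of_succ_le (le_max_right _ _)⟩, p'⟩) ((sat_exFr _ _ _ _).2
        ⟨(CoVal.ofSurj f hf).cons z, M.adm_cons _ _ hz, ?_, by simp⟩)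
    rw [CoVal.cons_assoc, ← hp']
  · refine (hχ M w).2 fun k => (sat_neg _ _ _).2 fun hk => ?_
    obtain ⟨u, hu, -, -⟩ := (sat_exFr _ _ _ _).1 hk
    have := h.2 _ ⟨u, hu⟩
    rw [Finset.card_range] at this
    exact absurd k.1.2 (not_lt.2 this)

/-- Indices of the atomic statements about elements of `Y`. -/
abbrev AtomIndex (L : FirstOrder.Language) (Y : Ctx) : Type _ :=
  Σ R : (Σ n, L.Relations n), Fin R.1 → Y

variable [L.IsRelational] {Y : Ctx}

/-- The finite structure on the set `Y` with given truth values of atomic statements, in which all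
co-valuations are admissible. -/
abbrev finStr (b : AtomIndex L Y → Bool) : ProtoStructure L where
  carrier := Y
  str :=
    { funMap := fun f => isEmptyElim f
      RelMap := fun R x => b ⟨⟨_, R⟩, x⟩ = true }
  adm _ := Set.univ
  adm_cons _ _ _ := trivial

theorem sat_rel_finStr_refl (b : AtomIndex L Y → Bool) {n : ℕ} (R : L.Relations n) (x : Fin n → Y) :
    (finStr b).Sat (.rel R x) (CoVal.refl Y : CoVal Y (finStr b).carrier) ↔ b ⟨⟨n, R⟩, x⟩ = true := by
  rw [sat_rel]
  constructor
  · rintro ⟨a, ha, hax⟩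
    obtain rfl : x = a := funext hax
    exact ha
  · exact fun h => ⟨x, h, fun _ => rfl⟩

theorem finStr_isCompactOmega [Nonempty Y] (b : AtomIndex L Y → Bool) :
    (finStr b).IsCompactOmega where
  isStructure :=
    { nonempty := ‹Nonempty Y›
      adm_nonempty := ⟨Y, CoVal.refl Y, trivial⟩
      directed := fun u _ v _ =>
        ⟨Y, CoVal.refl Y, trivial, u, v, (CoVal.cons_refl u).symm, (CoVal.cons_refl v).symm⟩
      witness := by
        intro n R X v _ x hx
        obtain ⟨a, ha, hax⟩ := (sat_rel _ _ _ _).1 hx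
        refine ⟨Y, CoVal.refl Y, trivial, a, a, fun k => ⟨rfl, fun _ h => h⟩, ?_, ha⟩
        rintro k _ rfl
        exact hax k }
  isCompact := by
    have : Finite (finStr b).carrier := inferInstanceAs (Finite Y)
    let _ : TopologicalSpace (finStr b).carrier := ⊥
    have : DiscreteTopology (finStr b).carrier := ⟨rfl⟩
    refine ⟨⊥, Finite.compactSpace, inferInstance, fun _ _ _ _ => isOpen_discrete _, fun U _ hU => ?_,
      fun _ _ => isClosed_discrete _⟩
    · refine ⟨Y, CoVal.refl Y, trivial, fun y => ?_⟩
      obtain ⟨u, hu, hy⟩ := Set.mem_sUnion.1 (hU ▸ Set.mem_univ (α := (finStr b).carrier) y)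
      refine ⟨u, hu, ?_⟩
      rintro _ rfl
      exact hy
  hasCore := ⟨fun _ => Y, fun _ => CoVal.refl Y, fun _ => trivial,
    fun _ => ⟨CoVal.refl Y, (CoVal.refl_cons _).symm⟩, fun w _ => ⟨0, w, (CoVal.cons_refl w).symm⟩⟩

theorem isLargest_refl_finStr (b : AtomIndex L Y → Bool) :
    (finStr b).IsLargest (CoVal.refl Y : CoVal Y (finStr b).carrier) := by
  refine ⟨trivial, ?_⟩
  rintro Z ⟨u, -⟩
  have := CoVal.card_le (M := Y) u
  rwa [CoVal.card_ctx, CoVal.card_ctx] at this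

theorem isClopen_setOf_sat_finStr {X : Ctx} (φ : CoFormula L X) (h : CoVal X Y) :
    IsClopen {b : AtomIndex L Y → Bool | (finStr b).Sat φ h} := by
  induction φ with
  | bot => simpa only [sat_bot] using isClopen_setOf_const False
  | rel R x =>
    simp only [sat_rel]
    exact isClopen_setOf_exists (ι := Fin _ → Y) fun a =>
      isClopen_setOf_and ((isClopen_discrete {true}).preimage (continuous_apply _))
        (isClopen_setOf_const (∀ k, a k ∈ h.cell (x k)))
  | neg φ ih => simpa only [sat_neg] using isClopen_setOf_not (ih h)
  | and φ ψ ih ih' => simpa only [sat_and] using isClopen_setOf_and (ih h) (ih' h)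
  | @exFr X Z g φ ih =>
    simp only [sat_exFr]
    exact isClopen_setOf_exists (ι := CoVal Z Y) fun w =>
      isClopen_setOf_and (isClopen_setOf_const _)
        (isClopen_setOf_and (isClopen_setOf_const _) (ih w))

/-- Atomic truth at `w`. -/
noncomputable def atomTruth (M : ProtoStructure L) (w : CoVal Y M.carrier) : AtomIndex L Y → Bool :=
  open Classical in fun k => decide (M.Sat (.rel k.1.2 k.2) w)

/-- A structure with a largest admissible cover satisfies the same formulas as the finite structure on
the indices of this cover. -/
theorem sat_finStr_atomTruth_iff {M : ProtoStructure L} (hM : M.IsStructure) {w : CoVal Y M.carrier}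
    (hw : M.IsLargest w) {X : Ctx} (φ : CoFormula L X) (h : CoVal X Y) :
    (finStr (atomTruth M w)).Sat φ h ↔ M.Sat φ (h.cons w) := by
  have := sat_iff_of_isCore ((isLargest_refl_finStr (atomTruth M w)).isCore (hM := ?_))
    (hw.isCore hM) (s := fun _ => CoVal.refl Y) (fun _ => (CoVal.refl_cons _).symm)
    (fun _ => (CoVal.refl_cons _).symm) (fun _ R x => by simp [sat_rel_finStr_refl, atomTruth])
    φ 0 h
  · rwa [CoVal.cons_refl] at this
  · have := hM.nonempty
    have : Nonempty Y := (w.cosurj (Classical.arbitrary _)).nonempty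
    exact (finStr_isCompactOmega _).isStructure

theorem models_finStr_iff [Nonempty Y] (b : AtomIndex L Y → Bool) (T : CoTheory L) :
    (finStr b).Models T ↔ ∀ φ ∈ T, (finStr b).Sat φ (CoVal.single starCtx Y) :=
  have : Nonempty (finStr b).carrier := ‹Nonempty Y›
  models_iff (finStr b) (v := CoVal.single starCtx Y) trivial

theorem models_finStr_atomTruth {M : ProtoStructure L} (hM : M.IsStructure) {T : CoTheory L}
    (hT : M.Models T) {w : CoVal Y M.carrier} (hw : M.IsLargest w) :
    (finStr (atomTruth M w)).Models T := by
  have := hM.nonempty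
  have : Nonempty Y := (w.cosurj (Classical.arbitrary _)).nonempty
  refine (models_finStr_iff _ T).2 fun φ hφ => (sat_finStr_atomTruth_iff hM hw φ _).2 ?_
  exact (models_iff M (M.adm_cons _ _ hw.1)).1 hT φ hφ

/-- The finite models on `Y` in which `h` does not realize a given non-isolated type are dense: if
finitely many atomic statements implied the type, then together with the formula saying that the cover
is largest they would isolate it. -/
theorem dense_setOf_not_sat_finStr {T : CoTheory L} {X : Ctx} {p : CoType L X}
    (hp : ¬ IsIsolatedType T p) [Nonempty Y] (h : CoVal X Y) :
    Dense {b : {b : AtomIndex L Y → Bool // (finStr b).Models T} |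
      ¬ ∀ φ ∈ p, (finStr b.1).Sat φ h} := by
  rw [dense_iff_inter_open]
  rintro _ ⟨V, hV, rfl⟩ ⟨b₀, hb₀⟩
  by_contra hne
  have hsub : ∀ b : {b : AtomIndex L Y → Bool // (finStr b).Models T}, b.1 ∈ V →
      ∀ φ ∈ p, (finStr b.1).Sat φ h := fun b hb =>
    not_not.1 fun hb' => hne ⟨b, hb, hb'⟩
  obtain ⟨I, u, hu, hI⟩ := isOpen_pi_iff.1 hV b₀.1 hb₀
  obtain ⟨ψ, hψ⟩ := CoFormula.exists_iAnd (ι := I) fun k =>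
    if b₀.1 k.1 = true then CoFormula.rel k.1.1.2 k.1.2 else .neg (.rel k.1.1.2 k.1.2)
  have hψ' : ∀ (M : ProtoStructure L) (w : CoVal Y M.carrier), M.Sat ψ w ↔
      ∀ k ∈ I, (M.Sat (.rel k.1.2 k.2) w ↔ b₀.1 k = true) := by
    intro M w
    rw [hψ, Subtype.forall]
    refine forall₂_congr fun k _ => ?_
    by_cases hk : b₀.1 k = true <;> simp [hk]
  obtain ⟨χ, hχ⟩ := exists_largest_formula L Y
  refine hp ⟨.exFr h (.and ψ χ), ⟨finStr b₀.1, (finStr_isCompactOmega _).isStructure, b₀.2, h,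
    trivial, ?_⟩, fun M hM hMT v hv hsat φ hφ => ?_⟩
  · rintro _ rfl
    refine (sat_exFr _ _ _ _).2 ⟨CoVal.refl Y, trivial, (CoVal.cons_refl h).symm,
      (sat_and _ _ _ _).2 ⟨(hψ' _ _).2 fun k _ => sat_rel_finStr_refl _ _ _,
        (hχ _ (finStr_isCompactOmega _).isStructure _ trivial).2 (isLargest_refl_finStr _)⟩⟩
  · obtain ⟨w, hw, rfl, hsat'⟩ := (sat_exFr _ _ _ _).1 hsat
    rw [sat_and, hψ', hχ M hM w hw] at hsat'
    refine (sat_finStr_atomTruth_iff hM hsat'.2 φ h).1 (hsub ⟨_, models_finStr_atomTruth hM hMT hsat'.2⟩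
      (hI fun k hk => ?_) φ hφ)
    have : atomTruth M w k = b₀.1 k := by
      rw [Bool.eq_iff_iff, ← hsat'.1 k hk]
      simp [atomTruth]
    change atomTruth M w k ∈ u k
    rw [this]
    exact (hu k hk).2

/-- If a theory has a model with a largest admissible cover, then it has a finite model omitting
countably many given non-isolated types. -/
theorem exists_finite_omits {T : CoTheory L} {M : ProtoStructure L} (hM : M.IsStructure)
    (hT : M.Models T) {w : CoVal Y M.carrier} (hw : M.IsLargest w)
    {F : Set (Σ X : Ctx, CoType L X)} (hF : F.Countable) (hFT : ∀ p ∈ F, ¬ IsIsolatedType T p.2) :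
    ∃ N : ProtoStructure L, N.IsCompactOmega ∧ N.Models T ∧ ∀ p ∈ F, N.Omits p.2 := by
  have := hM.nonempty
  have : Nonempty Y := (w.cosurj (Classical.arbitrary _)).nonempty
  let E := {b : AtomIndex L Y → Bool // (finStr b).Models T}
  have hclosed : IsClosed {b : AtomIndex L Y → Bool | (finStr b).Models T} := by
    simp only [models_finStr_iff]
    exact isClosed_setOf_forall fun φ => isClosed_setOf_forall fun _ =>
      (isClopen_setOf_sat_finStr φ _).isClosed
  have : CompactSpace E := isCompact_iff_compactSpace.1 hclosed.isCompact
  have : Nonempty E := ⟨⟨_, models_finStr_atomTruth hM hT hw⟩⟩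
  have hall : ∀ᶠ b : E in residual E, ∀ p ∈ F, ∀ h : CoVal p.1 Y,
      ¬ ∀ φ ∈ p.2, (finStr b.1).Sat φ h := by
    refine (eventually_countable_ball hF).2 fun p hp => eventually_countable_forall.2 fun h => ?_
    refine residual_of_dense_open ?_ (dense_setOf_not_sat_finStr (hFT p hp) h)
    refine IsClosed.isOpen_compl (s := {b : E | ∀ φ ∈ p.2, (finStr b.1).Sat φ h}) (self := ?_)
    exact isClosed_setOf_forall fun φ => isClosed_setOf_forall fun _ =>
      ((isClopen_setOf_sat_finStr φ h).preimage continuous_subtype_val).isClosed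
  obtain ⟨b, hb⟩ := (dense_of_mem_residual hall).nonempty
  refine ⟨finStr b.1, finStr_isCompactOmega b.1, b.2, fun p hp => ?_⟩
  rintro ⟨h, -, hh⟩
  exact hb p hp h hh

end Finite

/-! ### The omitting types theorem -/

section Omitting

open ProtoStructure

variable {L : FirstOrder.Language}

theorem exists_isLargest_of_finite {M : ProtoStructure L} (hM : M.IsStructure) [Finite M.carrier] :
    ∃ (Y : Ctx) (w : CoVal Y M.carrier), M.IsLargest w := by
  let S : Set ℕ := {n | ∃ Y : Ctx, Y.card = n ∧ (M.adm Y).Nonempty}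
  have hbdd : BddAbove S := by
    refine ⟨Nat.card M.carrier, ?_⟩
    rintro _ ⟨Y, rfl, w, -⟩
    exact CoVal.card_ctx Y ▸ w.card_le
  obtain ⟨X, hX⟩ := hM.adm_nonempty
  obtain ⟨Y, hY, w, hw⟩ := Nat.sSup_mem (s := S) ⟨_, X, rfl, hX⟩ hbdd
  exact ⟨Y, w, hw, fun Z hZ => hY ▸ le_csSup hbdd ⟨Z, rfl, hZ⟩⟩

variable [L.IsRelational] [Countable (Σ n, L.Relations n)]

/-- If some model has a largest admissible cover, Baire category is applied to the finite models in the
context of this cover; otherwise all compact models are infinite and it is applied to `Mod(T)`. -/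
theorem exists_isCompactOmega_omits {T : CoTheory L}
    (hT : ∃ M : ProtoStructure L, M.IsStructure ∧ M.Models T)
    {F : Set (Σ X : Ctx, CoType L X)} (hF : F.Countable) (hFT : ∀ p ∈ F, ¬ IsIsolatedType T p.2) :
    ∃ M : ProtoStructure L, M.IsCompactOmega ∧ M.Models T ∧ ∀ p ∈ F, M.Omits p.2 := by
  by_cases hfin : ∃ (M : ProtoStructure L) (Y : Ctx) (w : CoVal Y M.carrier),
      M.IsStructure ∧ M.Models T ∧ M.IsLargest w
  · obtain ⟨M, Y, w, hM, hMT, hw⟩ := hfin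
    exact exists_finite_omits hM hMT hw hF hFT
  have hinf : ∀ M : ProtoStructure L, M.IsCompactOmega → M.Models T → Infinite M.carrier := by
    intro M hM hMT
    by_contra hcon
    have := not_infinite_iff_finite.1 hcon
    obtain ⟨Y, w, hw⟩ := exists_isLargest_of_finite hM.isStructure
    exact hfin ⟨M, Y, w, hM.isStructure, hMT, hw⟩
  obtain ⟨M, hM, hMT⟩ := hT
  have := nonempty_modT hM hMT hinf
  have := ModT.polishSpace (witnessBound L) T
  have hall : ∀ᶠ μ : ModT (witnessBound L) T in residual (ModT (witnessBound L) T),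
      ∀ p ∈ F, ∀ r ∈ {r : TypeSpace T p.1 | p.2 ⊆ r.1}, μ.1.code.toStr.Omits r.1 :=
    (eventually_countable_ball hF).2 fun p hp =>
      eventually_residual_omits hinf (TypeSpace.isMeagre_setOf_subset (hFT p hp))
  obtain ⟨μ, hμ⟩ := (dense_of_mem_residual hall).nonempty
  refine ⟨μ.1.code.toStr, μ.1.code.isCompactOmega_toStr, μ.2, fun p hp => ?_⟩
  rintro ⟨v, hv, hpv⟩
  exact hμ p hp (TypeSpace.ofVal μ.1.code.isCompactOmega_toStr.isStructure μ.2 hv) hpv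
    ⟨v, hv, fun _ h => h⟩

end Omitting
theorem mainTheorem6 (L : FirstOrder.Language) [L.IsRelational]
    [Countable (Σ n, L.Relations n)] :
    (∃ β : LevelBound L, β.IsAdequate ∧
      ∀ T : CoTheory L,
        PolishSpace (ModT β T) ∧
        ((∀ M : ProtoStructure L, M.IsCompactOmega → M.Models T → Infinite M.carrier) →
          ∀ (X : Ctx) (F : Set (TypeSpace T X)), IsMeagre F →
            ∀ᶠ μ : ModT β T in residual (ModT β T),
              μ.1.1.toStr.IsCompactOmega ∧ μ.1.1.toStr.Models T ∧
                ∀ p ∈ F, μ.1.1.toStr.Omits p.1)) ∧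
    (∀ T : CoTheory L,
      (∀ (X : Ctx) (p : CoType L X), ¬ IsIsolatedType T p →
        IsMeagre {r : TypeSpace T X | p ⊆ r.1}) ∧
      ((∃ M : ProtoStructure L, M.IsStructure ∧ M.Models T) →
        ∀ F : Set (Σ X : Ctx, CoType L X), F.Countable →
          (∀ p ∈ F, ¬ IsIsolatedType T p.2) →
            ∃ M : ProtoStructure L, M.IsCompactOmega ∧ M.Models T ∧
              ∀ p ∈ F, M.Omits p.2)) := by
  refine ⟨⟨witnessBound L, ProtoStructure.isAdequate_witnessBound, fun T =>
    ⟨ModT.polishSpace _ T, fun hT X F hF => ?_⟩⟩, fun T =>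
    ⟨fun X p hp => TypeSpace.isMeagre_setOf_subset hp, fun hT F hF hFT =>
      exists_isCompactOmega_omits hT hF hFT⟩⟩
  exact (eventually_residual_omits hT hF).mono fun μ hμ =>
    ⟨μ.1.code.isCompactOmega_toStr, μ.2, hμ⟩
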